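/- Let $X$ be a compact connected surface without boundary, $u:\widetilde X\to X$ its universal covering, and $T$ a cell decomposition of $X$: it is the projection of a decomposition $\widetilde T$ of $\widetilde X$ into closed disks (the cells) by arcs (the edges) joining pairs of points (the vertices), where $\widetilde T$ is invariant under the covering transformations, no two edges of $\widetilde T$ have a common interior point, two different cells of $\widetilde T$ intersect in the empty set, a vertex or an edge, the sets $V(T),E(T),F(T)$ of projected vertices, edges and cells are finite, and every edge of $T$ is incident to two different vertices. Let $\chi(X)=\#V(T)-\#E(T)+\#F(T)$ be the Euler characteristic of $X$. A chain of edges of $T$ is a nonempty family $(e_1,\dots,e_n)$ of edges together with a continuous, locally injective path $\gamma:[0,n]\to X$ that maps each $[i-1,i]$ injectively onto $e_i$. It is a contractible loop if $\gamma$ is a null-homotopic loop in $X$, and it is then called reduced if for no $0\le i<j\le n$ with $(i,j)\neq(0,n)$ the restriction of $\gamma$ to $[i,j]$ is a null-homotopic loop. A function $\theta:E(T)\to\,]0,\pi[$ is called polyhedral if every reduced contractible loop $(e_1,\dots,e_n)$ of edges satisfies $\sum_{i=1}^n(\pi-\theta(e_i))\ge 2\pi$, with equality if and only if a lift of $\gamma$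 to $\widetilde X$ bounds a cell of $\widetilde T$. Let $S(T)$ be the set of oriented edges, i.e. of pairs $s=(e,v)\in E(T)\times V(T)$ with $v\in e$; write $|s|=e$ and let $-s$ be the pair formed by $e$ and its other vertex. For $\psi:S(T)\to\mathbb R$ put $\widehat\eta(|s|)=\frac12(\psi(s)+\psi(-s)-\theta(|s|))$ and $\widehat\psi(s)=\psi(s)-\widehat\eta(|s|)$. A coherent angle system is a function $\psi:S(T)\to\mathbb R$ such that - $\widehat\psi(s)\in\,]0,\theta(|s|)[$ for all $s\in S(T)$; - for all $e\in E(T)$, $\widehat\eta(e)\in\,]0,\pi-\theta(e)[$ if $\chi(X)>0$, $\widehat\eta(e)=0$ if $\chi(X)=0$, and $\widehat\eta(e)\in\,]-\theta(e),0[$ if $\chi(X)<0$; - $\sum_{s=(e,v)\in S(T)}\psi(s)=\pi$ for every $v\in V(T)$, the sum being over the oriented edges with vertex $v$. Let $\mathcal F_{\Delta,\Sigma}(T,\theta)$ be the set of all coherent angle systems. If $\chi(X)\le 0$ and $\theta$ is polyhedral, then $\mathcal F_{\Delta,\Sigma}(T,\theta)$ is convex and non-empty. -/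

import Mathlib

open Real Set Topology

/-- A cell decomposition (a *map*) of a surface `X`, described upstairs: `u : Y → X` is the universal
covering of `X`, and the decomposition is a decomposition of `Y` into closed disks, cut out by arcs
and invariant under the covering transformations of `u`, which has finitely many vertices, edges and
cells modulo covering transformations. -/
structure CellDecomposition {Y X : Type*} [TopologicalSpace Y] [TopologicalSpace X]
    (u : Y → X) where
  /-- the vertices of the lifted decomposition -/
  verts : Set Y
  /-- the edges of the lifted decomposition -/
  edges : Set (Set Y)
  /-- the cells of the lifted decomposition -/
  cells : Set (Set Y)
  /-- Every edge is an arc joining two vertices, it contains no further vertices, and the edge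
  of `X` below it is incident to two different vertices. -/
  edge_arc : ∀ e ∈ edges, ∃ γ : ℝ → Y, ContinuousOn γ (Icc 0 1) ∧ InjOn γ (Icc 0 1) ∧
    γ '' Icc 0 1 = e ∧ e ∩ verts = {γ 0, γ 1} ∧ u (γ 0) ≠ u (γ 1)
  /-- Two different edges have no common interior point. -/
  edge_inter : ∀ e ∈ edges, ∀ e' ∈ edges, e ≠ e' → e ∩ e' ⊆ verts
  /-- Every cell is a closed topological polygon: a closed disk whose boundary circle is divided
  into `n` arcs that are edges, and whose interior is embedded in `X` and contains no point of a
  vertex or of an edge. -/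
  cell_disk : ∀ f ∈ cells, ∃ (n : ℕ) (Φ : ℂ → Y), 0 < n ∧
    ContinuousOn Φ (Metric.closedBall 0 1) ∧ InjOn Φ (Metric.closedBall 0 1) ∧
    Φ '' Metric.closedBall 0 1 = f ∧
    (∀ k < n, Φ '' ((fun t : ℝ => Complex.exp (2 * π * t * Complex.I)) ''
      Icc ((k : ℝ) / n) (((k : ℝ) + 1) / n)) ∈ edges) ∧
    InjOn u (Φ '' Metric.ball 0 1) ∧
    Disjoint (Φ '' Metric.ball 0 1) verts ∧
    ∀ e ∈ edges, Disjoint (Φ '' Metric.ball 0 1) e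
  /-- The cells cover the surface. -/
  cover : ⋃₀ cells = univ
  /-- Two different cells have nothing, a vertex or an edge in common. -/
  cell_inter : ∀ f ∈ cells, ∀ g ∈ cells, f ≠ g →
    f ∩ g = ∅ ∨ (∃ v ∈ verts, f ∩ g = {v}) ∨ f ∩ g ∈ edges
  /-- Every edge has a cell on each of its two sides. -/
  edge_cells : ∀ e ∈ edges, {f ∈ cells | e ⊆ f}.ncard = 2
  /-- The decomposition is invariant under covering transformations. -/
  deck_verts : ∀ g : Y ≃ₜ Y, (∀ y, u (g y) = u y) → ∀ v ∈ verts, g v ∈ verts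
  deck_edges : ∀ g : Y ≃ₜ Y, (∀ y, u (g y) = u y) → ∀ e ∈ edges, g '' e ∈ edges
  deck_cells : ∀ g : Y ≃ₜ Y, (∀ y, u (g y) = u y) → ∀ f ∈ cells, g '' f ∈ cells
  /-- There are finitely many vertices, edges and cells in `X`. -/
  finite_verts : (u '' verts).Finite
  finite_edges : ((fun e => u '' e) '' edges).Finite
  finite_cells : ((fun f => u '' f) '' cells).Finite

namespace CellDecomposition

variable {Y X : Type*} [TopologicalSpace Y] [TopologicalSpace X] {u : Y → X}

/-- The vertices of the decomposition of `X`. -/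
def V (T : CellDecomposition u) : Set X := u '' T.verts

/-- The edges of the decomposition of `X`. -/
def E (T : CellDecomposition u) : Set (Set X) := (fun e => u '' e) '' T.edges

/-- The cells of the decomposition of `X`. -/
def F (T : CellDecomposition u) : Set (Set X) := (fun f => u '' f) '' T.cells

/-- The Euler characteristic of the decomposed surface. -/
noncomputable def eulerChar (T : CellDecomposition u) : ℤ :=
  (T.V.ncard : ℤ) - (T.E.ncard : ℤ) + (T.F.ncard : ℤ)

/-- `γ : [0, n] → X` is a path along the chain of edges `L = (e₁, …, eₙ)`: it is continuous and
locally injective, and it runs injectively through `eᵢ` on `[i - 1, i]`. -/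
structure IsChainPath (T : CellDecomposition u) (L : List T.E) (γ : ℝ → X) : Prop where
  ne_nil : L ≠ []
  cont : ContinuousOn γ (Icc 0 (L.length : ℝ))
  loc_inj : ∀ t ∈ Icc (0 : ℝ) L.length, ∃ U ∈ 𝓝 t, InjOn γ (U ∩ Icc 0 (L.length : ℝ))
  inj : ∀ i : Fin L.length, InjOn γ (Icc (i : ℝ) ((i : ℝ) + 1))
  image : ∀ i : Fin L.length, γ '' Icc (i : ℝ) ((i : ℝ) + 1) = (L.get i : Set X)

/-- The restriction of `γ` to `[a, b]` is a loop which is contractible in `X`. -/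
def IsContractibleLoopOn (γ : ℝ → X) (a b : ℝ) : Prop :=
  ∃ (x : X) (p : Path x x), (∀ t : unitInterval, p t = γ (a + t * (b - a))) ∧
    p.Homotopic (Path.refl x)

/-- `L`, travelled along `γ`, is a reduced contractible loop of edges: a contractible loop no proper
segment `(eᵢ₊₁, …, eⱼ)` of which is a contractible loop. Equivalently, the lifts of `γ` to the
universal covering are simple closed curves. -/
def IsReducedContractibleLoop (T : CellDecomposition u) (L : List T.E) (γ : ℝ → X) : Prop :=
  T.IsChainPath L γ ∧ IsContractibleLoopOn γ 0 L.length ∧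
    ∀ i j : ℕ, i < j → j ≤ L.length → (i, j) ≠ (0, L.length) → ¬ IsContractibleLoopOn γ i j

/-- The boundary of a cell of the lifted decomposition: the union of its edges. -/
def boundary (T : CellDecomposition u) (f : Set Y) : Set Y := ⋃₀ {e ∈ T.edges | e ⊆ f}

/-- A lift of `γ : [0, n] → X` to the universal covering bounds a cell of the lifted
decomposition. -/
def LiftBoundsCell (T : CellDecomposition u) (γ : ℝ → X) (n : ℕ) : Prop :=
  ∃ (γ' : ℝ → Y), ContinuousOn γ' (Icc 0 (n : ℝ)) ∧ (∀ t ∈ Icc (0 : ℝ) n, u (γ' t) = γ t) ∧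
    ∃ f ∈ T.cells, γ' '' Icc 0 (n : ℝ) = T.boundary f

/-- Polyhedral weight functions: on every reduced contractible loop of edges the sum of the
`π - θ(eᵢ)` is at least `2π`, with equality if and only if a lift of the loop bounds a cell. -/
def IsPolyhedral (T : CellDecomposition u) (θ : T.E → ℝ) : Prop :=
  (∀ e, θ e ∈ Ioo 0 π) ∧
  ∀ (L : List T.E) (γ : ℝ → X), T.IsReducedContractibleLoop L γ →
    2 * π ≤ (L.map fun e => π - θ e).sum ∧
    ((L.map fun e => π - θ e).sum = 2 * π ↔ T.LiftBoundsCell γ L.length)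

/-- The oriented edges: pairs of an edge and a vertex incident to it. -/
def S (T : CellDecomposition u) : Type _ := {s : T.E × T.V // (s.2 : X) ∈ (s.1 : Set X)}

/-- The edge of an oriented edge. -/
def edge {T : CellDecomposition u} (s : T.S) : T.E := s.1.1

/-- The vertex of an oriented edge. -/
def vertex {T : CellDecomposition u} (s : T.S) : T.V := s.1.2

theorem exists_rev {T : CellDecomposition u} (s : T.S) :
    ∃ s' : T.S, edge s' = edge s ∧ vertex s' ≠ vertex s := by
  obtain ⟨⟨⟨_, e, he, rfl⟩, v⟩, hv⟩ := s
  obtain ⟨γ, -, -, -, hV, hne⟩ := T.edge_arc e he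
  have h0 : γ 0 ∈ e ∩ T.verts := by rw [hV]; simp
  have h1 : γ 1 ∈ e ∩ T.verts := by rw [hV]; simp
  by_cases h : u (γ 0) = v
  · refine ⟨⟨(⟨_, e, he, rfl⟩, ⟨u (γ 1), γ 1, h1.2, rfl⟩), γ 1, h1.1, rfl⟩, rfl, ?_⟩
    intro h'
    exact hne (h.trans (congrArg Subtype.val h').symm)
  · refine ⟨⟨(⟨_, e, he, rfl⟩, ⟨u (γ 0), γ 0, h0.2, rfl⟩), γ 0, h0.1, rfl⟩, rfl, ?_⟩
    intro h'
    exact h (congrArg Subtype.val h')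

/-- The oppositely oriented edge `-s`: the same edge with its other vertex. -/
noncomputable def rev {T : CellDecomposition u} (s : T.S) : T.S := (exists_rev s).choose

/-- `η̂(e) = (ψ(s) + ψ(-s) - θ(e)) / 2`, where `e` is the edge of `s`. -/
noncomputable def etaHat {T : CellDecomposition u} (θ : T.E → ℝ) (ψ : T.S → ℝ) (s : T.S) : ℝ :=
  (ψ s + ψ (rev s) - θ (edge s)) / 2

/-- `ψ̂(s) = ψ(s) - η̂(e)`, where `e` is the edge of `s`. -/
noncomputable def psiHat {T : CellDecomposition u} (θ : T.E → ℝ) (ψ : T.S → ℝ) (s : T.S) : ℝ :=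
  ψ s - etaHat θ ψ s

/-- The range prescribed for `η̂(e)`, in terms of the Euler characteristic `χ` and `t = θ(e)`. -/
noncomputable def etaRange (χ : ℤ) (t : ℝ) : Set ℝ :=
  if 0 < χ then Ioo 0 (π - t) else if χ = 0 then {0} else Ioo (-t) 0

/-- The set `F_Δ(T, θ)`. -/
def FDelta (T : CellDecomposition u) (θ : T.E → ℝ) : Set (T.S → ℝ) :=
  {ψ | ∀ s : T.S, psiHat θ ψ s ∈ Ioo 0 (θ (edge s)) ∧
    etaHat θ ψ s ∈ etaRange T.eulerChar (θ (edge s))}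

/-- The set `F_{Δ,Σ}(T, θ)` of coherent angle systems. -/
def FDeltaSigma (T : CellDecomposition u) (θ : T.E → ℝ) : Set (T.S → ℝ) :=
  {ψ ∈ T.FDelta θ | ∀ v : T.V, ∑ᶠ (s : T.S) (_ : vertex s = v), ψ s = π}

end CellDecomposition

/-!
Convexity is clear: the conditions on `ψ` are linear and the ranges are intervals or points.

For `χ ≤ 0`, a coherent angle system amounts to positive angles at the two ends of every edge `e`
whose sum is `θ e` if `χ = 0`, less than `θ e` if `χ < 0`, and which add up to `π` at every vertex.
So the edges supply `θ e` each and the vertices demand `π` each, and such a distribution exists as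
soon as the edges that meet a nonempty set `A` of vertices supply more than `π * |A|` (with equality
for the full vertex set if `χ = 0`). This feasible-flow theorem is proved in `exists_vertexSum_ge` by
minimizing the sum of the squares of the vertex sums.

Put `w = π - θ`. As the boundary of each cell has weight `2 * π` and each edge lies on two cells,
`∑ w = π * |F|` (`IsPolyhedralWeight.sum_eq`), and the supply condition for `A` turns into a lower
bound for the weight of the edges that do not meet `A` (`IsPolyhedralWeight.lt_sum_compl`). For the
full vertex set it follows from `χ ≤ 0`. For a proper nonempty set `A`, omit one edge for each of
its vertices from the edges that meet `A`, such that going around the vertices replaces crossing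
the omitted edges (`exists_spanning`); let `Q` be the set of edges that remain. The graph with the
cells as its vertices and `Q` as its edges has at least `|F| - |Q|` components that are trees; they
lift to finite, pairwise independent sets of cells of the universal covering
(`exists_independent`). The boundary of such a set is a cycle modulo two, consists of edges over
those that do not meet `A`, and contains a simple cycle; hence its weight is at least `2 * π`.
Together the boundaries use each edge that does not meet `A` at most twice. This gives the bound, and
the strict inequality comes from the case of equality in the polyhedral condition: all boundaries
would be boundaries of cells, which is excluded by `χ ≤ 0` or by connectedness.

This argument is carried out for an abstract combinatorial structure, `PeriodicMap`. Topology is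
needed to show that a cell decomposition is one (`CellDecomposition.periodicMap`), where the main
point is that a discrete set does not disconnect a surface, so that any two cells are joined by a
chain of cells with common edges (`CellDecomposition.dual_conn`), and that a simple cycle of edges
upstairs projects to a reduced contractible loop of edges
(`CellDecomposition.isReducedContractibleLoop`), so that the polyhedral condition applies to it.
-/

/-! ### Simple cycles, periodic maps and parity -/

/-- `v 0, e 0, v 1, e 1, …, e (n - 1), v n = v 0` is a simple closed edge path of length `n ≥ 2` in
the multigraph with incidence relation `inc`; the values of `v` and `e` beyond that range are
irrelevant. -/
structure IsCycle {V E : Type*} (inc : V → E → Prop) (n : ℕ) (v : ℕ → V) (e : ℕ → E) : Prop where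
  two_le : 2 ≤ n
  closed : v n = v 0
  ends : ∀ i < n, ∀ x, inc x (e i) ↔ x = v i ∨ x = v (i + 1)
  inj_v : InjOn v (Iio n)
  inj_e : InjOn e (Iio n)

namespace IsCycle

variable {V E : Type*} {inc : V → E → Prop} {n : ℕ} {v : ℕ → V} {e : ℕ → E}

theorem exists_two (h : IsCycle inc n v e) {k : ℕ} (hk : k < n) :
    ∃ i < n, ∃ j < n, i ≠ j ∧ ∀ m < n, inc (v k) (e m) ↔ m = i ∨ m = j := by
  have h2 := h.two_le
  have key : ∀ m < n, (inc (v k) (e m) ↔ k = m ∨ (m + 1 = n ∧ k = 0) ∨ m + 1 = k) := by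
    intro m hm
    rw [h.ends m hm]
    have h1 : v k = v m ↔ k = m := ⟨fun h' => h.inj_v hk hm h', fun h' => by rw [h']⟩
    have h3 : v k = v (m + 1) ↔ (m + 1 = n ∧ k = 0) ∨ m + 1 = k := by
      constructor
      · intro h'
        rcases Nat.lt_or_ge (m + 1) n with hlt | hge
        · exact Or.inr (h.inj_v hk hlt h').symm
        · have hmn : m + 1 = n := by omega
          rw [hmn, h.closed] at h'
          exact Or.inl ⟨hmn, h.inj_v hk (by simp only [mem_Iio]; omega) h'⟩
      · rintro (⟨h', rfl⟩ | rfl)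
        · rw [h', h.closed]
        · rfl
    rw [h1, h3]
  rcases Nat.eq_zero_or_pos k with rfl | hpos
  · refine ⟨0, by omega, n - 1, by omega, by omega, fun m hm => ?_⟩
    rw [key m hm]; omega
  · refine ⟨k, hk, k - 1, by omega, by omega, fun m hm => ?_⟩
    rw [key m hm]; omega

/-- A vertex is an end of no or of two edges of a cycle. -/
theorem none_or_two (h : IsCycle inc n v e) (x : V) :
    (∀ m < n, ¬ inc x (e m)) ∨
      ∃ i < n, ∃ j < n, i ≠ j ∧ ∀ m < n, inc x (e m) ↔ m = i ∨ m = j := by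
  by_cases hx : ∃ k < n, x = v k
  · obtain ⟨k, hk, rfl⟩ := hx
    exact Or.inr (h.exists_two hk)
  · refine Or.inl fun m hm hinc => hx ?_
    rcases (h.ends m hm x).1 hinc with rfl | rfl
    · exact ⟨m, hm, rfl⟩
    · rcases Nat.lt_or_ge (m + 1) n with hlt | hge
      · exact ⟨m + 1, hlt, rfl⟩
      · exact ⟨0, by omega, by rw [← h.closed]; congr 1; omega⟩

end IsCycle

/-- The combinatorics of a cell decomposition of a surface together with its lift to a covering
surface: `V' E' F'` are the vertices, edges and faces upstairs, `V E F` their orbits under the group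
`Γ`. -/
structure PeriodicMap (Γ V' E' F' V E F : Type*) [Group Γ]
    [MulAction Γ V'] [MulAction Γ E'] [MulAction Γ F'] where
  /-- incidence of vertices and edges -/
  onE : V' → E' → Prop
  /-- incidence of edges and faces -/
  onF : E' → F' → Prop
  /-- the orbit of a vertex -/
  pV : V' → V
  /-- the orbit of an edge -/
  pE : E' → E
  /-- the orbit of a face -/
  pF : F' → F
  pV_surj : Function.Surjective pV
  pE_surj : Function.Surjective pE
  pF_surj : Function.Surjective pF
  pV_eq : ∀ x y, pV x = pV y ↔ ∃ g : Γ, g • x = y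
  pE_eq : ∀ x y, pE x = pE y ↔ ∃ g : Γ, g • x = y
  pF_eq : ∀ x y, pF x = pF y ↔ ∃ g : Γ, g • x = y
  free_V : ∀ (g : Γ) (x : V'), g • x = x → g = 1
  free_F : ∀ (g : Γ) (x : F'), g • x = x → g = 1
  onE_smul : ∀ (g : Γ) v e, onE v e → onE (g • v) (g • e)
  onF_smul : ∀ (g : Γ) e f, onF e f → onF (g • e) (g • f)
  /-- The ends of an edge are different downstairs already: there are no loops. -/
  edge_ends : ∀ e, ∃ v w, pV v ≠ pV w ∧ ∀ x, onE x e ↔ x = v ∨ x = w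
  edge_faces : ∀ e, ∃ f g, f ≠ g ∧ ∀ x, onF e x ↔ x = f ∨ x = g
  face_cycle : ∀ f, ∃ n v e, IsCycle onE n v e ∧ ∀ x, onF x f ↔ ∃ i < n, e i = x
  exists_edge : ∀ v, ∃ e, onE v e
  /-- the graph of faces and edges is connected -/
  dual_conn : ∀ K : Set F', (∀ e f f', onF e f → onF e f' → f ∈ K → f' ∈ K) → K = ∅ ∨ K = univ

namespace PeriodicMap

open Classical in
/-- More edges than vertices contain a nonempty cycle modulo two, because two of the subsets of `Z`
have the same degree parities at all vertices in `W`. -/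
theorem exists_even_subset {V E : Type*} (inc : V → E → Prop) (W : Finset V) (Z : Finset E)
    (h : W.card < Z.card) :
    ∃ Y ⊆ Z, Y.Nonempty ∧ ∀ v ∈ W, Even (Y.filter (inc v)).card := by
  have hcard : W.powerset.card < Z.powerset.card := by
    rw [Finset.card_powerset, Finset.card_powerset]
    exact Nat.pow_lt_pow_right (by norm_num) h
  obtain ⟨Y₁, h₁, Y₂, h₂, hne, heq⟩ := Finset.exists_ne_map_eq_of_card_lt_of_maps_to hcard
    (f := fun Y => W.filter fun v => Odd (Y.filter (inc v)).card)
    (fun Y _ => Finset.mem_powerset.2 (Finset.filter_subset _ _))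
  rw [Finset.mem_powerset] at h₁ h₂
  refine ⟨symmDiff Y₁ Y₂, ?_, ?_, fun v hv => ?_⟩
  · intro x hx
    rcases Finset.mem_symmDiff.1 hx with hx | hx
    · exact h₁ hx.1
    · exact h₂ hx.1
  · rw [Finset.nonempty_iff_ne_empty]
    intro h0
    exact hne (symmDiff_eq_bot.1 h0)
  · have hodd : Odd (Y₁.filter (inc v)).card ↔ Odd (Y₂.filter (inc v)).card := by
      have := Finset.ext_iff.1 heq v
      simpa [hv] using this
    have e1 : (symmDiff Y₁ Y₂).filter (inc v) =
        symmDiff (Y₁.filter (inc v)) (Y₂.filter (inc v)) := by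
      ext x; simp only [Finset.mem_filter, Finset.mem_symmDiff]; tauto
    set P := Y₁.filter (inc v)
    set R := Y₂.filter (inc v)
    have e2 : (symmDiff P R).card = (P \ R).card + (R \ P).card := by
      rw [symmDiff_def, Finset.sup_eq_union, Finset.card_union_of_disjoint]
      exact Finset.disjoint_left.2 fun x hx hx' => by
        simp only [Finset.mem_sdiff] at hx hx'; exact hx.2 hx'.1
    have e3 := Finset.card_sdiff_add_card_inter P R
    have e4 := Finset.card_sdiff_add_card_inter R P
    rw [Finset.inter_comm R P] at e4
    rw [e1, e2]
    rw [← e3, ← e4] at hodd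
    simp only [← Nat.not_even_iff_odd, Nat.even_add] at hodd ⊢
    tauto

variable {Γ V' E' F' V E F : Type*} [Group Γ]
  [MulAction Γ V'] [MulAction Γ E'] [MulAction Γ F'] (M : PeriodicMap Γ V' E' F' V E F)

theorem pV_smul (g : Γ) (x : V') : M.pV (g • x) = M.pV x := ((M.pV_eq _ _).2 ⟨g, rfl⟩).symm

theorem pE_smul (g : Γ) (x : E') : M.pE (g • x) = M.pE x := ((M.pE_eq _ _).2 ⟨g, rfl⟩).symm

theorem pF_smul (g : Γ) (x : F') : M.pF (g • x) = M.pF x := ((M.pF_eq _ _).2 ⟨g, rfl⟩).symm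

theorem onF_smul_iff (g : Γ) (e : E') (f : F') : M.onF (g • e) (g • f) ↔ M.onF e f :=
  ⟨fun h => by simpa using M.onF_smul g⁻¹ _ _ h, M.onF_smul g e f⟩

theorem smul_F_inj (M : PeriodicMap Γ V' E' F' V E F) {g h : Γ} {f : F'} (hf : g • f = h • f) :
    g = h := by
  have := M.free_F (h⁻¹ * g) f (by rw [mul_smul, hf, inv_smul_smul])
  exact (inv_mul_eq_one.1 this).symm

/-- The ends of an edge are distinguished by their orbits, because no edge is a loop downstairs. -/
theorem ends_inj {e : E'} {x y : V'} (hx : M.onE x e) (hy : M.onE y e) (h : M.pV x = M.pV y) :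
    x = y := by
  obtain ⟨v, w, hne, hvw⟩ := M.edge_ends e
  rcases (hvw x).1 hx with rfl | rfl <;> rcases (hvw y).1 hy with rfl | rfl
  · rfl
  · exact absurd h hne
  · exact absurd h.symm hne
  · rfl

/-- Different edges at a vertex lie in different orbits, so that stars are finite. -/
theorem star_inj {v : V'} {e e' : E'} (he : M.onE v e) (he' : M.onE v e') (h : M.pE e = M.pE e') :
    e = e' := by
  obtain ⟨g, rfl⟩ := (M.pE_eq _ _).1 h
  have h1 : M.onE (g⁻¹ • v) e := by simpa using M.onE_smul g⁻¹ _ _ he'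
  have h2 := M.ends_inj h1 he (M.pV_smul _ _)
  rw [inv_eq_one.1 (M.free_V _ _ h2), one_smul]

theorem free_E (M : PeriodicMap Γ V' E' F' V E F) {g : Γ} {e : E'} (h : g • e = e) : g = 1 := by
  obtain ⟨v, w, -, hvw⟩ := M.edge_ends e
  have hv : M.onE v e := (hvw v).2 (Or.inl rfl)
  have h1 := M.onE_smul g _ _ hv
  rw [h] at h1
  exact M.free_V g v (M.ends_inj h1 hv (M.pV_smul _ _))

theorem star_finite [Finite E] (v : V') : {e | M.onE v e}.Finite :=
  Set.Finite.of_finite_image (f := M.pE) (Set.toFinite _)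
    fun _ h _ h' heq => M.star_inj h h' heq

/-- The edges at a vertex. -/
noncomputable def star [Finite E] (v : V') : Finset E' := (M.star_finite v).toFinset

@[simp] theorem mem_star [Finite E] {v : V'} {e : E'} : e ∈ M.star v ↔ M.onE v e := by simp [star]

theorem faces_finite (e : E') : {f | M.onF e f}.Finite := by
  obtain ⟨f, g, -, h⟩ := M.edge_faces e
  exact (Set.toFinite {f, g}).subset fun x hx => (h x).1 hx

/-- The two faces at an edge. -/
noncomputable def faces (e : E') : Finset F' := (M.faces_finite e).toFinset

@[simp] theorem mem_faces {e : E'} {f : F'} : f ∈ M.faces e ↔ M.onF e f := by simp [faces]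

theorem card_faces (e : E') : (M.faces e).card = 2 := by
  classical
  obtain ⟨f, g, hne, h⟩ := M.edge_faces e
  have : M.faces e = {f, g} := by ext x; simp [h]
  rw [this, Finset.card_pair hne]

theorem edges_finite (f : F') : {e | M.onF e f}.Finite := by
  obtain ⟨n, v, e, -, h⟩ := M.face_cycle f
  refine ((Set.finite_Iio n).image e).subset fun x hx => ?_
  obtain ⟨i, hi, rfl⟩ := (h x).1 hx
  exact ⟨i, hi, rfl⟩

/-- The edges of a face. -/
noncomputable def edges (f : F') : Finset E' := (M.edges_finite f).toFinset

@[simp] theorem mem_edges {f : F'} {e : E'} : e ∈ M.edges f ↔ M.onF e f := by simp [edges]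

open Classical in
/-- A face has no or two edges at a given vertex. -/
theorem corner (f : F') (v : V') :
    (M.edges f).filter (M.onE v) = ∅ ∨ ((M.edges f).filter (M.onE v)).card = 2 := by
  obtain ⟨n, u, e, hc, h⟩ := M.face_cycle f
  rcases hc.none_or_two v with h0 | ⟨i, hi, j, hj, hij, h2⟩
  · left
    rw [Finset.filter_eq_empty_iff]
    intro x hx hv
    obtain ⟨m, hm, rfl⟩ := (h x).1 (M.mem_edges.1 hx)
    exact h0 m hm hv
  · right
    have : (M.edges f).filter (M.onE v) = {e i, e j} := by
      ext x
      simp only [Finset.mem_filter, mem_edges, h, Finset.mem_insert, Finset.mem_singleton]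
      constructor
      · rintro ⟨⟨m, hm, rfl⟩, hv⟩
        rcases (h2 m hm).1 hv with rfl | rfl <;> simp
      · rintro (rfl | rfl)
        · exact ⟨⟨i, hi, rfl⟩, (h2 i hi).2 (Or.inl rfl)⟩
        · exact ⟨⟨j, hj, rfl⟩, (h2 j hj).2 (Or.inr rfl)⟩
    rw [this, Finset.card_pair fun h' => hij (hc.inj_e hi hj h')]

/-- `K` is not separated from its complement by the edge `e`: it contains both faces at `e` or
none of them. -/
def Crosses (K : Set F') (e : E') : Prop := ∀ f f', M.onF e f → M.onF e f' → f ∈ K → f' ∈ K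

open Classical in
theorem crosses_iff_even (K : Set F') (e : E') :
    M.Crosses K e ↔ Even ((M.faces e).filter (· ∈ K)).card := by
  obtain ⟨f, g, hne, h⟩ := M.edge_faces e
  have : M.faces e = {f, g} := by ext x; simp [h]
  rw [this]
  have hf : M.onF e f := (h f).2 (Or.inl rfl)
  have hg : M.onF e g := (h g).2 (Or.inr rfl)
  by_cases h1 : f ∈ K <;> by_cases h2 : g ∈ K <;>
    simp only [Finset.filter_insert, Finset.filter_singleton, h1, h2, if_true, if_false]
  · rw [Finset.card_pair hne]
    simp only [even_two, iff_true]
    intro a b _ hb _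
    rcases (h b).1 hb with rfl | rfl <;> assumption
  · simp only [insert_empty_eq, Finset.card_singleton, Nat.not_even_one, iff_false]
    exact fun hc => h2 (hc f g hf hg h1)
  · simp only [Finset.card_singleton, Nat.not_even_one, iff_false]
    exact fun hc => h1 (hc g f hg hf h2)
  · simp only [Finset.card_empty, Even.zero, iff_true]
    intro a b ha _ haK
    rcases (h a).1 ha with rfl | rfl <;> contradiction

open Classical in
/-- Each vertex is an end of an even number of the edges that separate a set of faces from its
complement, because each face has no or two edges at the vertex. -/
theorem even_card_not_crosses [Finite E] (K : Set F') (v : V') :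
    Even ((M.star v).filter fun e => ¬ M.Crosses K e).card := by
  have h1 : ((M.star v).filter fun e => ¬ M.Crosses K e) =
      (M.star v).filter fun e => Odd ((M.faces e).filter (· ∈ K)).card := by
    refine Finset.filter_congr fun e _ => ?_
    rw [M.crosses_iff_even, Nat.not_even_iff_odd]
  rw [h1, ← Finset.even_sum_iff_even_card_odd]
  set D := ((M.star v).biUnion M.faces).filter (· ∈ K) with hD
  have h2 : ∀ e ∈ M.star v, (M.faces e).filter (· ∈ K) = D.bipartiteAbove M.onF e := by
    intro e he
    ext f
    simp only [Finset.mem_filter, mem_faces, Finset.mem_bipartiteAbove, hD, Finset.mem_biUnion]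
    constructor
    · rintro ⟨h, hK⟩; exact ⟨⟨⟨e, he, h⟩, hK⟩, h⟩
    · rintro ⟨⟨-, hK⟩, h⟩; exact ⟨h, hK⟩
  rw [Finset.sum_congr rfl fun e he => by rw [h2 e he],
    Finset.sum_card_bipartiteAbove_eq_sum_card_bipartiteBelow]
  refine Finset.even_sum _ fun f _ => ?_
  have h3 : (M.star v).bipartiteBelow M.onF f = (M.edges f).filter (M.onE v) := by
    ext e; simp [Finset.mem_bipartiteBelow, and_comm]
  rw [h3]
  rcases M.corner f v with h | h
  · rw [h]; simp
  · rw [h]; simp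

/-- A set of faces that is not separated by the edges at a vertex, one of them excepted, is not
separated by that edge either. -/
theorem crosses_of_others [Finite E] {K : Set F'} {v : V'} {e : E'} (he : M.onE v e)
    (h : ∀ e', M.onE v e' → e' ≠ e → M.Crosses K e') : M.Crosses K e := by
  classical
  by_contra hcon
  have h1 : ((M.star v).filter fun e => ¬ M.Crosses K e) = {e} := by
    ext x
    simp only [Finset.mem_filter, mem_star, Finset.mem_singleton]
    constructor
    · rintro ⟨hx, hn⟩
      by_contra hne
      exact hn (h x hx hne)
    · rintro rfl; exact ⟨he, hcon⟩
  have := M.even_card_not_crosses K v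
  rw [h1] at this
  simp at this

/-- The edges that separate a finite set of faces from its complement. -/
noncomputable def bd (K : Finset F') : Finset E' := by
  classical exact (K.biUnion M.edges).filter fun e => ¬ M.Crosses (K : Set F') e

theorem mem_bd {K : Finset F'} {e : E'} : e ∈ M.bd K ↔ ¬ M.Crosses (K : Set F') e := by
  classical
  simp only [bd, Finset.mem_filter, Finset.mem_biUnion, mem_edges, and_iff_right_iff_imp]
  intro h
  simp only [Crosses, not_forall] at h
  obtain ⟨f, f', hf, hf', hK, -⟩ := h
  exact ⟨f, hK, hf⟩

/-- A cycle modulo two: each vertex is an end of an even number of the edges in `Z`. -/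
def IsEven (Z : Finset E') : Prop := by
  classical exact ∀ v, Even (Z.filter (M.onE v)).card

theorem isEven_bd [Finite E] (K : Finset F') : M.IsEven (M.bd K) := by
  classical
  intro v
  convert M.even_card_not_crosses (K : Set F') v using 2
  ext e
  simp only [Finset.mem_filter, mem_bd, mem_star, and_comm]

theorem onE_iff {e : E'} {v w : V'} (hv : M.onE v e) (hw : M.onE w e) (hne : w ≠ v) (x : V') :
    M.onE x e ↔ x = v ∨ x = w := by
  obtain ⟨a, b, -, h⟩ := M.edge_ends e
  rw [h]
  rcases (h v).1 hv with rfl | rfl <;> rcases (h w).1 hw with rfl | rfl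
  · exact absurd rfl hne
  · rfl
  · exact or_comm
  · exact absurd rfl hne

/-- A nonempty cycle modulo two contains a simple cycle. -/
theorem exists_cycle {Z : Finset E'} (hZ : M.IsEven Z) (hne : Z.Nonempty) :
    ∃ n v e, IsCycle M.onE n v e ∧ ∀ i < n, e i ∈ Z := by
  classical
  let St := {s : V' × E' // s.2 ∈ Z ∧ M.onE s.1 s.2}
  have step : ∀ s : St, ∃ t : St, M.onE t.1.1 s.1.2 ∧ t.1.1 ≠ s.1.1 ∧ t.1.2 ≠ s.1.2 := by
    rintro ⟨⟨v, e⟩, he, hve⟩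
    obtain ⟨a, b, hab, h⟩ := M.edge_ends e
    have hab' : a ≠ b := fun h => hab (by rw [h])
    obtain ⟨w, hwe, hwv⟩ : ∃ w, M.onE w e ∧ w ≠ v := by
      rcases (h v).1 hve with rfl | rfl
      · exact ⟨b, (h b).2 (Or.inr rfl), hab'.symm⟩
      · exact ⟨a, (h a).2 (Or.inl rfl), hab'⟩
    have hmem : e ∈ Z.filter (M.onE w) := Finset.mem_filter.2 ⟨he, hwe⟩
    have hcard : 1 < (Z.filter (M.onE w)).card := by
      have h0 := Finset.card_pos.2 ⟨e, hmem⟩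
      obtain ⟨k, hk⟩ := hZ w
      omega
    obtain ⟨e', he', hne'⟩ := Finset.exists_mem_ne hcard e
    rw [Finset.mem_filter] at he'
    exact ⟨⟨(w, e'), he'⟩, hwe, hwv, hne'⟩
  -- A walk in `Z` that never turns back repeats a vertex; up to the first repetition it is simple.
  choose next hn1 hn2 hn3 using step
  obtain ⟨e₀, he₀⟩ := hne
  obtain ⟨a₀, b₀, -, h₀⟩ := M.edge_ends e₀
  let s : ℕ → St := fun i => next^[i] ⟨(a₀, e₀), he₀, (h₀ a₀).2 (Or.inl rfl)⟩
  have hs : ∀ i, s (i + 1) = next (s i) := fun i => Function.iterate_succ_apply' next i _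
  let v : ℕ → V' := fun i => (s i).1.1
  let e : ℕ → E' := fun i => (s i).1.2
  have hve : ∀ i, M.onE (v i) (e i) := fun i => (s i).2.2
  have heZ : ∀ i, e i ∈ Z := fun i => (s i).2.1
  have hve' : ∀ i, M.onE (v (i + 1)) (e i) := fun i => by
    change M.onE (s (i + 1)).1.1 _; rw [hs]; exact hn1 _
  have hvne : ∀ i, v (i + 1) ≠ v i := fun i => by
    change (s (i + 1)).1.1 ≠ _; rw [hs]; exact hn2 _
  have hene : ∀ i, e (i + 1) ≠ e i := fun i => by
    change (s (i + 1)).1.2 ≠ _; rw [hs]; exact hn3 _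
  have hends : ∀ i x, M.onE x (e i) ↔ x = v i ∨ x = v (i + 1) := fun i x =>
    M.onE_iff (hve i) (hve' i) (hvne i) x
  have hfin : (⋃ e ∈ Z, {x | M.onE x e}).Finite := by
    refine Set.Finite.biUnion Z.finite_toSet fun e _ => ?_
    obtain ⟨a, b, -, h⟩ := M.edge_ends e
    exact (Set.toFinite {a, b}).subset fun x hx => (h x).1 hx
  have hrep : ∃ j, ∃ i < j, v i = v j := by
    by_contra! hcon
    have hinj : Function.Injective v := by
      intro i j hij
      rcases lt_trichotomy i j with h | h | h
      · exact absurd hij (hcon j i h)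
      · exact h
      · exact absurd hij.symm (hcon i j h)
    exact Set.infinite_of_injective_forall_mem hinj
      (fun i => Set.mem_biUnion (heZ i) (hve i)) hfin
  obtain ⟨i, hij, hvij⟩ := Nat.find_spec hrep
  set j := Nat.find hrep with hj
  have hmin : ∀ a b, a < b → b < j → v a ≠ v b := fun a b hab hb h =>
    Nat.find_min hrep hb ⟨a, hab, h⟩
  have hinjv : ∀ a b, a < j → b < j → v a = v b → a = b := by
    intro a b ha hb h
    rcases lt_trichotomy a b with h' | h' | h'
    · exact absurd h (hmin a b h' hb)
    · exact h'
    · exact absurd h.symm (hmin b a h' ha)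
  have hlt : ∀ a b, a < b → b < j → e a ≠ e b := by
    intro a b hab hb h
    have h1 := (hends a (v b)).1 (by rw [h]; exact hve b)
    rcases h1 with h1 | h1
    · have := hinjv b a hb (by omega) h1; omega
    · have := hinjv b (a + 1) hb (by omega) h1
      subst this
      exact hene a h.symm
  refine ⟨j - i, fun k => v (i + k), fun k => e (i + k), ⟨?_, ?_, ?_, ?_, ?_⟩, fun k _ => heZ _⟩
  · by_contra hcon
    have : j = i + 1 := by omega
    rw [this] at hvij
    exact hvne i hvij.symm
  · rw [show i + (j - i) = j by omega, Nat.add_zero, hvij]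
  · intro k _ x
    exact hends (i + k) x
  · intro a ha b hb h
    rw [mem_Iio] at ha hb
    have := hinjv (i + a) (i + b) (by omega) (by omega) h
    omega
  · intro a ha b hb h
    rw [mem_Iio] at ha hb
    rcases lt_trichotomy a b with h' | h' | h'
    · exact absurd h (hlt _ _ (by omega) (by omega))
    · exact h'
    · exact absurd h.symm (hlt _ _ (by omega) (by omega))

end PeriodicMap

/-! ### Independent families of sets of faces and polyhedral weights -/

namespace PeriodicMap

variable {Γ V' E' F' V E F : Type*} [Group Γ]
  [MulAction Γ V'] [MulAction Γ E'] [MulAction Γ F'] (M : PeriodicMap Γ V' E' F' V E F)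

theorem crosses_iff {K : Set F'} {e : E'} {a b : F'} (h : ∀ x, M.onF e x ↔ x = a ∨ x = b) :
    M.Crosses K e ↔ (a ∈ K ↔ b ∈ K) := by
  have ha := (h a).2 (Or.inl rfl)
  have hb := (h b).2 (Or.inr rfl)
  constructor
  · exact fun hc => ⟨hc a b ha hb, hc b a hb ha⟩
  · intro hK x y hx hy
    rcases (h x).1 hx with rfl | rfl <;> rcases (h y).1 hy with rfl | rfl <;> tauto

theorem faces_smul {e : E'} {a b : F'} (h : ∀ x, M.onF e x ↔ x = a ∨ x = b) (g : Γ) (x : F') :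
    M.onF (g • e) x ↔ x = g • a ∨ x = g • b := by
  rw [← M.onF_smul_iff g⁻¹, inv_smul_smul, h, inv_smul_eq_iff, inv_smul_eq_iff]

/-- A family of finite sets of faces that are not separated by the edges over `Q`, and whose
disjoint union embeds into the set of faces downstairs. -/
structure IsIndependent (Q : Finset E) (𝒦 : Finset (Finset F')) : Prop where
  nonempty : ∀ K ∈ 𝒦, K.Nonempty
  crosses : ∀ K ∈ 𝒦, ∀ e, M.pE e ∈ Q → M.Crosses (K : Set F') e
  inj : ∀ K ∈ 𝒦, ∀ K' ∈ 𝒦, ∀ x ∈ K, ∀ x' ∈ K', M.pF x = M.pF x' → K = K' ∧ x = x'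

/-- For `Q = ∅`, representatives of all faces form an independent family. -/
theorem exists_singletons [Fintype F] : ∃ 𝒦, M.IsIndependent ∅ 𝒦 ∧ 𝒦.card = Fintype.card F ∧
    (∀ K ∈ 𝒦, ∃ f, K = {f}) ∧ ∀ f, ∃ K ∈ 𝒦, ∃ g : Γ, g • f ∈ K := by
  classical
  set r := Function.surjInv M.pF_surj with hr
  have hpr : ∀ f, M.pF (r f) = f := Function.surjInv_eq M.pF_surj
  refine ⟨Finset.univ.image fun f => {r f}, ⟨?_, ?_, ?_⟩, ?_, ?_, fun f => ?_⟩
  · intro K hK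
    obtain ⟨f, -, rfl⟩ := Finset.mem_image.1 hK
    simp
  · simp
  · intro K hK K' hK' x hx x' hx' h
    obtain ⟨f, -, rfl⟩ := Finset.mem_image.1 hK
    obtain ⟨f', -, rfl⟩ := Finset.mem_image.1 hK'
    rw [Finset.mem_singleton] at hx hx'
    subst hx hx'
    rw [hpr, hpr] at h
    subst h
    exact ⟨rfl, rfl⟩
  · rw [Finset.card_image_of_injective, Finset.card_univ]
    intro a b h
    exact (Function.injective_surjInv M.pF_surj) (Finset.singleton_injective h)
  · intro K hK
    obtain ⟨f, -, rfl⟩ := Finset.mem_image.1 hK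
    exact ⟨_, rfl⟩
  · obtain ⟨g, hg⟩ := (M.pF_eq f (r (M.pF f))).1 (hpr _).symm
    exact ⟨_, Finset.mem_image.2 ⟨M.pF f, Finset.mem_univ _, rfl⟩, g, by simp [hg]⟩

theorem crosses_image [DecidableEq F'] {K : Finset F'} {e : E'} (g : Γ) :
    M.Crosses ((K.image (g • ·) : Finset F') : Set F') e ↔ M.Crosses (K : Set F') (g⁻¹ • e) := by
  obtain ⟨a, b, -, h⟩ := M.edge_faces e
  rw [M.crosses_iff h, M.crosses_iff (M.faces_smul h g⁻¹)]
  simp only [Finset.coe_image, Set.mem_image, Finset.mem_coe, ← eq_inv_smul_iff]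
  simp

/-- Adding one orbit of edges to `Q` destroys at most one set of an independent family: the edge
either joins two sets of the family up to translation, which are replaced with their union, or it
meets at most one set of the family, which is dropped. -/
theorem IsIndependent.exists_insert [DecidableEq E] {M : PeriodicMap Γ V' E' F' V E F}
    {Q : Finset E} {𝒦 : Finset (Finset F')} (h : M.IsIndependent Q 𝒦) (e : E) :
    ∃ 𝒦', M.IsIndependent (insert e Q) 𝒦' ∧ 𝒦.card ≤ 𝒦'.card + 1 := by
  classical
  obtain ⟨e, rfl⟩ := M.pE_surj e
  obtain ⟨f₁, f₂, -, hf⟩ := M.edge_faces e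
  by_cases hm : ∃ K₁ ∈ 𝒦, ∃ K₂ ∈ 𝒦, K₁ ≠ K₂ ∧ ∃ g₁ g₂ : Γ, g₁ • f₁ ∈ K₁ ∧ g₂ • f₂ ∈ K₂
  · obtain ⟨K₁, hK₁, K₂, hK₂, hne, g₁, g₂, h₁, h₂⟩ := hm
    set K := K₁.image (g₁⁻¹ • ·) ∪ K₂.image (g₂⁻¹ • ·) with hK
    have memK : ∀ x, x ∈ K ↔ g₁ • x ∈ K₁ ∨ g₂ • x ∈ K₂ := by
      intro x
      simp only [hK, Finset.mem_union, Finset.mem_image, inv_smul_eq_iff]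
      simp
    set R := (𝒦.erase K₁).erase K₂ with hR
    have hRmem : ∀ L ∈ R, L ∈ 𝒦 ∧ L ≠ K₁ ∧ L ≠ K₂ := by
      intro L hL
      simp only [hR, Finset.mem_erase] at hL
      exact ⟨hL.2.2, hL.2.1, hL.1⟩
    have hsep : ∀ L ∈ R, ∀ x ∈ L, ∀ y ∈ K, M.pF x ≠ M.pF y := by
      intro L hL x hx y hy hxy
      obtain ⟨hL𝒦, hL1, hL2⟩ := hRmem L hL
      rcases (memK y).1 hy with hy | hy
      · exact hL1 (h.inj L hL𝒦 K₁ hK₁ x hx _ hy (by rw [hxy, M.pF_smul])).1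
      · exact hL2 (h.inj L hL𝒦 K₂ hK₂ x hx _ hy (by rw [hxy, M.pF_smul])).1
    have hKne : K.Nonempty := ⟨f₁, (memK _).2 (Or.inl h₁)⟩
    have hf1 : f₁ ∈ K := (memK _).2 (Or.inl h₁)
    have hf2 : f₂ ∈ K := (memK _).2 (Or.inr h₂)
    have hKinj : ∀ x ∈ K, ∀ y ∈ K, M.pF x = M.pF y → x = y := by
      intro x hx y hy hxy
      rcases (memK x).1 hx with hx | hx <;> rcases (memK y).1 hy with hy | hy
      · exact smul_left_cancel _
          (h.inj K₁ hK₁ K₁ hK₁ _ hx _ hy (by rw [M.pF_smul, M.pF_smul, hxy])).2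
      · exact absurd (h.inj K₁ hK₁ K₂ hK₂ _ hx _ hy (by rw [M.pF_smul, M.pF_smul, hxy])).1 hne
      · exact absurd (h.inj K₂ hK₂ K₁ hK₁ _ hx _ hy (by rw [M.pF_smul, M.pF_smul, hxy])).1.symm hne
      · exact smul_left_cancel _
          (h.inj K₂ hK₂ K₂ hK₂ _ hx _ hy (by rw [M.pF_smul, M.pF_smul, hxy])).2
    refine ⟨insert K R, ⟨?_, ?_, ?_⟩, ?_⟩
    · intro L hL
      rcases Finset.mem_insert.1 hL with rfl | hL
      · exact hKne
      · exact h.nonempty L (hRmem L hL).1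
    · intro L hL e' he'
      rcases Finset.mem_insert.1 he' with he' | he'
      · obtain ⟨g, rfl⟩ := (M.pE_eq _ _).1 he'.symm
        rw [M.crosses_iff (M.faces_smul hf g), Finset.mem_coe, Finset.mem_coe]
        rcases Finset.mem_insert.1 hL with rfl | hL
        · constructor
          · intro hg
            rw [M.free_F _ _ (hKinj _ hg _ hf1 (M.pF_smul _ _)), one_smul]
            exact hf2
          · intro hg
            rw [M.free_F _ _ (hKinj _ hg _ hf2 (M.pF_smul _ _)), one_smul]
            exact hf1
        · exact iff_of_false (fun hx => hsep L hL _ hx _ hf1 (M.pF_smul _ _))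
            (fun hx => hsep L hL _ hx _ hf2 (M.pF_smul _ _))
      · rcases Finset.mem_insert.1 hL with rfl | hL
        · have c1 := (M.crosses_image g₁⁻¹).2
            (h.crosses K₁ hK₁ (g₁⁻¹⁻¹ • e') (by rwa [M.pE_smul]))
          have c2 := (M.crosses_image g₂⁻¹).2
            (h.crosses K₂ hK₂ (g₂⁻¹⁻¹ • e') (by rwa [M.pE_smul]))
          intro a b ha hb haK
          rw [hK, Finset.coe_union] at haK ⊢
          rcases haK with haK | haK
          · exact Or.inl (c1 a b ha hb haK)
          · exact Or.inr (c2 a b ha hb haK)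
        · exact h.crosses L (hRmem L hL).1 e' he'
    · intro L hL L' hL' x hx x' hx' hxx
      rcases Finset.mem_insert.1 hL with rfl | hL <;> rcases Finset.mem_insert.1 hL' with rfl | hL'
      · exact ⟨rfl, hKinj _ hx _ hx' hxx⟩
      · exact absurd hxx.symm (hsep L' hL' _ hx' _ hx)
      · exact absurd hxx (hsep L hL _ hx _ hx')
      · exact h.inj L (hRmem L hL).1 L' (hRmem L' hL').1 x hx x' hx' hxx
    · have hKR : K ∉ R := fun hKR => hsep K hKR _ hf1 _ hf1 rfl
      rw [Finset.card_insert_of_notMem hKR, hR,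
        Finset.card_erase_of_mem (Finset.mem_erase.2 ⟨hne.symm, hK₂⟩), Finset.card_erase_of_mem hK₁]
      omega
  · set bad : Finset F' → Prop := fun K => ∃ g : Γ, g • f₁ ∈ K ∨ g • f₂ ∈ K with hbad
    refine ⟨𝒦.filter fun K => ¬ bad K, ⟨?_, ?_, ?_⟩, ?_⟩
    · exact fun K hK => h.nonempty K (Finset.mem_filter.1 hK).1
    · intro K hK e' he'
      obtain ⟨hK, hnb⟩ := Finset.mem_filter.1 hK
      rcases Finset.mem_insert.1 he' with he' | he'
      · obtain ⟨g, rfl⟩ := (M.pE_eq _ _).1 he'.symm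
        rw [M.crosses_iff (M.faces_smul hf g), Finset.mem_coe, Finset.mem_coe]
        exact iff_of_false (fun hx => hnb ⟨g, Or.inl hx⟩) (fun hx => hnb ⟨g, Or.inr hx⟩)
      · exact h.crosses K hK e' he'
    · intro K hK K' hK'
      exact h.inj K (Finset.mem_filter.1 hK).1 K' (Finset.mem_filter.1 hK').1
    · have hone : (𝒦.filter bad).card ≤ 1 := by
        rw [Finset.card_le_one]
        intro K hK K' hK'
        obtain ⟨hK, g, hg⟩ := Finset.mem_filter.1 hK
        obtain ⟨hK', g', hg'⟩ := Finset.mem_filter.1 hK'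
        by_contra hne
        rcases hg with hg | hg <;> rcases hg' with hg' | hg'
        · exact hne (h.inj K hK K' hK' _ hg _ hg' (by rw [M.pF_smul, M.pF_smul])).1
        · exact hm ⟨K, hK, K', hK', hne, g, g', hg, hg'⟩
        · exact hm ⟨K', hK', K, hK, Ne.symm hne, g', g, hg', hg⟩
        · exact hne (h.inj K hK K' hK' _ hg _ hg' (by rw [M.pF_smul, M.pF_smul])).1
      have := Finset.card_filter_add_card_filter_not (s := 𝒦) bad
      omega

/-- In the finite graph with the faces as its vertices and the edges in `Q`, at least
`|F| - |Q|` components are trees; these lift to the covering surface. -/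
theorem exists_independent [Fintype F] (Q : Finset E) :
    ∃ 𝒦, M.IsIndependent Q 𝒦 ∧ Fintype.card F ≤ 𝒦.card + Q.card := by
  classical
  induction Q using Finset.induction_on with
  | empty =>
    obtain ⟨𝒦, h, hc, -⟩ := M.exists_singletons
    exact ⟨𝒦, h, by simp [hc]⟩
  | insert e Q he ih =>
    obtain ⟨𝒦, h, hc⟩ := ih
    obtain ⟨𝒦', h', hc'⟩ := h.exists_insert e
    exact ⟨𝒦', h', by rw [Finset.card_insert_of_notMem he]; omega⟩

theorem bd_singleton (f : F') : M.bd {f} = M.edges f := by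
  ext e
  obtain ⟨a, b, hne, h⟩ := M.edge_faces e
  rw [M.mem_bd, M.crosses_iff h, M.mem_edges, h]
  simp only [Finset.coe_singleton, Set.mem_singleton_iff]
  constructor
  · intro h'
    by_contra hcon
    push Not at hcon
    exact h' (iff_of_false hcon.1.symm hcon.2.symm)
  · rintro (rfl | rfl) h'
    · exact hne (h'.1 rfl).symm
    · exact hne (h'.2 rfl)

/-- The boundaries of an independent family within `Z` use each of the two sides of an edge in `Z`
at most once; equality of weights holds if and only if all sides are used. -/
theorem IsIndependent.sum_bd_le [DecidableEq E] {M : PeriodicMap Γ V' E' F' V E F}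
    {Q : Finset E} {𝒦 : Finset (Finset F')} (h : M.IsIndependent Q 𝒦) (Z : Finset E)
    (hZ : ∀ K ∈ 𝒦, ∀ e ∈ M.bd K, M.pE e ∈ Z) (w : E → ℝ) (hw : ∀ e, 0 < w e) :
    ∑ K ∈ 𝒦, ∑ e ∈ M.bd K, w (M.pE e) ≤ 2 * ∑ e ∈ Z, w e ∧
    (2 * ∑ e ∈ Z, w e ≤ ∑ K ∈ 𝒦, ∑ e ∈ M.bd K, w (M.pE e) ↔
      ∀ e f, M.pE e ∈ Z → M.onF e f → ∃ K ∈ 𝒦, ∃ g : Γ, g • f ∈ K ∧ g • e ∈ M.bd K) := by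
  classical
  set r := Function.surjInv M.pE_surj
  have hpr : ∀ e, M.pE (r e) = e := Function.surjInv_eq M.pE_surj
  have hg : ∀ e, ∃ g : Γ, g • e = r (M.pE e) := fun e => (M.pE_eq _ _).1 (hpr _).symm
  choose g hg using hg
  have hin : ∀ p : (_ : Finset F') × E', ∃ f, p ∈ 𝒦.sigma M.bd → f ∈ p.1 ∧ M.onF p.2 f := by
    rintro ⟨K, e⟩
    by_cases hp : (⟨K, e⟩ : (_ : Finset F') × E') ∈ 𝒦.sigma M.bd
    · have h1 := M.mem_bd.1 (Finset.mem_sigma.1 hp).2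
      simp only [Crosses, not_forall] at h1
      obtain ⟨f, f', hf, -, hK, -⟩ := h1
      exact ⟨f, fun _ => ⟨hK, hf⟩⟩
    · obtain ⟨f, -, -, -⟩ := M.edge_faces e
      exact ⟨f, fun h => absurd h hp⟩
  choose inn hinn using hin
  set S := 𝒦.sigma M.bd with hS
  set T : Finset ((_ : E) × F') := Z.sigma fun e => M.faces (r e) with hT
  -- A boundary edge of `K` with its face inside `K` is translated to the side of an edge downstairs.
  let φ : (_ : Finset F') × E' → (_ : E) × F' := fun p => ⟨M.pE p.2, g p.2 • inn p⟩
  have hφT : ∀ p ∈ S, φ p ∈ T := by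
    intro p hp
    obtain ⟨h1, h2⟩ := Finset.mem_sigma.1 hp
    refine Finset.mem_sigma.2 ⟨hZ _ h1 _ h2, ?_⟩
    rw [M.mem_faces]
    change M.onF (r (M.pE p.2)) (g p.2 • inn p)
    rw [← hg, M.onF_smul_iff]
    exact (hinn p hp).2
  have hφinj : Set.InjOn φ S := by
    rintro ⟨K, e⟩ hp ⟨K', e'⟩ hp' heq
    rw [Finset.mem_coe] at hp hp'
    have e1 : M.pE e = M.pE e' := congrArg Sigma.fst heq
    have e2 : g e • inn ⟨K, e⟩ = g e' • inn ⟨K', e'⟩ := congrArg Sigma.snd heq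
    obtain ⟨i1, i2⟩ := hinn _ hp
    obtain ⟨j1, j2⟩ := hinn _ hp'
    have e3 : M.pF (inn ⟨K, e⟩) = M.pF (inn ⟨K', e'⟩) := by
      rw [← M.pF_smul (g e), e2, M.pF_smul]
    obtain ⟨rfl, e4⟩ := h.inj K (Finset.mem_sigma.1 hp).1 K' (Finset.mem_sigma.1 hp').1 _ i1 _ j1 e3
    rw [← e4] at e2
    have e5 := M.smul_F_inj e2
    have e6 : g e • e = g e • e' := by rw [hg, e1, ← hg, e5]
    rw [smul_left_cancel _ e6]
  have hsum : ∑ K ∈ 𝒦, ∑ e ∈ M.bd K, w (M.pE e) = ∑ x ∈ S.image φ, w x.1 := by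
    rw [Finset.sum_image hφinj, hS, Finset.sum_sigma]
  have hsumT : 2 * ∑ e ∈ Z, w e = ∑ x ∈ T, w x.1 := by
    rw [hT, Finset.sum_sigma, Finset.mul_sum]
    refine Finset.sum_congr rfl fun e _ => ?_
    change _ = ∑ _f ∈ M.faces (r e), w e
    rw [Finset.sum_const, M.card_faces, nsmul_eq_mul]
    norm_num
  have hsub : S.image φ ⊆ T := Finset.image_subset_iff.2 hφT
  rw [hsum, hsumT]
  refine ⟨Finset.sum_le_sum_of_subset_of_nonneg hsub fun x _ _ => (hw _).le, ?_, ?_⟩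
  · intro hle e f he hf
    have heq : S.image φ = T := by
      by_contra hne
      obtain ⟨x, hx, hx'⟩ := Finset.exists_of_ssubset (hsub.ssubset_of_ne hne)
      exact absurd hle (not_le.2 (Finset.sum_lt_sum_of_subset hsub hx hx' (hw _)
        fun y _ _ => (hw _).le))
    have hx : (⟨M.pE e, g e • f⟩ : (_ : E) × F') ∈ T := by
      refine Finset.mem_sigma.2 ⟨he, ?_⟩
      rw [M.mem_faces, ← hg, M.onF_smul_iff]
      exact hf
    rw [← heq] at hx
    obtain ⟨⟨K, e'⟩, hp, hpe⟩ := Finset.mem_image.1 hx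
    have e1 : M.pE e' = M.pE e := congrArg Sigma.fst hpe
    have e2 : g e' • inn ⟨K, e'⟩ = g e • f := congrArg Sigma.snd hpe
    have e3 : g e' • e' = g e • e := by rw [hg, hg, e1]
    obtain ⟨h1, h2⟩ := Finset.mem_sigma.1 hp
    refine ⟨K, h1, (g e')⁻¹ * g e, ?_, ?_⟩
    · rw [mul_smul, ← e2, inv_smul_smul]
      exact (hinn _ hp).1
    · rw [mul_smul, ← e3, inv_smul_smul]
      exact h2
  · intro hall
    refine Finset.sum_le_sum_of_subset_of_nonneg ?_ fun x _ _ => (hw _).le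
    rintro ⟨e, f⟩ hx
    obtain ⟨he, hf⟩ := Finset.mem_sigma.1 hx
    rw [M.mem_faces] at hf
    obtain ⟨K, hK, k, h1, h2⟩ := hall (r e) f (by rw [hpr]; exact he) hf
    have hp : (⟨K, k • r e⟩ : (_ : Finset F') × E') ∈ S := Finset.mem_sigma.2 ⟨hK, h2⟩
    refine Finset.mem_image.2 ⟨_, hp, ?_⟩
    obtain ⟨i1, i2⟩ := hinn _ hp
    have hk : g (k • r e) * k = 1 := M.free_E (e := r e) (by rw [mul_smul, hg, M.pE_smul, hpr])
    have hi : inn ⟨K, k • r e⟩ = k • f := by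
      by_contra hne
      obtain ⟨a, b, hab, hf2⟩ := M.edge_faces (k • r e)
      rw [M.mem_bd, M.crosses_iff hf2] at h2
      have hkf := M.onF_smul k _ _ hf
      apply h2
      rcases (hf2 _).1 hkf with e1 | e1 <;> rcases (hf2 _).1 i2 with e2 | e2
      · exact absurd (e2.trans e1.symm) hne
      · rw [← e1, ← e2]; exact iff_of_true h1 i1
      · rw [← e1, ← e2]; exact iff_of_true i1 h1
      · exact absurd (e2.trans e1.symm) hne
    change (⟨M.pE (k • r e), g (k • r e) • inn ⟨K, k • r e⟩⟩ : (_ : E) × F') = ⟨e, f⟩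
    rw [hi, ← mul_smul, hk, one_smul, M.pE_smul, hpr]

/-- The weight condition of a polyhedral function, in terms of `w = π - θ`: simple cycles have
weight at least `2π`, with equality exactly for the boundaries of faces. -/
structure IsPolyhedralWeight (w : E → ℝ) : Prop where
  pos : ∀ e, 0 < w e
  cycle : ∀ n v e, IsCycle M.onE n v e → 2 * π ≤ ∑ i ∈ Finset.range n, w (M.pE (e i)) ∧
    (∑ i ∈ Finset.range n, w (M.pE (e i)) = 2 * π ↔ ∃ f, ∀ x, M.onF x f ↔ ∃ i < n, e i = x)

variable {M}

/-- A nonempty cycle modulo two has weight at least `2 * π`, with equality for faces only. -/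
theorem IsPolyhedralWeight.even {w : E → ℝ} (hw : M.IsPolyhedralWeight w) {Z : Finset E'}
    (hZ : M.IsEven Z) (hne : Z.Nonempty) :
    2 * π ≤ ∑ e ∈ Z, w (M.pE e) ∧ (∑ e ∈ Z, w (M.pE e) = 2 * π → ∃ f, M.edges f = Z) := by
  classical
  obtain ⟨n, v, e, hc, heZ⟩ := M.exists_cycle hZ hne
  obtain ⟨h1, h2⟩ := hw.cycle n v e hc
  have hsub : (Finset.range n).image e ⊆ Z := by
    intro x hx
    obtain ⟨i, hi, rfl⟩ := Finset.mem_image.1 hx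
    exact heZ i (Finset.mem_range.1 hi)
  have hsum : ∑ i ∈ Finset.range n, w (M.pE (e i)) =
      ∑ x ∈ (Finset.range n).image e, w (M.pE x) := by
    rw [Finset.sum_image]
    intro a ha b hb h
    exact hc.inj_e (by simpa using ha) (by simpa using hb) h
  have hle : ∑ x ∈ (Finset.range n).image e, w (M.pE x) ≤ ∑ e ∈ Z, w (M.pE e) :=
    Finset.sum_le_sum_of_subset_of_nonneg hsub fun x _ _ => (hw.pos _).le
  refine ⟨by linarith, fun heq => ?_⟩
  have hZeq : (Finset.range n).image e = Z := by
    by_contra hne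
    obtain ⟨x, hx, hx'⟩ := Finset.exists_of_ssubset (hsub.ssubset_of_ne hne)
    have := Finset.sum_lt_sum_of_subset (f := fun x => w (M.pE x)) hsub hx hx' (hw.pos _)
      fun y _ _ => (hw.pos _).le
    linarith
  obtain ⟨f, hf⟩ := h2.1 (by linarith)
  refine ⟨f, ?_⟩
  rw [← hZeq]
  ext x
  rw [M.mem_edges, hf]
  simp

theorem IsPolyhedralWeight.face {w : E → ℝ} (hw : M.IsPolyhedralWeight w) (f : F') :
    ∑ e ∈ M.edges f, w (M.pE e) = 2 * π := by
  classical
  obtain ⟨n, v, e, hc, h⟩ := M.face_cycle f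
  rw [← (hw.cycle n v e hc).2.2 ⟨f, h⟩]
  have : M.edges f = (Finset.range n).image e := by
    ext x; rw [M.mem_edges, h]; simp
  rw [this, Finset.sum_image]
  intro a ha b hb h
  exact hc.inj_e (by simpa using ha) (by simpa using hb) h

/-- The total weight: every face has weight `2 * π` and every edge lies on two faces. -/
theorem IsPolyhedralWeight.sum_eq [Fintype E] [Fintype F] {w : E → ℝ}
    (hw : M.IsPolyhedralWeight w) : ∑ e, w e = π * Fintype.card F := by
  classical
  obtain ⟨𝒦, h, hc, hs, hall⟩ := M.exists_singletons
  obtain ⟨h1, h2⟩ := h.sum_bd_le Finset.univ (fun _ _ _ _ => Finset.mem_univ _) w hw.pos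
  have h3 := h2.2 fun e f _ hf => by
    obtain ⟨K, hK, g, hg⟩ := hall f
    refine ⟨K, hK, g, hg, ?_⟩
    obtain ⟨f', rfl⟩ := hs K hK
    rw [Finset.mem_singleton] at hg
    rw [M.bd_singleton, M.mem_edges, ← hg]
    exact M.onF_smul _ _ _ hf
  have h4 : ∑ K ∈ 𝒦, ∑ e ∈ M.bd K, w (M.pE e) = ∑ K ∈ 𝒦, 2 * π := by
    refine Finset.sum_congr rfl fun K hK => ?_
    obtain ⟨f, rfl⟩ := hs K hK
    rw [M.bd_singleton, hw.face]
  rw [Finset.sum_const, hc, nsmul_eq_mul] at h4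
  linarith

end PeriodicMap

/-! ### The weight of the edges that do not meet a set of vertices -/

namespace PeriodicMap

variable {Γ V' E' F' V E F : Type*} [Group Γ]
  [MulAction Γ V'] [MulAction Γ E'] [MulAction Γ F'] (M : PeriodicMap Γ V' E' F' V E F)

/-- Incidence of vertices and edges downstairs. -/
def inc (v : V) (e : E) : Prop := ∃ x e', M.pV x = v ∧ M.pE e' = e ∧ M.onE x e'

theorem inc_pE {v : V} {e : E'} : M.inc v (M.pE e) ↔ ∃ x, M.pV x = v ∧ M.onE x e := by
  constructor
  · rintro ⟨x, e', rfl, he, h⟩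
    obtain ⟨g, rfl⟩ := (M.pE_eq _ _).1 he
    exact ⟨g • x, M.pV_smul _ _, M.onE_smul _ _ _ h⟩
  · rintro ⟨x, hx, h⟩
    exact ⟨x, e, hx, rfl, h⟩

theorem inc_pV {x : V'} {e : E} : M.inc (M.pV x) e ↔ ∃ e', M.pE e' = e ∧ M.onE x e' := by
  constructor
  · rintro ⟨y, e', hy, rfl, h⟩
    obtain ⟨g, rfl⟩ := (M.pV_eq _ _).1 hy
    exact ⟨g • e', M.pE_smul _ _, M.onE_smul _ _ _ h⟩
  · rintro ⟨e', he, h⟩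
    exact ⟨x, e', rfl, he, h⟩

theorem exists_ends (e : E) : ∃ a b, a ≠ b ∧ ∀ v, M.inc v e ↔ v = a ∨ v = b := by
  obtain ⟨e, rfl⟩ := M.pE_surj e
  obtain ⟨x, y, hne, h⟩ := M.edge_ends e
  refine ⟨_, _, hne, fun v => ?_⟩
  rw [M.inc_pE]
  constructor
  · rintro ⟨z, rfl, hz⟩
    rcases (h z).1 hz with rfl | rfl <;> simp
  · rintro (rfl | rfl)
    · exact ⟨x, rfl, (h x).2 (Or.inl rfl)⟩
    · exact ⟨y, rfl, (h y).2 (Or.inr rfl)⟩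

/-- The edges downstairs that have an end in `A`. -/
noncomputable def meets [Fintype E] (A : Finset V) : Finset E := by
  classical exact Finset.univ.filter fun e => ∃ v ∈ A, M.inc v e

theorem mem_meets [Fintype E] {A : Finset V} {e : E} : e ∈ M.meets A ↔ ∃ v ∈ A, M.inc v e := by
  simp [meets]

/-- A set of vertices closed under adjacency along a cycle contains all or none of its vertices. -/
theorem vertex_of_cycle {n : ℕ} {v : ℕ → V'} {e : ℕ → E'} (hc : IsCycle M.onE n v e)
    {B : Set V'} (hB : ∀ i < n, ∀ x y, M.onE x (e i) → M.onE y (e i) → x ∈ B → y ∈ B)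
    {i : ℕ} (hi : i < n) {x : V'} (hx : M.onE x (e i)) (hxB : x ∈ B) :
    ∀ j < n, ∀ y, M.onE y (e j) → y ∈ B := by
  have hstep : ∀ i < n, (v i ∈ B ↔ v (i + 1) ∈ B) := fun i hi =>
    ⟨hB i hi _ _ ((hc.ends i hi _).2 (Or.inl rfl)) ((hc.ends i hi _).2 (Or.inr rfl)),
      hB i hi _ _ ((hc.ends i hi _).2 (Or.inr rfl)) ((hc.ends i hi _).2 (Or.inl rfl))⟩
  have hall : ∀ i ≤ n, (v i ∈ B ↔ v 0 ∈ B) := by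
    intro i
    induction i with
    | zero => simp
    | succ k ih => intro hk; rw [← hstep k (by omega), ih (by omega)]
  have h0 : v 0 ∈ B := by
    rcases (hc.ends i hi x).1 hx with rfl | rfl
    · exact (hall i hi.le).1 hxB
    · exact (hall (i + 1) hi).1 hxB
  intro j hj y hy
  rcases (hc.ends j hj y).1 hy with rfl | rfl
  · exact (hall j hj.le).2 h0
  · exact (hall (j + 1) hj).2 h0

/-- The graph of vertices and edges is connected. -/
theorem primal_conn (B : Set V') (hB : ∀ e x y, M.onE x e → M.onE y e → x ∈ B → y ∈ B)
    {x : V'} (hx : x ∈ B) (y : V') : y ∈ B := by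
  set K : Set F' := {f | ∃ e z, M.onF e f ∧ M.onE z e ∧ z ∈ B} with hK
  have hall : ∀ f ∈ K, ∀ e z, M.onF e f → M.onE z e → z ∈ B := by
    rintro f ⟨e, z, hef, hze, hz⟩ e' z' hef' hze'
    obtain ⟨n, v, ε, hc, h⟩ := M.face_cycle f
    obtain ⟨i, hi, rfl⟩ := (h e).1 hef
    obtain ⟨j, hj, rfl⟩ := (h e').1 hef'
    exact M.vertex_of_cycle hc (fun i _ x y => hB (ε i) x y) hi hze hz j hj z' hze'
  obtain ⟨e, he⟩ := M.exists_edge x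
  obtain ⟨f, g, -, hf⟩ := M.edge_faces e
  have hfK : f ∈ K := ⟨e, x, (hf f).2 (Or.inl rfl), he, hx⟩
  have hKu : K = univ := by
    refine (M.dual_conn K fun e f f' h h' hfK => ?_).resolve_left (Set.Nonempty.ne_empty ⟨f, hfK⟩)
    obtain ⟨a, b, -, hab⟩ := M.edge_ends e
    have ha := (hab a).2 (Or.inl rfl)
    exact ⟨e, a, h', ha, hall f hfK e a h ha⟩
  obtain ⟨e', he'⟩ := M.exists_edge y
  obtain ⟨f', _, -, hf'⟩ := M.edge_faces e'
  exact hall f' (hKu ▸ mem_univ f') e' y ((hf' f').2 (Or.inl rfl)) he'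

/-- Some edge leads out of a proper nonempty set of vertices. -/
theorem exists_edge_between {A : Set V} (hA : A.Nonempty) (hA' : A ≠ univ) :
    ∃ e, ∃ a ∈ A, ∃ b ∉ A, M.inc a e ∧ M.inc b e := by
  by_contra! hcon
  obtain ⟨a, ha⟩ := hA
  obtain ⟨x, rfl⟩ := M.pV_surj a
  refine hA' (Set.eq_univ_of_forall fun v => ?_)
  obtain ⟨y, rfl⟩ := M.pV_surj v
  refine M.primal_conn (M.pV ⁻¹' A) (fun e x y hx hy hxA => ?_) ha y
  by_contra hy'
  exact hcon (M.pE e) _ hxA _ hy' (M.inc_pE.2 ⟨x, rfl, hx⟩) (M.inc_pE.2 ⟨y, rfl, hy⟩)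

/-- If one edge is left out for each vertex in `A`, suitably chosen, then going around these
vertices replaces crossing the omitted edges. -/
theorem exists_spanning [Fintype E] [Finite V] (A : Finset V) (hA : (A : Set V) ≠ univ) :
    ∃ Q ⊆ M.meets A, Q.card + A.card = (M.meets A).card ∧
      ∀ K : Set F', (∀ e, M.pE e ∈ Q → M.Crosses K e) →
        ∀ e, M.pE e ∈ M.meets A → M.Crosses K e := by
  classical
  induction hn : A.card generalizing A with
  | zero =>
    rw [Finset.card_eq_zero] at hn
    subst hn
    exact ⟨M.meets ∅, subset_rfl, by simp, fun K h => h⟩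
  | succ n ih =>
    have hAne : (A : Set V).Nonempty := by
      rw [Finset.coe_nonempty, ← Finset.card_pos]; omega
    obtain ⟨e₀, a, ha, b, hb, hae, hbe⟩ := M.exists_edge_between hAne hA
    rw [Finset.mem_coe] at ha hb
    set A' := A.erase a with hA'
    have hA'c : A'.card = n := by rw [hA', Finset.card_erase_of_mem ha, hn]; rfl
    have hbA' : b ∉ A' := fun h => hb (Finset.mem_of_mem_erase h)
    obtain ⟨Q, hQ, hQc, hQK⟩ := ih A' (fun h => hbA' (by
      rw [← Finset.mem_coe, h]; trivial)) hA'c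
    have hends : ∀ v, M.inc v e₀ → v = a ∨ v = b := by
      obtain ⟨c, d, -, h⟩ := M.exists_ends e₀
      intro v hv
      have hab : a ≠ b := fun h => hb (h ▸ ha)
      rcases (h a).1 hae with rfl | rfl <;> rcases (h b).1 hbe with rfl | rfl <;>
        have := (h v).1 hv <;> tauto
    have he₀ : e₀ ∉ M.meets A' := by
      rw [M.mem_meets]
      rintro ⟨v, hv, hve⟩
      rcases hends v hve with rfl | rfl
      · simp [hA'] at hv
      · exact hbA' hv
    have he₀A : e₀ ∈ M.meets A := M.mem_meets.2 ⟨a, ha, hae⟩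
    have hsub : M.meets A' ⊆ M.meets A := by
      intro e he
      obtain ⟨v, hv, h⟩ := M.mem_meets.1 he
      exact M.mem_meets.2 ⟨v, Finset.mem_of_mem_erase hv, h⟩
    set R := (M.meets A \ M.meets A').erase e₀ with hR
    have hRc : R.card + 1 + (M.meets A').card = (M.meets A).card := by
      have h1 := Finset.card_sdiff_add_card_eq_card hsub
      have h2 := Finset.card_erase_add_one (Finset.mem_sdiff.2 ⟨he₀A, he₀⟩)
      rw [hR]; omega
    refine ⟨Q ∪ R, ?_, ?_, ?_⟩
    · refine Finset.union_subset (hQ.trans hsub) fun e he => ?_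
      exact (Finset.mem_sdiff.1 (Finset.mem_of_mem_erase he)).1
    · rw [Finset.card_union_of_disjoint]
      · omega
      · refine Finset.disjoint_left.2 fun e he he' => ?_
        exact (Finset.mem_sdiff.1 (Finset.mem_of_mem_erase he')).2 (hQ he)
    · intro K hK e he
      have hQ' := hQK K fun e he => hK e (Finset.mem_union_left _ he)
      have hne : ∀ e, M.pE e ∈ M.meets A → M.pE e ≠ e₀ → M.Crosses K e := by
        intro e he hne
        by_cases h : M.pE e ∈ M.meets A'
        · exact hQ' e h
        · exact hK e (Finset.mem_union_right _
            (Finset.mem_erase.2 ⟨hne, Finset.mem_sdiff.2 ⟨he, h⟩⟩))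
      by_cases h : M.pE e = e₀
      · rw [← h] at hae
        obtain ⟨x, hx, hxe⟩ := M.inc_pE.1 hae
        refine M.crosses_of_others hxe fun e' hxe' hee' => hne e' ?_ fun h' => ?_
        · exact M.mem_meets.2 ⟨a, ha, M.inc_pE.2 ⟨x, hx, hxe'⟩⟩
        · exact hee' (M.star_inj hxe' hxe (h'.trans h.symm))
      · exact hne e he h

/-- A set of faces whose boundary is the boundary of one face consists of that face or of all other
faces. -/
theorem eq_of_bd_eq_edges {K : Finset F'} {f : F'} (h : M.bd K = M.edges f) :
    K = {f} ∨ ∀ x, x ∈ K ↔ x ≠ f := by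
  have hc := M.dual_conn {x | x ∈ K ↔ x ≠ f} fun e => by
    obtain ⟨a, b, hab, hf⟩ := M.edge_faces e
    have h1 : ¬ M.Crosses (K : Set F') e ↔ M.onF e f := by rw [← M.mem_bd, h, M.mem_edges]
    refine (M.crosses_iff hf).2 ?_
    rw [M.crosses_iff hf, Finset.mem_coe, Finset.mem_coe, hf] at h1
    simp only [mem_ofPred_eq]
    by_cases h2 : a = f
    · subst h2
      have : b ≠ a := hab.symm
      tauto
    · by_cases h3 : b = f
      · subst h3
        tauto
      · have h4 : f ≠ a := Ne.symm h2
        have h5 : f ≠ b := Ne.symm h3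
        tauto
  rcases hc with hc | hc
  · left
    ext x
    have := Set.ext_iff.1 hc x
    simp only [mem_ofPred_eq, mem_empty_iff_false, iff_false] at this
    rw [Finset.mem_singleton]
    tauto
  · exact Or.inr fun x => (Set.ext_iff.1 hc x).2 trivial

variable {M}

/-- If the covering is trivial, then a subgraph downstairs with more edges than vertices contains a
cycle that lifts, and its weight is at least `2 * π`. -/
theorem IsPolyhedralWeight.le_sum_of_injective {w : E → ℝ}
    (hw : M.IsPolyhedralWeight w) (hinj : Function.Injective M.pF) {W : Finset V}
    {Z : Finset E} (hZW : ∀ e ∈ Z, ∀ v, M.inc v e → v ∈ W) (hc : W.card < Z.card) :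
    2 * π ≤ ∑ e ∈ Z, w e := by
  classical
  obtain ⟨Y, hYZ, hYne, hYe⟩ := exists_even_subset M.inc W Z hc
  obtain ⟨e₁, -⟩ := id hYne
  obtain ⟨e₂, -⟩ := M.pE_surj e₁
  obtain ⟨f₀, -, -, -⟩ := M.edge_faces e₂
  have hΓ : ∀ g : Γ, g = 1 := fun g => M.free_F g f₀ (hinj (M.pF_smul _ _))
  have hEinj : Function.Injective M.pE := by
    intro a b h
    obtain ⟨g, rfl⟩ := (M.pE_eq _ _).1 h
    rw [hΓ g, one_smul]
  have hVinj : Function.Injective M.pV := by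
    intro a b h
    obtain ⟨g, rfl⟩ := (M.pV_eq _ _).1 h
    rw [hΓ g, one_smul]
  set r := Function.surjInv M.pE_surj
  have hpr : ∀ e, M.pE (r e) = e := Function.surjInv_eq M.pE_surj
  have hr : Function.Injective r := Function.injective_surjInv _
  have hinc : ∀ x e, M.inc (M.pV x) e ↔ M.onE x (r e) := by
    intro x e
    rw [M.inc_pV]
    constructor
    · rintro ⟨e', rfl, h⟩
      rwa [hEinj (hpr (M.pE e'))]
    · exact fun h => ⟨_, hpr e, h⟩
  have heven : M.IsEven (Y.image r) := by
    intro x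
    have h1 : (Y.image r).filter (M.onE x) = (Y.filter (M.inc (M.pV x))).image r := by
      ext e'
      simp only [Finset.mem_filter, Finset.mem_image]
      constructor
      · rintro ⟨⟨e, he, rfl⟩, h⟩; exact ⟨e, ⟨he, (hinc x e).2 h⟩, rfl⟩
      · rintro ⟨e, ⟨he, h⟩, rfl⟩; exact ⟨⟨e, he, rfl⟩, (hinc x e).1 h⟩
    have h2 : Even ((Y.image r).filter (M.onE x)).card := by
      rw [h1, Finset.card_image_of_injective _ hr]
      by_cases hx : M.pV x ∈ W
      · exact hYe _ hx
      · rw [Finset.filter_eq_empty_iff.2 fun e he h => hx (hZW e (hYZ he) _ h)]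
        simp
    convert h2
  have h3 := (hw.even heven (hYne.image r)).1
  rw [Finset.sum_image fun a _ b _ h => hr h] at h3
  simp only [hpr] at h3
  exact h3.trans (Finset.sum_le_sum_of_subset_of_nonneg hYZ fun e _ _ => (hw.pos e).le)

/-- If the edges over `Z` are all edges of one face, then there are at most as many edges in `Z` as
ends of these. -/
theorem card_le_of_edges [Finite E] {f : F'} {W : Finset V} {Z : Finset E}
    (hZW : ∀ e ∈ Z, ∀ v, M.inc v e → v ∈ W) (hZf : ∀ e, M.pE e ∈ Z → M.onF e f) :
    Z.card ≤ W.card := by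
  classical
  have h1 : ∀ e ∈ Z, (W.bipartiteBelow M.inc e).card = 2 := by
    intro e he
    obtain ⟨a, b, hab, h⟩ := M.exists_ends e
    have : W.bipartiteBelow M.inc e = {a, b} := by
      ext v
      rw [Finset.mem_bipartiteBelow, h, Finset.mem_insert, Finset.mem_singleton,
        and_iff_right_iff_imp]
      exact fun hv => hZW e he v ((h v).2 hv)
    rw [this, Finset.card_pair hab]
  have h2 : ∀ v ∈ W, (Z.bipartiteAbove M.inc v).card ≤ 2 := by
    intro v _
    obtain ⟨x, rfl⟩ := M.pV_surj v
    have hsub : Z.bipartiteAbove M.inc (M.pV x) ⊆ ((M.edges f).filter (M.onE x)).image M.pE := by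
      intro e he
      rw [Finset.mem_bipartiteAbove, M.inc_pV] at he
      obtain ⟨he, e', rfl, hx⟩ := he
      exact Finset.mem_image.2 ⟨e', Finset.mem_filter.2 ⟨M.mem_edges.2 (hZf e' he), hx⟩, rfl⟩
    refine (Finset.card_le_card hsub).trans (Finset.card_image_le.trans ?_)
    rcases M.corner f x with h | h <;> rw [h]
    simp
  have h3 := Finset.sum_card_bipartiteAbove_eq_sum_card_bipartiteBelow (s := W) (t := Z) M.inc
  rw [Finset.sum_congr rfl h1, Finset.sum_const, smul_eq_mul] at h3
  have h4 := Finset.sum_le_sum h2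
  rw [h3, Finset.sum_const, smul_eq_mul] at h4
  omega

/-- The main inequality: a lower bound for the weight of the edges that do not meet a proper
nonempty set `A` of vertices. With `Q` as in `exists_spanning`, there are at least `|F| - |Q|`
independent sets of faces that are joined across `Q`, hence across all edges that meet `A`; each has
a boundary of weight at least `2 * π`, and the boundaries use each remaining edge at most twice. -/
theorem IsPolyhedralWeight.lt_sum_compl [Fintype V] [Fintype E] [Fintype F] [DecidableEq V]
    [DecidableEq E] {w : E → ℝ}
    (hw : M.IsPolyhedralWeight w) (hχ : Fintype.card V + Fintype.card F ≤ Fintype.card E)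
    {A : Finset V} (hA : A.Nonempty) (hA' : (A : Set V) ≠ univ) :
    π * (Fintype.card F + A.card - (M.meets A).card) < ∑ e ∈ (M.meets A)ᶜ, w e := by
  classical
  obtain ⟨Q, -, hQc, hQK⟩ := M.exists_spanning A hA'
  obtain ⟨𝒦, h𝒦, hcard⟩ := M.exists_independent Q
  set Z := (M.meets A)ᶜ with hZ
  set W := Aᶜ with hW
  have hWpos : 0 < W.card := by
    rw [Finset.card_pos]
    obtain ⟨b, hb⟩ := (Set.ne_univ_iff_exists_notMem _).1 hA'
    exact ⟨b, Finset.mem_compl.2 (by simpa using hb)⟩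
  have hVc : A.card + W.card = Fintype.card V := Finset.card_add_card_compl A
  have hEc : (M.meets A).card + Z.card = Fintype.card E := Finset.card_add_card_compl _
  have hZW : ∀ e ∈ Z, ∀ v, M.inc v e → v ∈ W := by
    intro e he v hv
    rw [hZ, Finset.mem_compl, M.mem_meets] at he
    rw [hW, Finset.mem_compl]
    exact fun h => he ⟨v, h, hv⟩
  have hbdZ : ∀ K ∈ 𝒦, ∀ e ∈ M.bd K, M.pE e ∈ Z := by
    intro K hK e he
    rw [hZ, Finset.mem_compl]
    exact fun h => M.mem_bd.1 he (hQK K (h𝒦.crosses K hK) e h)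
  have hπ := Real.pi_pos
  by_contra! hcon
  have hq : (Fintype.card F + A.card - (M.meets A).card : ℝ) = Fintype.card F - Q.card := by
    have : (Q.card + A.card : ℝ) = (M.meets A).card := by exact_mod_cast hQc
    linarith
  rw [hq] at hcon
  have hZne : Z.Nonempty := by
    rw [Finset.nonempty_iff_ne_empty]
    intro h0
    rw [h0, Finset.sum_empty] at hcon
    have h1 : (Fintype.card F : ℝ) + 1 ≤ Q.card := by
      have : Z.card = 0 := by rw [h0]; rfl
      exact_mod_cast (by omega : Fintype.card F + 1 ≤ Q.card)
    nlinarith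
  have hpos : 0 < ∑ e ∈ Z, w e := Finset.sum_pos (fun e _ => hw.pos e) hZne
  have hFq : Q.card < Fintype.card F := by
    have : 0 < (Fintype.card F - Q.card : ℝ) := by
      by_contra! h; nlinarith
    exact_mod_cast (by linarith : (Q.card : ℝ) < Fintype.card F)
  -- As `χ ≤ 0` and `|Q| < |F|`, the complementary subgraph has more edges than vertices.
  have hWZ : W.card < Z.card := by omega
  -- A member with empty boundary consists of all faces, so that the covering is trivial.
  by_cases hempty : ∃ K ∈ 𝒦, M.bd K = ∅
  · obtain ⟨K, hK, hbd⟩ := hempty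
    have hKu : (K : Set F') = univ := by
      obtain ⟨f, hf⟩ := h𝒦.nonempty K hK
      refine (M.dual_conn K fun e => ?_).resolve_left (Set.Nonempty.ne_empty ⟨f, hf⟩)
      have : e ∉ M.bd K := by rw [hbd]; simp
      rw [M.mem_bd, not_not] at this
      exact this
    have hKm : ∀ f, f ∈ K := fun f => by rw [← Finset.mem_coe, hKu]; trivial
    have hinj : Function.Injective M.pF := fun a b h =>
      (h𝒦.inj K hK K hK a (hKm a) b (hKm b) h).2
    have hone : 𝒦.card ≤ 1 := by
      rw [Finset.card_le_one]
      have : ∀ L ∈ 𝒦, L = K := by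
        intro L hL
        obtain ⟨f, hf⟩ := h𝒦.nonempty L hL
        exact (h𝒦.inj L hL K hK f hf f (hKm f) rfl).1
      intro a ha b hb
      rw [this a ha, this b hb]
    have h1 := hw.le_sum_of_injective hinj hZW hWZ
    have h2 : (Fintype.card F : ℝ) ≤ 1 + Q.card := by
      exact_mod_cast (by omega : Fintype.card F ≤ 1 + Q.card)
    nlinarith
  push Not at hempty
  have hK2 : ∀ K ∈ 𝒦, 2 * π ≤ ∑ e ∈ M.bd K, w (M.pE e) ∧
      (∑ e ∈ M.bd K, w (M.pE e) = 2 * π → ∃ f, M.edges f = M.bd K) := fun K hK =>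
    hw.even (M.isEven_bd K) (hempty K hK)
  obtain ⟨s1, s2⟩ := h𝒦.sum_bd_le Z hbdZ w hw.pos
  have s3 : ∑ K ∈ 𝒦, 2 * π ≤ ∑ K ∈ 𝒦, ∑ e ∈ M.bd K, w (M.pE e) :=
    Finset.sum_le_sum fun K hK => (hK2 K hK).1
  have s4 : (Fintype.card F - Q.card : ℝ) ≤ 𝒦.card := by
    have : (Fintype.card F : ℝ) ≤ 𝒦.card + Q.card := by exact_mod_cast hcard
    linarith
  have s5 : ∑ K ∈ 𝒦, 2 * π = 2 * (π * 𝒦.card) := by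
    rw [Finset.sum_const, nsmul_eq_mul]; ring
  have s6 : π * (Fintype.card F - Q.card : ℝ) ≤ π * 𝒦.card := mul_le_mul_of_nonneg_left s4 hπ.le
  -- Now equality holds throughout: all sides of all edges in `Z` are used, and every boundary is
  -- the boundary of a face.
  have hsides := s2.1 (by linarith)
  have hface : ∀ K ∈ 𝒦, ∃ f, M.edges f = M.bd K := by
    have heq : ∑ K ∈ 𝒦, 2 * π = ∑ K ∈ 𝒦, ∑ e ∈ M.bd K, w (M.pE e) := by linarith
    rw [Finset.sum_eq_sum_iff_of_le fun K hK => (hK2 K hK).1] at heq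
    exact fun K hK => (hK2 K hK).2 (heq K hK).symm
  by_cases hbig : ∃ K ∈ 𝒦, ∃ f, M.edges f = M.bd K ∧ ∀ x, x ∈ K ↔ x ≠ f
  · -- A member consisting of all faces but `f` leaves only edges of `f` in `Z`, which are too few.
    obtain ⟨K, hK, f, hf, hx⟩ := hbig
    refine absurd hWZ (not_lt.2 (card_le_of_edges hZW (f := f) fun e he => ?_))
    rw [← M.mem_edges, hf]
    obtain ⟨a, b, hab, hab'⟩ := M.edge_faces e
    obtain ⟨x, hxe, hxf⟩ : ∃ x, M.onF e x ∧ x ≠ f := by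
      by_cases h : a = f
      · exact ⟨b, (hab' b).2 (Or.inr rfl), fun h' => hab (h.trans h'.symm)⟩
      · exact ⟨a, (hab' a).2 (Or.inl rfl), h⟩
    obtain ⟨L, hL, g, hg, hge⟩ := hsides e x he hxe
    obtain ⟨rfl, hgx⟩ := h𝒦.inj L hL K hK _ hg x ((hx x).2 hxf) (M.pF_smul _ _)
    rwa [M.free_F _ _ hgx, one_smul] at hge
  · -- All members are single faces, so the union of their orbits is closed under adjacency and
    -- contains every face, although the edges that meet `A` are not in `Z`.
    have hsingle : ∀ K ∈ 𝒦, ∃ f, K = {f} ∧ M.edges f = M.bd K := by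
      intro K hK
      obtain ⟨f, hf⟩ := hface K hK
      rcases M.eq_of_bd_eq_edges hf.symm with h | h
      · exact ⟨f, h, hf⟩
      · exact absurd ⟨K, hK, f, hf, h⟩ hbig
    have hU : ∀ e f, M.onF e f → (∃ K ∈ 𝒦, ∃ g : Γ, g • f ∈ K) → M.pE e ∈ Z := by
      rintro e f hef ⟨K, hK, g, hg⟩
      obtain ⟨f', hf', hb⟩ := hsingle K hK
      rw [← M.pE_smul g]
      refine hbdZ K hK _ ?_
      rw [hf', Finset.mem_singleton] at hg
      rw [← hb, M.mem_edges, ← hg]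
      exact M.onF_smul _ _ _ hef
    have hne : ∃ K, K ∈ 𝒦 := by
      have : 0 < 𝒦.card := by omega
      exact Finset.card_pos.1 this
    have hall : {f | ∃ K ∈ 𝒦, ∃ g : Γ, g • f ∈ K} = univ := by
      obtain ⟨K, hK⟩ := hne
      obtain ⟨f, hf⟩ := h𝒦.nonempty K hK
      refine (M.dual_conn _ fun e f f' hf hf' hmem => ?_).resolve_left
        (Set.Nonempty.ne_empty ⟨f, K, hK, 1, by rwa [one_smul]⟩)
      obtain ⟨L, hL, g, hg, -⟩ := hsides e f' (hU e f hf hmem) hf'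
      exact ⟨L, hL, g, hg⟩
    obtain ⟨a, ha⟩ := hA
    obtain ⟨x, rfl⟩ := M.pV_surj a
    obtain ⟨e, he⟩ := M.exists_edge x
    obtain ⟨f, _, -, hf⟩ := M.edge_faces e
    have h1 := hU e f ((hf f).2 (Or.inl rfl)) ((Set.ext_iff.1 hall f).2 trivial)
    rw [hZ, Finset.mem_compl] at h1
    exact h1 (M.mem_meets.2 ⟨_, ha, M.inc_pE.2 ⟨x, rfl, he⟩⟩)

/-- The supply condition for the existence of vertex angles, where `π - w e` is the amount that
the edge `e` can distribute. -/
theorem IsPolyhedralWeight.lt_sum_meets [Fintype V] [Fintype E] [Fintype F] {w : E → ℝ}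
    (hw : M.IsPolyhedralWeight w) (hχ : Fintype.card V + Fintype.card F ≤ Fintype.card E)
    {A : Finset V} (hA : A.Nonempty) (hA' : (A : Set V) ≠ univ) :
    π * A.card < ∑ e ∈ M.meets A, (π - w e) := by
  classical
  have h1 := hw.lt_sum_compl hχ hA hA'
  have h2 := Finset.sum_add_sum_compl (M.meets A) w
  rw [hw.sum_eq] at h2
  rw [Finset.sum_sub_distrib, Finset.sum_const, nsmul_eq_mul]
  linarith

end PeriodicMap

/-! ### Distributing edge weights to the vertices -/

section VertexSums

variable {V E : Type*} [Fintype E] [DecidableEq V]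

/-- The sum at `v` when each edge `e` gives `x e` to its end `a e` and `θ e - x e` to its end
`b e`. -/
def vertexSum (a b : E → V) (θ x : E → ℝ) (v : V) : ℝ :=
  ∑ e, ((if a e = v then x e else 0) + (if b e = v then θ e - x e else 0))

variable {a b : E → V} {θ : E → ℝ}

theorem sum_vertexSum (x : E → ℝ) (A : Finset V) : ∑ v ∈ A, vertexSum a b θ x v =
    ∑ e, ((if a e ∈ A then x e else 0) + (if b e ∈ A then θ e - x e else 0)) := by
  unfold vertexSum
  rw [Finset.sum_comm]
  refine Finset.sum_congr rfl fun e _ => ?_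
  rw [Finset.sum_add_distrib, Finset.sum_ite_eq, Finset.sum_ite_eq]

theorem vertexSum_update [DecidableEq E] (x : E → ℝ) (e : E) (t : ℝ) (v : V) :
    vertexSum a b θ (Function.update x e (x e + t)) v =
      vertexSum a b θ x v + t * ((if a e = v then 1 else 0) - (if b e = v then 1 else 0)) := by
  unfold vertexSum
  rw [← Finset.add_sum_erase _ _ (Finset.mem_univ e),
    ← Finset.add_sum_erase _ (fun e => (if a e = v then x e else 0) + _) (Finset.mem_univ e)]
  rw [Finset.sum_congr rfl (g := fun e => (if a e = v then x e else 0) +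
    (if b e = v then θ e - x e else 0)) fun e' he' => by
      rw [Function.update_of_ne (Finset.ne_of_mem_erase he')]]
  rw [Function.update_self]
  split_ifs <;> ring

theorem sum_sq_vertexSum_update [Fintype V] [DecidableEq E] (x : E → ℝ) {e : E}
    (hab : a e ≠ b e) (t : ℝ) :
    ∑ v, vertexSum a b θ (Function.update x e (x e + t)) v ^ 2 = ∑ v, vertexSum a b θ x v ^ 2 +
      2 * t * (vertexSum a b θ x (a e) - vertexSum a b θ x (b e)) + 2 * t ^ 2 := by
  have h : ∀ v, vertexSum a b θ (Function.update x e (x e + t)) v ^ 2 = vertexSum a b θ x v ^ 2 +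
      (if a e = v then 2 * t * vertexSum a b θ x v + t ^ 2 else 0) +
      (if b e = v then - (2 * t * vertexSum a b θ x v) + t ^ 2 else 0) := by
    intro v
    rw [vertexSum_update]
    split_ifs with h1 h2
    · exact absurd (h1.trans h2.symm) hab
    all_goals ring
  rw [Finset.sum_congr rfl fun v _ => h v, Finset.sum_add_distrib, Finset.sum_add_distrib,
    Finset.sum_ite_eq, Finset.sum_ite_eq, if_pos (Finset.mem_univ _), if_pos (Finset.mem_univ _)]
  ring

theorem continuous_vertexSum (v : V) : Continuous fun x => vertexSum a b θ x v := by
  unfold vertexSum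
  refine continuous_finsetSum _ fun e _ => Continuous.add ?_ ?_ <;> split_ifs <;> fun_prop

/-- A feasible-flow theorem: if the edges meeting any proper nonempty set `A` of vertices supply
more than `c` for each vertex in `A`, then the edges can be split between their ends so that
each vertex receives at least `c`. A split that minimizes the sum of the squares of the vertex sums,
with a small margin kept at each end, works: if some sums were below `c`, the vertices with the
least sum would already receive everything their edges can supply. -/
theorem exists_vertexSum_ge [Fintype V] (hab : ∀ e, a e ≠ b e) (hθ : ∀ e, 0 < θ e) (c : ℝ)
    (hA : ∀ A : Finset V, A.Nonempty → (A : Set V) ≠ univ →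
      c * A.card < ∑ e with a e ∈ A ∨ b e ∈ A, θ e)
    (htot : c * Fintype.card V ≤ ∑ e, θ e) :
    ∃ x : E → ℝ, (∀ e, x e ∈ Ioo 0 (θ e)) ∧ ∀ v, c ≤ vertexSum a b θ x v := by
  classical
  -- A margin `ε` that is small compared with the slack in all the strict inequalities.
  obtain ⟨ε, ⟨hε1, hε2⟩, hε⟩ : ∃ ε : ℝ, ((∀ e, ε < θ e - ε) ∧ ∀ A : Finset V, A.Nonempty →
      (A : Set V) ≠ univ → c * A.card < ∑ e with a e ∈ A ∨ b e ∈ A, (θ e - ε)) ∧ 0 < ε := by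
    have h1 : ∀ᶠ ε : ℝ in 𝓝[>] 0, (∀ e, ε < θ e - ε) ∧ ∀ A : Finset V, A.Nonempty →
        (A : Set V) ≠ univ → c * A.card < ∑ e with a e ∈ A ∨ b e ∈ A, (θ e - ε) := by
      refine Filter.Eventually.filter_mono nhdsWithin_le_nhds (Filter.Eventually.and ?_ ?_)
      · rw [Filter.eventually_all]
        intro e
        have : Filter.Tendsto (fun ε : ℝ => θ e - ε - ε) (𝓝 0) (𝓝 (θ e - 0 - 0)) :=
          Continuous.tendsto (by fun_prop) 0
        filter_upwards [this.eventually (lt_mem_nhds (a := 0) (by simpa using hθ e))] with ε h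
        linarith
      · rw [Filter.eventually_all]
        intro A
        by_cases h : A.Nonempty ∧ (A : Set V) ≠ univ
        · have : Filter.Tendsto (fun ε : ℝ => ∑ e with a e ∈ A ∨ b e ∈ A, (θ e - ε)) (𝓝 0)
              (𝓝 (∑ e with a e ∈ A ∨ b e ∈ A, (θ e - 0))) := Continuous.tendsto (by fun_prop) 0
          filter_upwards [this.eventually (lt_mem_nhds (a := c * A.card)
            (by simpa using hA A h.1 h.2))] with ε h _ _
          exact h
        · exact Filter.Eventually.of_forall fun ε h1 h2 => absurd ⟨h1, h2⟩ h
    exact (h1.and self_mem_nhdsWithin).exists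
  have hcpt : IsCompact (Icc (fun _ : E => ε) (fun e => θ e - ε)) := isCompact_Icc
  have hcont : Continuous fun x => ∑ v, vertexSum a b θ x v ^ 2 :=
    continuous_finsetSum _ fun v _ => (continuous_vertexSum v).pow 2
  obtain ⟨x, hx, hmin⟩ := hcpt.exists_isMinOn (f := fun x => ∑ v, vertexSum a b θ x v ^ 2)
    ⟨fun _ => ε, le_refl _, fun e => (hε1 e).le⟩ hcont.continuousOn
  have hx1 : ∀ e, ε ≤ x e := hx.1
  have hx2 : ∀ e, x e ≤ θ e - ε := hx.2
  set S := vertexSum a b θ x with hS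
  refine ⟨x, fun e => ⟨hε.trans_le (hx1 e), by have := hx2 e; linarith⟩, ?_⟩
  by_contra! hcon
  obtain ⟨u, hu⟩ := hcon
  obtain ⟨m, -, hm⟩ := Finset.exists_min_image Finset.univ S ⟨u, Finset.mem_univ u⟩
  set A : Finset V := Finset.univ.filter fun v => S v = S m with hAdef
  have memA : ∀ v, v ∈ A ↔ S v = S m := fun v => by simp [hAdef]
  have hSm : S m < c := (hm u (Finset.mem_univ u)).trans_lt hu
  have hAne : A.Nonempty := ⟨m, (memA m).2 rfl⟩
  have hlt : ∀ v ∉ A, S m < S v := fun v hv =>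
    lt_of_le_of_ne (hm v (Finset.mem_univ v)) fun h => hv ((memA v).2 h.symm)
  have hsumA : ∑ v ∈ A, S v < c * A.card := by
    have : ∑ v ∈ A, S v < ∑ v ∈ A, c :=
      Finset.sum_lt_sum_of_nonempty hAne fun v hv => by rw [(memA v).1 hv]; exact hSm
    rwa [Finset.sum_const, nsmul_eq_mul, mul_comm] at this
  have hAuniv : (A : Set V) ≠ univ := by
    intro h
    rw [Finset.coe_eq_univ] at h
    rw [h, hS, sum_vertexSum, Finset.card_univ] at hsumA
    simp only [Finset.mem_univ, if_true, add_sub_cancel] at hsumA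
    linarith
  -- Shifting weight along an edge towards an end with a smaller sum decreases the sum of squares.
  have hshift : ∀ e t, ε ≤ x e + t → x e + t ≤ θ e - ε →
      t * (S (a e) - S (b e)) + t ^ 2 < 0 → False := by
    intro e t h1 h2 h3
    have hmem : Function.update x e (x e + t) ∈ Icc (fun _ : E => ε) (fun e => θ e - ε) := by
      constructor <;> intro e' <;> by_cases h : e' = e
      · subst h; simpa using h1
      · simpa [h] using hx1 e'
      · subst h; simpa using h2
      · simpa [h] using hx2 e'
    have h4 := hmin hmem
    simp only [mem_ofPred_eq] at h4
    rw [sum_sq_vertexSum_update x (hab e) t] at h4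
    linarith
  have ha : ∀ e, a e ∈ A → b e ∉ A → x e = θ e - ε := by
    intro e h1 h2
    by_contra hne
    have h3 : x e < θ e - ε := lt_of_le_of_ne (hx2 e) hne
    have h4 := hlt _ h2
    rw [← (memA _).1 h1] at h4
    set δ := min (θ e - ε - x e) ((S (b e) - S (a e)) / 2) with hδ
    have hδ0 : 0 < δ := lt_min (by linarith) (by linarith)
    have hδ1 : δ ≤ θ e - ε - x e := min_le_left _ _
    have hδ2 : δ ≤ (S (b e) - S (a e)) / 2 := min_le_right _ _
    have := hx1 e
    refine hshift e δ (by linarith) (by linarith) ?_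
    nlinarith
  have hb : ∀ e, b e ∈ A → a e ∉ A → x e = ε := by
    intro e h1 h2
    by_contra hne
    have h3 : ε < x e := lt_of_le_of_ne (hx1 e) (Ne.symm hne)
    have h4 := hlt _ h2
    rw [← (memA _).1 h1] at h4
    set δ := min (x e - ε) ((S (a e) - S (b e)) / 2) with hδ
    have hδ0 : 0 < δ := lt_min (by linarith) (by linarith)
    have hδ1 : δ ≤ x e - ε := min_le_left _ _
    have hδ2 : δ ≤ (S (a e) - S (b e)) / 2 := min_le_right _ _
    have := hx2 e
    refine hshift e (-δ) (by linarith) (by linarith) ?_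
    nlinarith
  have hge : ∑ e with a e ∈ A ∨ b e ∈ A, (θ e - ε) ≤ ∑ v ∈ A, S v := by
    rw [hS, sum_vertexSum, Finset.sum_filter]
    refine Finset.sum_le_sum fun e _ => ?_
    by_cases h1 : a e ∈ A <;> by_cases h2 : b e ∈ A <;> simp only [h1, h2, if_true, if_false,
      true_or, or_true, or_self]
    · linarith
    · rw [ha e h1 h2]; linarith
    · rw [hb e h2 h1]; linarith
    · linarith
  have := hε2 A hAne hAuniv
  linarith

/-- With a surplus on the whole vertex set as well, each vertex can receive exactly `c` while each
edge keeps something for itself. -/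
theorem exists_vertexSum_eq_of_lt [Fintype V] (hab : ∀ e, a e ≠ b e) (hθ : ∀ e, 0 < θ e) {c : ℝ}
    (hc : 0 < c)
    (hA : ∀ A : Finset V, A.Nonempty → c * A.card < ∑ e with a e ∈ A ∨ b e ∈ A, θ e) :
    ∃ y z : E → ℝ, (∀ e, 0 < y e ∧ 0 < z e ∧ y e + z e < θ e) ∧
      ∀ v, ∑ e, ((if a e = v then y e else 0) + (if b e = v then z e else 0)) = c := by
  classical
  -- The supplies are scaled down by a factor `κ < 1` close to `1`, so that a surplus remains.
  obtain ⟨κ, ⟨hκA, hκ1⟩, hκ0⟩ : ∃ κ : ℝ, ((∀ A : Finset V, A.Nonempty →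
      c * A.card < ∑ e with a e ∈ A ∨ b e ∈ A, κ * θ e) ∧ κ < 1) ∧ 0 < κ := by
    have h1 : ∀ᶠ κ : ℝ in 𝓝[<] 1, (∀ A : Finset V, A.Nonempty →
        c * A.card < ∑ e with a e ∈ A ∨ b e ∈ A, κ * θ e) := by
      refine Filter.Eventually.filter_mono nhdsWithin_le_nhds ?_
      rw [Filter.eventually_all]
      intro A
      by_cases h : A.Nonempty
      · have : Filter.Tendsto (fun κ : ℝ => ∑ e with a e ∈ A ∨ b e ∈ A, κ * θ e) (𝓝 1)
            (𝓝 (∑ e with a e ∈ A ∨ b e ∈ A, 1 * θ e)) := Continuous.tendsto (by fun_prop) 1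
        filter_upwards [this.eventually (lt_mem_nhds (a := c * A.card)
          (by simpa using hA A h))] with κ h _
        exact h
      · exact Filter.Eventually.of_forall fun κ h1 => absurd h1 h
    have h2 : ∀ᶠ κ : ℝ in 𝓝[<] 1, 0 < κ :=
      Filter.Eventually.filter_mono nhdsWithin_le_nhds (lt_mem_nhds one_pos)
    exact ((h1.and self_mem_nhdsWithin).and h2).exists
  have htot : c * Fintype.card V ≤ ∑ e, κ * θ e := by
    rcases isEmpty_or_nonempty V with hV | hV
    · rw [Fintype.card_eq_zero, Nat.cast_zero, mul_zero]
      exact Finset.sum_nonneg fun e _ => (mul_pos hκ0 (hθ e)).le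
    · have := hκA Finset.univ Finset.univ_nonempty
      simp only [Finset.mem_univ, or_self, Finset.filter_true, Finset.card_univ] at this
      exact this.le
  obtain ⟨x, hx, hxS⟩ := exists_vertexSum_ge (θ := fun e => κ * θ e) hab
    (fun e => mul_pos hκ0 (hθ e)) c (fun A h _ => hκA A h) htot
  set S := vertexSum a b (fun e => κ * θ e) x with hS
  have hS0 : ∀ v, 0 < S v := fun v => hc.trans_le (hxS v)
  have hle : ∀ v, c / S v ≤ 1 := fun v => (div_le_one (hS0 v)).2 (hxS v)
  have hpos : ∀ v, 0 < c / S v := fun v => div_pos hc (hS0 v)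
  refine ⟨fun e => c / S (a e) * x e, fun e => c / S (b e) * (κ * θ e - x e), fun e => ?_,
    fun v => ?_⟩
  · obtain ⟨h1, h2⟩ := hx e
    refine ⟨mul_pos (hpos _) h1, mul_pos (hpos _) (by linarith), ?_⟩
    have h3 := mul_le_mul_of_nonneg_right (hle (a e)) h1.le
    have h4 := mul_le_mul_of_nonneg_right (hle (b e)) (by linarith : 0 ≤ κ * θ e - x e)
    have h5 := mul_lt_mul_of_pos_right hκ1 (hθ e)
    linarith
  · have : ∑ e, ((if a e = v then c / S (a e) * x e else 0) +
        (if b e = v then c / S (b e) * (κ * θ e - x e) else 0)) = c / S v * S v := by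
      conv_rhs => rhs; rw [hS, vertexSum]
      rw [Finset.mul_sum]
      refine Finset.sum_congr rfl fun e _ => ?_
      rw [mul_add, mul_ite, mul_ite, mul_zero]
      congr 1 <;> refine if_ctx_congr Iff.rfl (fun h => ?_) fun _ => rfl <;> rw [← h]
    rw [this, div_mul_cancel₀ _ (hS0 v).ne']

/-- Without a surplus on the whole vertex set, each vertex receives exactly `c`. -/
theorem exists_vertexSum_eq [Fintype V] (hab : ∀ e, a e ≠ b e) (hθ : ∀ e, 0 < θ e) (c : ℝ)
    (hA : ∀ A : Finset V, A.Nonempty → (A : Set V) ≠ univ →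
      c * A.card < ∑ e with a e ∈ A ∨ b e ∈ A, θ e)
    (htot : ∑ e, θ e = c * Fintype.card V) :
    ∃ x : E → ℝ, (∀ e, x e ∈ Ioo 0 (θ e)) ∧ ∀ v, vertexSum a b θ x v = c := by
  obtain ⟨x, hx, hxS⟩ := exists_vertexSum_ge hab hθ c hA htot.ge
  refine ⟨x, hx, ?_⟩
  have h1 : ∑ v : V, c = ∑ v, vertexSum a b θ x v := by
    rw [sum_vertexSum]
    simp only [Finset.mem_univ, if_true, add_sub_cancel, htot]
    rw [Finset.sum_const, nsmul_eq_mul, Finset.card_univ, mul_comm]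
  rw [Finset.sum_eq_sum_iff_of_le fun v _ => hxS v] at h1
  exact fun v => (h1 v (Finset.mem_univ v)).symm

end VertexSums

/-! ### Arcs, surfaces and covering transformations -/

section Arcs

variable {Y : Type*} [TopologicalSpace Y] [T2Space Y]

/-- A path in the image of a compact set under an embedding lifts continuously to that set. -/
theorem continuousOn_invFunOn_comp {f g : ℝ → Y} {K S : Set ℝ} (hK : IsCompact K)
    (hf : ContinuousOn f K) (hinj : InjOn f K) (hg : ContinuousOn g S) (hgS : g '' S ⊆ f '' K) :
    ContinuousOn (fun t => Function.invFunOn f K (g t)) S := by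
  have hmem : ∀ t ∈ S, ∃ s ∈ K, f s = g t := fun t ht => hgS ⟨t, ht, rfl⟩
  have := isCompact_iff_compactSpace.1 hK
  have hemb : IsClosedEmbedding (K.domRestrict f) :=
    hf.domRestrict.isClosedEmbedding (injOn_iff_injective.1 hinj)
  let m : S → K := fun t => ⟨Function.invFunOn f K (g t), Function.invFunOn_mem (hmem t t.2)⟩
  have hm : Continuous m := by
    rw [hemb.isInducing.continuous_iff]
    have : K.domRestrict f ∘ m = S.domRestrict g :=
      funext fun t => Function.invFunOn_eq (hmem t t.2)
    rw [this]
    exact hg.domRestrict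
  rw [continuousOn_iff_continuous_domRestrict]
  exact continuous_subtype_val.comp hm

/-- The end points of an arc do not depend on its parametrization. -/
theorem arc_ends_eq {γ δ : ℝ → Y} (hγ : ContinuousOn γ (Icc 0 1)) (hγi : InjOn γ (Icc 0 1))
    (hδ : ContinuousOn δ (Icc 0 1)) (hδi : InjOn δ (Icc 0 1))
    (h : γ '' Icc 0 1 = δ '' Icc 0 1) : ({γ 0, γ 1} : Set Y) = {δ 0, δ 1} := by
  set ψ : ℝ → ℝ := fun t => Function.invFunOn δ (Icc 0 1) (γ t) with hψ
  have hex : ∀ t ∈ Icc (0 : ℝ) 1, ∃ s ∈ Icc (0 : ℝ) 1, δ s = γ t := fun t ht =>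
    h.subset ⟨t, ht, rfl⟩
  have hψm : ∀ t ∈ Icc (0 : ℝ) 1, ψ t ∈ Icc (0 : ℝ) 1 := fun t ht =>
    Function.invFunOn_mem (hex t ht)
  have hψe : ∀ t ∈ Icc (0 : ℝ) 1, δ (ψ t) = γ t := fun t ht => Function.invFunOn_eq (hex t ht)
  have hψc : ContinuousOn ψ (Icc 0 1) :=
    continuousOn_invFunOn_comp isCompact_Icc hδ hδi hγ h.subset
  have hψi : InjOn ψ (Icc 0 1) := fun s hs t ht hst =>
    hγi hs ht (by rw [← hψe s hs, ← hψe t ht, hst])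
  have hψs : ∀ s ∈ Icc (0 : ℝ) 1, ∃ t ∈ Icc (0 : ℝ) 1, ψ t = s := by
    intro s hs
    obtain ⟨t, ht, hts⟩ := h.symm.subset ⟨s, hs, rfl⟩
    exact ⟨t, ht, hδi (hψm t ht) hs (by rw [hψe t ht, hts])⟩
  have m0 : (0 : ℝ) ∈ Icc (0 : ℝ) 1 := by simp
  have m1 : (1 : ℝ) ∈ Icc (0 : ℝ) 1 := by simp
  obtain ⟨t0, ht0, e0⟩ := hψs 0 m0
  obtain ⟨t1, ht1, e1⟩ := hψs 1 m1
  rcases hψc.strictMonoOn_of_injOn_Icc' zero_le_one hψi with hm | hm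
  · have a0 : ψ 0 = 0 :=
      le_antisymm ((hm.monotoneOn m0 ht0 ht0.1).trans e0.le) (hψm 0 m0).1
    have a1 : ψ 1 = 1 :=
      le_antisymm (hψm 1 m1).2 (e1.ge.trans (hm.monotoneOn ht1 m1 ht1.2))
    rw [← hψe 0 m0, ← hψe 1 m1, a0, a1]
  · have a0 : ψ 0 = 1 :=
      le_antisymm (hψm 0 m0).2 (e1.ge.trans (hm.antitoneOn m0 ht1 ht1.1))
    have a1 : ψ 1 = 0 :=
      le_antisymm ((hm.antitoneOn ht0 m1 ht0.2).trans e0.le) (hψm 1 m1).1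
    rw [← hψe 0 m0, ← hψe 1 m1, a0, a1, Set.pair_comm]

/-- An arc contains no simple closed curve. -/
theorem arc_no_loop {γ δ : ℝ → Y} (hγ : ContinuousOn γ (Icc 0 1)) (hγi : InjOn γ (Icc 0 1))
    (hδ : ContinuousOn δ (Icc 0 1)) (hδi : InjOn δ (Ico 0 1)) (hδi' : InjOn δ (Ioc 0 1))
    (h01 : δ 0 = δ 1) (h : δ '' Icc 0 1 ⊆ γ '' Icc 0 1) : False := by
  set ψ : ℝ → ℝ := fun t => Function.invFunOn γ (Icc 0 1) (δ t) with hψ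
  have hψe : ∀ t ∈ Icc (0 : ℝ) 1, γ (ψ t) = δ t := fun t ht =>
    Function.invFunOn_eq (h ⟨t, ht, rfl⟩)
  have hψc : ContinuousOn ψ (Icc 0 1) :=
    continuousOn_invFunOn_comp isCompact_Icc hγ hγi hδ h
  have hends : ψ 0 = ψ 1 := by simp only [hψ, h01]
  have hsub : Icc (0 : ℝ) (3 / 4) ⊆ Icc 0 1 := Icc_subset_Icc le_rfl (by norm_num)
  have hsub' : Icc (1 / 4 : ℝ) 1 ⊆ Icc 0 1 := Icc_subset_Icc (by norm_num) le_rfl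
  have i1 : InjOn ψ (Icc 0 (3 / 4)) := fun s hs t ht hst =>
    hδi ⟨hs.1, hs.2.trans_lt (by norm_num)⟩ ⟨ht.1, ht.2.trans_lt (by norm_num)⟩
      (by rw [← hψe s (hsub hs), ← hψe t (hsub ht), hst])
  have i2 : InjOn ψ (Icc (1 / 4) 1) := fun s hs t ht hst =>
    hδi' ⟨lt_of_lt_of_le (by norm_num) hs.1, hs.2⟩ ⟨lt_of_lt_of_le (by norm_num) ht.1, ht.2⟩
      (by rw [← hψe s (hsub' hs), ← hψe t (hsub' ht), hst])
  have c1 := (hψc.mono hsub).strictMonoOn_of_injOn_Icc' (by norm_num) i1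
  have c2 := (hψc.mono hsub').strictMonoOn_of_injOn_Icc' (by norm_num) i2
  have a0 : (0 : ℝ) ∈ Icc (0 : ℝ) (3 / 4) := by constructor <;> norm_num
  have a1 : (1 / 2 : ℝ) ∈ Icc (0 : ℝ) (3 / 4) := by constructor <;> norm_num
  have a2 : (3 / 4 : ℝ) ∈ Icc (0 : ℝ) (3 / 4) := by constructor <;> norm_num
  have b1 : (1 / 2 : ℝ) ∈ Icc (1 / 4 : ℝ) 1 := by constructor <;> norm_num
  have b2 : (3 / 4 : ℝ) ∈ Icc (1 / 4 : ℝ) 1 := by constructor <;> norm_num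
  have b3 : (1 : ℝ) ∈ Icc (1 / 4 : ℝ) 1 := by constructor <;> norm_num
  rcases c1 with c1 | c1 <;> rcases c2 with c2 | c2
  · have h1 := c1 a0 a1 (by norm_num)
    have h2 := c2 b1 b3 (by norm_num)
    linarith
  · have h1 := c1 a1 a2 (by norm_num)
    have h2 := c2 b1 b2 (by norm_num)
    linarith
  · have h1 := c1 a1 a2 (by norm_num)
    have h2 := c2 b1 b2 (by norm_num)
    linarith
  · have h1 := c1 a0 a1 (by norm_num)
    have h2 := c2 b1 b3 (by norm_num)
    linarith

end Arcs

section Surfaces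

variable {Y : Type*} [TopologicalSpace Y] [ChartedSpace (EuclideanSpace ℝ (Fin 2)) Y]

theorem isPreconnected_ball_diff_center (c : EuclideanSpace ℝ (Fin 2)) (r : ℝ) :
    IsPreconnected (Metric.ball c r \ {c}) := by
  have hrank : 1 < Module.rank ℝ (EuclideanSpace ℝ (Fin 2)) :=
    Module.lt_rank_of_lt_finrank (by simp)
  have h1 := ((isPreconnected_sphere hrank 0 1).prod (isPreconnected_Ioo (a := (0 : ℝ)) (b := r)))
  have h2 := h1.image (fun p => c + p.2 • p.1) (by fun_prop)
  convert h2 using 1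
  ext x
  simp only [mem_sdiff, Metric.mem_ball, mem_singleton_iff, mem_image, mem_prod, Prod.exists,
    mem_sphere_iff_norm, sub_zero, mem_Ioo]
  constructor
  · rintro ⟨hx, hne⟩
    have hpos : 0 < ‖x - c‖ := norm_pos_iff.2 (sub_ne_zero.2 hne)
    refine ⟨‖x - c‖⁻¹ • (x - c), ‖x - c‖, ⟨?_, hpos, by rwa [dist_eq_norm] at hx⟩, ?_⟩
    · rw [norm_smul, norm_inv, norm_norm, inv_mul_cancel₀ hpos.ne']
    · rw [smul_inv_smul₀ hpos.ne', add_sub_cancel]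
  · rintro ⟨s, t, ⟨hs, ht0, htr⟩, rfl⟩
    have hn : ‖t • s‖ = t := by rw [norm_smul, hs, mul_one, Real.norm_of_nonneg ht0.le]
    refine ⟨by rw [dist_eq_norm, add_sub_cancel_left, hn]; exact htr, fun h => ?_⟩
    rw [add_eq_left] at h
    rw [h, norm_zero] at hn
    exact ht0.ne hn

/-- Points of a surface have small neighbourhoods that stay connected when punctured. -/
theorem exists_punctured_nhds {y : Y} {U : Set Y} (hU : U ∈ 𝓝 y) :
    ∃ N ⊆ U, IsOpen N ∧ y ∈ N ∧ IsPreconnected (N \ {y}) ∧ (𝓝[≠] y).NeBot := by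
  set φ := chartAt (EuclideanSpace ℝ (Fin 2)) y with hφ
  have hy : y ∈ φ.source := mem_chart_source _ y
  have h1 : φ.target ∩ φ.symm ⁻¹' U ∈ 𝓝 (φ y) := by
    refine Filter.inter_mem (φ.open_target.mem_nhds (φ.map_source hy)) ?_
    refine (φ.continuousAt_symm (φ.map_source hy)).preimage_mem_nhds ?_
    rwa [φ.left_inv hy]
  obtain ⟨r, hr, hball⟩ := Metric.mem_nhds_iff.1 h1
  have hN : φ.symm '' Metric.ball (φ y) r = φ.source ∩ φ ⁻¹' Metric.ball (φ y) r :=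
    φ.symm_image_eq_source_inter_preimage fun x hx => (hball hx).1
  refine ⟨φ.symm '' Metric.ball (φ y) r, ?_, ?_, ?_, ?_, ?_⟩
  · rintro _ ⟨x, hx, rfl⟩
    exact (hball hx).2
  · rw [hN]
    exact φ.isOpen_inter_preimage Metric.isOpen_ball
  · exact ⟨φ y, Metric.mem_ball_self hr, φ.left_inv hy⟩
  · have : φ.symm '' Metric.ball (φ y) r \ {y} = φ.symm '' (Metric.ball (φ y) r \ {φ y}) := by
      ext z
      constructor
      · rintro ⟨⟨x, hx, rfl⟩, hne⟩
        exact ⟨x, ⟨hx, fun h => hne (by rw [mem_singleton_iff.1 h]; exact φ.left_inv hy)⟩, rfl⟩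
      · rintro ⟨x, ⟨hx, hne⟩, rfl⟩
        refine ⟨⟨x, hx, rfl⟩, fun h => hne ?_⟩
        rw [mem_singleton_iff] at h ⊢
        rw [← h, φ.right_inv (hball hx).1]
    rw [this]
    exact (isPreconnected_ball_diff_center _ _).image _
      (φ.continuousOn_symm.mono fun x hx => (hball hx.1).1)
  · by_contra hbot
    rw [Filter.not_neBot] at hbot
    have hopen : IsOpen ({y} : Set Y) := by
      rw [isOpen_singleton_iff_nhds_eq_pure]
      rw [← nhdsNE_sup_pure, hbot, bot_sup_eq]
    have h2 := φ.isOpen_image_of_subset_source hopen (by simpa using hy)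
    rw [image_singleton] at h2
    have h3 : (𝓝[≠] (φ y)) = ⊥ := by
      rw [isOpen_singleton_iff_punctured_nhds] at h2
      exact h2
    exact (Module.punctured_nhds_neBot ℝ (EuclideanSpace ℝ (Fin 2)) (φ y)).ne h3

/-- A connected surface is not disconnected by a discrete closed set: if open sets separate the
complement, then so do, on the whole surface, the sets of points that have punctured neighbourhoods
in the one or the other. -/
theorem isPreconnected_compl_of_discrete [PreconnectedSpace Y] {D : Set Y}
    (hD : ∀ y, ∃ U ∈ 𝓝 y, U ∩ D ⊆ {y}) : IsPreconnected Dᶜ := by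
  have hne : ∀ y : Y, (𝓝[≠] y).NeBot := fun y => by
    obtain ⟨N, -, -, -, -, h⟩ := exists_punctured_nhds (y := y) Filter.univ_mem
    exact h
  have hDev : ∀ y, ∀ᶠ z in 𝓝[≠] y, z ∈ Dᶜ := by
    intro y
    obtain ⟨U, hU, h⟩ := hD y
    rw [eventually_nhdsWithin_iff]
    filter_upwards [hU] with z hz hzy hzD
    exact hzy (h ⟨hz, hzD⟩)
  rw [isPreconnected_iff_subset_of_disjoint]
  intro u v hu hv huv hdisj
  have hsep : ∀ y, (∀ᶠ z in 𝓝[≠] y, z ∈ u) → (∀ᶠ z in 𝓝[≠] y, z ∈ v) → False := by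
    intro y h1 h2
    have := hne y
    obtain ⟨z, ⟨h1, h2⟩, h3⟩ := ((h1.and h2).and (hDev y)).exists
    have : z ∈ Dᶜ ∩ (u ∩ v) := ⟨h3, h1, h2⟩
    rw [hdisj] at this
    exact this
  have hopen : ∀ w : Set Y, IsOpen w → IsOpen {y | ∀ᶠ z in 𝓝[≠] y, z ∈ w} := by
    intro w hw
    rw [isOpen_iff_mem_nhds]
    intro y hy
    rw [mem_ofPred_eq, eventually_nhdsWithin_iff, eventually_nhds_iff] at hy
    obtain ⟨N, hN, hNo, hyN⟩ := hy
    filter_upwards [hNo.mem_nhds hyN] with z hz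
    by_cases hzy : z = y
    · subst hzy
      rw [eventually_nhdsWithin_iff]
      filter_upwards [hNo.mem_nhds hyN] with x hx using hN x hx
    · exact mem_nhdsWithin_of_mem_nhds (hw.mem_nhds (hN z hz hzy))
  have hcov : ∀ y, (∀ᶠ z in 𝓝[≠] y, z ∈ u) ∨ (∀ᶠ z in 𝓝[≠] y, z ∈ v) := by
    intro y
    obtain ⟨U, hU, hUD⟩ := hD y
    obtain ⟨N, hNU, hNo, hyN, hNc, -⟩ := exists_punctured_nhds hU
    have hND : N \ {y} ⊆ Dᶜ := fun z hz hzD => hz.2 (hUD ⟨hNU hz.1, hzD⟩)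
    have hev : ∀ᶠ z in 𝓝[≠] y, z ∈ N \ {y} :=
      Filter.inter_mem (mem_nhdsWithin_of_mem_nhds (hNo.mem_nhds hyN)) self_mem_nhdsWithin
    rcases isPreconnected_iff_subset_of_disjoint.1 hNc u v hu hv (hND.trans huv)
      (subset_empty_iff.1 (hdisj ▸ inter_subset_inter_left _ hND)) with h | h
    · exact Or.inl (hev.mono fun z hz => h hz)
    · exact Or.inr (hev.mono fun z hz => h hz)
  have huniv : IsPreconnected (univ : Set Y) := isPreconnected_univ
  rcases isPreconnected_iff_subset_of_disjoint.1 huniv _ _ (hopen u hu) (hopen v hv)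
    (fun y _ => hcov y) (by
      ext y
      simp only [mem_inter_iff, mem_ofPred_eq, mem_empty_iff_false, iff_false]
      exact fun h => hsep y h.2.1 h.2.2) with h | h
  · left
    intro z hz
    refine (huv hz).resolve_right fun hzv => ?_
    exact hsep z (h trivial) (mem_nhdsWithin_of_mem_nhds (hv.mem_nhds hzv))
  · right
    intro z hz
    refine (huv hz).resolve_left fun hzu => ?_
    exact hsep z (mem_nhdsWithin_of_mem_nhds (hu.mem_nhds hzu)) (h trivial)

end Surfaces

section Deck

variable {Y X : Type*} [TopologicalSpace Y] [TopologicalSpace X]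

/-- The group of covering transformations. -/
def Deck (u : Y → X) : Subgroup (Y ≃ₜ Y) where
  carrier := {g | ∀ y, u (g y) = u y}
  one_mem' _ := rfl
  mul_mem' {g h} hg hh y := (hg (h y)).trans (hh y)
  inv_mem' {g} hg y := by
    have := hg (g⁻¹ y)
    rw [← this]
    exact congrArg u (g.apply_symm_apply y)

variable {u : Y → X}

theorem Deck.eq_one [PreconnectedSpace Y] (hu : IsCoveringMap u) {g : Deck u} {y : Y}
    (h : g.1 y = y) : g = 1 := by
  have h1 : (g.1 : Y → Y) = id :=
    hu.eq_of_comp_eq g.1.continuous continuous_id (funext fun z => g.2 z) y h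
  exact Subtype.ext (Homeomorph.ext fun z => congrFun h1 z)

theorem Deck.eq_of_apply_eq [PreconnectedSpace Y] (hu : IsCoveringMap u) {g h : Deck u} {y : Y}
    (e : g.1 y = h.1 y) : g = h := by
  have : h⁻¹ * g = 1 := Deck.eq_one hu (y := y) (by
    change h.1.symm (g.1 y) = y
    rw [e, Homeomorph.symm_apply_apply])
  exact (inv_mul_eq_one.1 this).symm

/-- Covering transformations of a simply connected covering space act transitively on the fibres. -/
theorem Deck.exists_apply_eq [SimplyConnectedSpace Y] [LocallyPathConnectedSpace Y]
    (hu : IsCoveringMap u) {y y' : Y} (h : u y = u y') : ∃ g : Deck u, g.1 y = y' := by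
  obtain ⟨f, ⟨hf, hfu⟩, -⟩ := hu.existsUnique_continuousMap_lifts ⟨u, hu.continuous⟩ y y' h.symm
  obtain ⟨k, ⟨hk, hku⟩, -⟩ := hu.existsUnique_continuousMap_lifts ⟨u, hu.continuous⟩ y' y h
  have hfu' : ∀ z, u (f z) = u z := fun z => congrFun hfu z
  have hku' : ∀ z, u (k z) = u z := fun z => congrFun hku z
  have h1 : (fun z => k (f z)) = id :=
    hu.eq_of_comp_eq (k.continuous.comp f.continuous) continuous_id
      (funext fun z => (hku' _).trans (hfu' z)) y (by simp [hf, hk])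
  have h2 : (fun z => f (k z)) = id :=
    hu.eq_of_comp_eq (f.continuous.comp k.continuous) continuous_id
      (funext fun z => (hfu' _).trans (hku' z)) y' (by simp [hf, hk])
  exact ⟨⟨⟨⟨f, k, congrFun h1, congrFun h2⟩, f.continuous, k.continuous⟩, hfu'⟩, hf⟩

theorem IsCoveringMap.t2Space [T2Space X] (hu : IsCoveringMap u) : T2Space Y := by
  refine ⟨fun y y' hne => ?_⟩
  by_cases h : u y = u y'
  · exact hu.isSeparatedMap y y' h hne
  · obtain ⟨A, B, hA, hB, hy, hy', hd⟩ := t2_separation h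
    exact ⟨u ⁻¹' A, u ⁻¹' B, hA.preimage hu.continuous, hB.preimage hu.continuous, hy, hy',
      hd.preimage u⟩

theorem IsCoveringMap.exists_injOn_nhds (hu : IsCoveringMap u) (y : Y) :
    ∃ N, IsOpen N ∧ y ∈ N ∧ InjOn u N := by
  obtain ⟨φ, hy, rfl⟩ := hu.isLocalHomeomorph y
  exact ⟨φ.source, φ.open_source, hy, φ.injOn⟩

/-- The translates of a compact set under covering transformations are locally finite. -/
theorem Deck.locallyFinite [T2Space X] [SimplyConnectedSpace Y] [LocallyPathConnectedSpace Y]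
    (hu : IsCoveringMap u) {C : Set Y} (hC : IsCompact C) :
    LocallyFinite fun g : Deck u => g.1 '' C := by
  intro y
  refine hC.induction_on (p := fun C => ∃ N ∈ 𝓝 y, {g : Deck u | (g.1 '' C ∩ N).Nonempty}.Finite)
    ⟨univ, Filter.univ_mem, by simp⟩ ?_ ?_ ?_
  · rintro s t hst ⟨N, hN, hfin⟩
    exact ⟨N, hN, hfin.subset fun g hg =>
      hg.mono (inter_subset_inter_left _ (image_mono hst))⟩
  · rintro s t ⟨N, hN, hfin⟩ ⟨N', hN', hfin'⟩
    refine ⟨N ∩ N', Filter.inter_mem hN hN', (hfin.union hfin').subset ?_⟩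
    rintro g ⟨_, ⟨z, hz | hz, rfl⟩, hzN⟩
    · exact Or.inl ⟨_, ⟨z, hz, rfl⟩, hzN.1⟩
    · exact Or.inr ⟨_, ⟨z, hz, rfl⟩, hzN.2⟩
  · intro x _
    by_cases h : u x = u y
    · obtain ⟨k, hk⟩ := Deck.exists_apply_eq hu h
      obtain ⟨N, hN, hyN, hinj⟩ := hu.exists_injOn_nhds y
      refine ⟨k.1 ⁻¹' N, mem_nhdsWithin_of_mem_nhds
        (k.1.continuous.continuousAt.preimage_mem_nhds (by rw [hk]; exact hN.mem_nhds hyN)),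
        N, hN.mem_nhds hyN, (Set.finite_singleton k).subset ?_⟩
      rintro g ⟨_, ⟨z, hz, rfl⟩, hzN⟩
      exact Deck.eq_of_apply_eq hu
        (hinj hzN hz ((g.2 z).trans (k.2 z).symm))
    · obtain ⟨A, B, hA, hB, hx, hy, hd⟩ := t2_separation h
      refine ⟨u ⁻¹' A, mem_nhdsWithin_of_mem_nhds ((hA.preimage hu.continuous).mem_nhds hx),
        u ⁻¹' B, (hB.preimage hu.continuous).mem_nhds hy, Set.finite_empty.subset ?_⟩
      rintro g ⟨_, ⟨z, hz, rfl⟩, hzN⟩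
      exact hd.le_bot ⟨hz, (g.2 z).symm ▸ hzN⟩

/-- The covering space of a surface is a surface. -/
noncomputable abbrev IsCoveringMap.chartedSpace {H : Type*} [TopologicalSpace H] [ChartedSpace H X]
    (hu : IsCoveringMap u) : ChartedSpace H Y where
  atlas := univ
  chartAt y := (hu.isLocalHomeomorph y).choose.trans (chartAt H (u y))
  mem_chart_source y := by
    obtain ⟨h1, h2⟩ := (hu.isLocalHomeomorph y).choose_spec
    rw [OpenPartialHomeomorph.trans_source]
    refine ⟨h1, ?_⟩
    rw [mem_preimage, ← h2]
    exact mem_chart_source H (u y)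
  chart_mem_atlas _ := trivial

end Deck

/-! ### The boundary cycle of a cell -/

section UnitCircle

/-- The point of the unit circle at the angle `2πt`. -/
noncomputable def circlePt (t : ℝ) : ℂ := Complex.exp (2 * π * t * Complex.I)

theorem continuous_circlePt : Continuous circlePt := by unfold circlePt; fun_prop

theorem norm_circlePt (t : ℝ) : ‖circlePt t‖ = 1 := by
  have : (2 * π * t * Complex.I : ℂ) = ((2 * π * t : ℝ) : ℂ) * Complex.I := by push_cast; ring
  rw [circlePt, this, Complex.norm_exp_ofReal_mul_I]

theorem circlePt_eq_iff {s t : ℝ} : circlePt s = circlePt t ↔ ∃ n : ℤ, s = t + n := by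
  rw [circlePt, circlePt, Complex.exp_eq_exp_iff_exists_int]
  refine exists_congr fun n => ?_
  have h1 : (2 * π * Complex.I : ℂ) ≠ 0 := Complex.two_pi_I_ne_zero
  have h2 : (2 * π * s * Complex.I : ℂ) = (2 * π * Complex.I) * (s : ℂ) := by ring
  have h3 : (2 * π * t * Complex.I + n * (2 * π * Complex.I) : ℂ) =
      (2 * π * Complex.I) * ((t + n : ℝ) : ℂ) := by push_cast; ring
  rw [h2, h3, mul_right_inj' h1, Complex.ofReal_inj]

theorem eq_of_circlePt_eq {s t : ℝ} (h : circlePt s = circlePt t) (hst : |s - t| < 1) : s = t := by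
  obtain ⟨n, rfl⟩ := circlePt_eq_iff.1 h
  rw [add_sub_cancel_left] at hst
  have : |n| < 1 := by exact_mod_cast hst
  rw [Int.abs_lt_one_iff.1 this]
  simp

theorem exists_circlePt_eq {z : ℂ} (hz : ‖z‖ = 1) : ∃ t ∈ Ico (0 : ℝ) 1, circlePt t = z := by
  have h1 : circlePt (z.arg / (2 * π)) = z := by
    have h2 : (2 * π * ((z.arg / (2 * π) : ℝ) : ℂ) * Complex.I : ℂ) = z.arg * Complex.I := by
      have : (π : ℂ) ≠ 0 := Complex.ofReal_ne_zero.2 Real.pi_ne_zero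
      push_cast
      field_simp
    have h3 := Complex.norm_mul_exp_arg_mul_I z
    rw [hz, Complex.ofReal_one, one_mul] at h3
    rw [circlePt, h2, h3]
  refine ⟨Int.fract (z.arg / (2 * π)), ⟨Int.fract_nonneg _, Int.fract_lt_one _⟩, ?_⟩
  rw [← h1, circlePt_eq_iff]
  exact ⟨-⌊z.arg / (2 * π)⌋, by push_cast; rw [← sub_eq_add_neg]; rw [h1]; rfl⟩

end UnitCircle

namespace CellDecomposition

variable {Y X : Type*} [TopologicalSpace Y] [TopologicalSpace X] {u : Y → X}
  (T : CellDecomposition u)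

theorem exists_notMem_verts {e : Set Y} (he : e ∈ T.edges) : ∃ p ∈ e, p ∉ T.verts := by
  obtain ⟨γ, -, hinj, rfl, hV, -⟩ := T.edge_arc e he
  have m : (1 / 2 : ℝ) ∈ Icc (0 : ℝ) 1 := by constructor <;> norm_num
  refine ⟨γ (1 / 2), ⟨_, m, rfl⟩, fun h => ?_⟩
  have h1 : γ (1 / 2) ∈ ({γ 0, γ 1} : Set Y) := hV.subset ⟨⟨_, m, rfl⟩, h⟩
  rcases h1 with h1 | h1
  · have := hinj m (by simp) h1
    norm_num at this
  · have := hinj m (by simp) h1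
    norm_num at this

theorem edge_eq_of_mem {e e' : Set Y} (he : e ∈ T.edges) (he' : e' ∈ T.edges) {p : Y}
    (hp : p ∈ e) (hp' : p ∈ e') (hpv : p ∉ T.verts) : e = e' := by
  by_contra hne
  exact hpv (T.edge_inter e he e' he' hne ⟨hp, hp'⟩)

theorem isCompact_cell {f : Set Y} (hf : f ∈ T.cells) : IsCompact f := by
  obtain ⟨n, Φ, -, hc, -, rfl, -⟩ := T.cell_disk f hf
  exact (isCompact_closedBall 0 1).image_of_continuousOn hc

/-- The edges of a cell, in the order in which they lie on its boundary, form a cycle. -/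
theorem exists_cycle_of_cell [T2Space Y] {f : Set Y} (hf : f ∈ T.cells) :
    ∃ (n : ℕ) (v : ℕ → T.verts) (e : ℕ → T.edges),
      IsCycle (fun (v : T.verts) (e : T.edges) => (v : Y) ∈ (e : Set Y)) n v e ∧
      (∀ x : T.edges, (x : Set Y) ⊆ f ↔ ∃ i < n, e i = x) ∧
      ∀ x ∈ f, x ∈ T.verts → ∃ i < n, x ∈ (e i : Set Y) := by
  obtain ⟨n, Φ, hn, hc, hinj, rfl, hedge, -, hverts, hdisj⟩ := T.cell_disk f hf
  have hn' : (0 : ℝ) < n := by exact_mod_cast hn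
  have hball : ∀ t, circlePt t ∈ Metric.closedBall (0 : ℂ) 1 := fun t => by
    rw [mem_closedBall_zero_iff, norm_circlePt]
  set δ : ℕ → ℝ → Y := fun k t => Φ (circlePt ((k + t) / n)) with hδ
  have himg : ∀ k : ℕ, Φ '' ((fun t : ℝ => Complex.exp (2 * π * t * Complex.I)) ''
      Icc ((k : ℝ) / n) (((k : ℝ) + 1) / n)) = δ k '' Icc 0 1 := by
    intro k
    rw [image_image]
    ext y
    constructor
    · rintro ⟨t, ⟨h1, h2⟩, rfl⟩
      rw [div_le_iff₀ hn'] at h1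
      rw [le_div_iff₀ hn'] at h2
      refine ⟨t * n - k, ⟨by linarith, by linarith⟩, ?_⟩
      simp only [hδ, circlePt]
      rw [add_sub_cancel, mul_div_cancel_right₀ _ hn'.ne']
    · rintro ⟨t, ⟨h1, h2⟩, rfl⟩
      exact ⟨(k + t) / n, ⟨by gcongr; linarith, by gcongr⟩, rfl⟩
  have hδe : ∀ k < n, δ k '' Icc 0 1 ∈ T.edges := fun k hk => himg k ▸ hedge k hk
  have hδc : ∀ k, Continuous (δ k) := fun k => hc.comp_continuous
    (continuous_circlePt.comp (by fun_prop)) fun t => hball _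
  have hΦ : ∀ {s t}, Φ (circlePt s) = Φ (circlePt t) → |s - t| < 1 → s = t :=
    fun h h' => eq_of_circlePt_eq (hinj (hball _) (hball _) h) h'
  have hn2 : 2 ≤ n := by
    by_contra hcon
    obtain rfl : n = 1 := by omega
    -- The boundary circle would be an edge.
    obtain ⟨γ, hγ, hγi, hγe, -⟩ := T.edge_arc _ (hδe 0 (by norm_num))
    have key : ∀ s t : ℝ, |s - t| < 1 → δ 0 s = δ 0 t → s = t := by
      intro s t hst h
      have := hΦ h (by simpa using hst)
      simpa using this
    refine arc_no_loop hγ hγi (hδc 0).continuousOn (fun s hs t ht h => key s t ?_ h)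
      (fun s hs t ht h => key s t ?_ h) ?_ hγe.symm.subset
    · rw [abs_lt]; constructor <;> linarith [hs.1, hs.2, ht.1, ht.2]
    · rw [abs_lt]; constructor <;> linarith [hs.1, hs.2, ht.1, ht.2]
    · simp only [hδ]
      congr 1
      rw [circlePt_eq_iff]
      exact ⟨-1, by norm_num⟩
  have hn2' : (2 : ℝ) ≤ n := by exact_mod_cast hn2
  have hδi : ∀ k, InjOn (δ k) (Icc 0 1) := by
    intro k s hs t ht h
    have h1 : ((k + s) / n : ℝ) = (k + t) / n := by
      refine hΦ h ?_
      rw [← sub_div, abs_div, abs_of_pos hn', div_lt_one hn', abs_lt]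
      constructor <;> linarith [hs.1, hs.2, ht.1, ht.2]
    rw [div_left_inj' hn'.ne'] at h1
    linarith
  have hδv : ∀ k < n, δ k '' Icc 0 1 ∩ T.verts = {δ k 0, δ k 1} := by
    intro k hk
    obtain ⟨γ, hγ, hγi, hγe, hV, -⟩ := T.edge_arc _ (hδe k hk)
    rw [hV]
    exact arc_ends_eq hγ hγi (hδc k).continuousOn (hδi k) hγe
  have hδs : ∀ k : ℕ, δ k 1 = δ (k + 1) 0 := fun k => by simp [hδ]
  have hδn : δ n 0 = δ 0 0 := by
    simp only [hδ]
    congr 1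
    rw [circlePt_eq_iff]
    exact ⟨1, by simp [hn'.ne']⟩
  have hmem : ∀ k ≤ n, δ k 0 ∈ T.verts := by
    intro k hk
    rcases Nat.lt_or_ge k n with h | h
    · exact ((hδv k h).symm.subset (by simp)).2
    · obtain rfl : k = n := by omega
      rw [hδn]
      exact ((hδv 0 hn).symm.subset (by simp)).2
  have hv : ∀ k, ∃ p : T.verts, k ≤ n → (p : Y) = δ k 0 := by
    intro k
    by_cases h : k ≤ n
    · exact ⟨⟨_, hmem k h⟩, fun _ => rfl⟩
    · exact ⟨⟨_, hmem 0 hn.le⟩, fun h' => absurd h' h⟩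
  have he : ∀ k, ∃ p : T.edges, k < n → (p : Set Y) = δ k '' Icc 0 1 := by
    intro k
    by_cases h : k < n
    · exact ⟨⟨_, hδe k h⟩, fun _ => rfl⟩
    · exact ⟨⟨_, hδe 0 hn⟩, fun h' => absurd h' h⟩
  choose v hv using hv
  choose e he using he
  have hcirc : ∀ z : ℂ, ‖z‖ = 1 → ∃ k < n, Φ z ∈ δ k '' Icc 0 1 := by
    intro z hz
    obtain ⟨t, ⟨ht0, ht1⟩, rfl⟩ := exists_circlePt_eq hz
    have h0 : 0 ≤ t * n := by positivity
    have h1 := Nat.floor_le h0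
    have h2 := Nat.lt_floor_add_one (t * n)
    refine ⟨⌊t * n⌋₊, ?_, t * n - ⌊t * n⌋₊, ⟨by linarith, by linarith⟩, ?_⟩
    · rw [Nat.floor_lt h0]
      nlinarith
    · simp only [hδ]
      rw [add_sub_cancel, mul_div_cancel_right₀ _ hn'.ne']
  have hbd : ∀ y ∈ Φ '' Metric.closedBall 0 1, y ∉ Φ '' Metric.ball 0 1 →
      ∃ k < n, y ∈ δ k '' Icc 0 1 := by
    rintro _ ⟨z, hz, rfl⟩ hzb
    refine hcirc z (le_antisymm (mem_closedBall_zero_iff.1 hz) ?_)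
    by_contra! h
    exact hzb ⟨z, mem_ball_zero_iff.2 h, rfl⟩
  have hsubf : ∀ k, δ k '' Icc 0 1 ⊆ Φ '' Metric.closedBall 0 1 := by
    rintro k _ ⟨t, -, rfl⟩
    exact ⟨_, hball _, rfl⟩
  have hvi : ∀ i < n, ∀ j < n, v i = v j → i = j := by
    intro i hi j hj h
    have h1 : δ i 0 = δ j 0 := by rw [← hv i hi.le, ← hv j hj.le, h]
    have hi' : (i : ℝ) < n := by exact_mod_cast hi
    have hj' : (j : ℝ) < n := by exact_mod_cast hj
    have hi0 : (0 : ℝ) ≤ i := Nat.cast_nonneg i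
    have hj0 : (0 : ℝ) ≤ j := Nat.cast_nonneg j
    have h2 : ((i + 0) / n : ℝ) = (j + 0) / n := by
      refine hΦ h1 ?_
      rw [← sub_div, abs_div, abs_of_pos hn', div_lt_one hn', abs_lt]
      constructor <;> linarith
    rw [div_left_inj' hn'.ne', add_zero, add_zero] at h2
    exact_mod_cast h2
  refine ⟨n, v, e, ⟨hn2, ?_, ?_, ?_, ?_⟩, ?_, ?_⟩
  · exact Subtype.ext (by rw [hv n le_rfl, hv 0 hn.le, hδn])
  · intro i hi x
    have h1 : (x : Y) ∈ (e i : Set Y) ↔ (x : Y) ∈ ({δ i 0, δ i 1} : Set Y) := by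
      rw [← hδv i hi, he i hi]
      exact ⟨fun h => ⟨h, x.2⟩, fun h => h.1⟩
    rw [h1, hδs, ← hv i hi.le, ← hv (i + 1) hi, mem_insert_iff, mem_singleton_iff,
      Subtype.ext_iff, Subtype.ext_iff]
  · exact fun i hi j hj h => hvi i hi j hj h
  · intro i hi j hj h
    rw [mem_Iio] at hi hj
    have h1 : (δ i (1 / 2)) ∈ δ j '' Icc 0 1 := by
      rw [← he j hj, ← h, he i hi]
      exact ⟨1 / 2, by constructor <;> norm_num, rfl⟩
    obtain ⟨t, ht, h2⟩ := h1
    have h3 : ∃ m : ℤ, ((j + t) / n : ℝ) = (i + 1 / 2) / n + m :=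
      circlePt_eq_iff.1 (hinj (hball _) (hball _) h2)
    obtain ⟨m, hm⟩ := h3
    rw [div_add' _ _ _ hn'.ne', div_left_inj' hn'.ne'] at hm
    -- `t - 1 / 2` is an integer, hence zero.
    have h4 : t - 1 / 2 = ((i + m * n - j : ℤ) : ℝ) := by push_cast; linarith
    have h5 : |t - 1 / 2| < 1 := by rw [abs_lt]; constructor <;> linarith [ht.1, ht.2]
    rw [h4, ← Int.cast_abs] at h5
    have h6 : |((i : ℤ) + m * n - j)| < 1 := by exact_mod_cast h5
    have h7 := Int.abs_lt_one_iff.1 h6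
    have h8 : (j : ℤ) = i + m * n := by linarith
    have hm0 : m = 0 := by
      have hi' : (i : ℤ) < n := by exact_mod_cast hi
      have hj' : (j : ℤ) < n := by exact_mod_cast hj
      have hn0 : (0 : ℤ) < n := by exact_mod_cast hn
      by_contra hm0
      rcases lt_or_gt_of_ne hm0 with h | h
      · nlinarith
      · nlinarith
    rw [hm0] at h8
    omega
  · intro x
    constructor
    · intro hx
      obtain ⟨p, hp, hpv⟩ := T.exists_notMem_verts x.2
      obtain ⟨k, hk, hpk⟩ := hbd p (hx hp) fun h => (hdisj x x.2).le_bot ⟨h, hp⟩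
      refine ⟨k, hk, Subtype.ext ?_⟩
      rw [he k hk]
      exact T.edge_eq_of_mem (hδe k hk) x.2 hpk hp hpv
    · rintro ⟨i, hi, rfl⟩
      rw [he i hi]
      exact hsubf i
  · intro x hx hxv
    obtain ⟨k, hk, hxk⟩ := hbd x hx fun h => hverts.le_bot ⟨h, hxv⟩
    exact ⟨k, hk, by rwa [he k hk]⟩

/-- Every cell contains a point off the vertices and edges, whose image in `X` is not the image of
any other point of the cell off the vertices and edges. -/
theorem exists_interior {f : Set Y} (hf : f ∈ T.cells) :
    ∃ p ∈ f, p ∉ T.verts ∧ (∀ e ∈ T.edges, p ∉ e) ∧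
      ∀ q ∈ f, q ∉ T.verts → (∀ e ∈ T.edges, q ∉ e) → u p = u q → p = q := by
  obtain ⟨n, Φ, hn, hc, hinj, rfl, hedge, hu, hverts, hdisj⟩ := T.cell_disk f hf
  have m0 : (0 : ℂ) ∈ Metric.ball (0 : ℂ) 1 := by simp
  refine ⟨Φ 0, ⟨0, by simp, rfl⟩, fun h => hverts.le_bot ⟨⟨0, m0, rfl⟩, h⟩,
    fun e he h => (hdisj e he).le_bot ⟨⟨0, m0, rfl⟩, h⟩, ?_⟩
  rintro _ ⟨z, hz, rfl⟩ - hze h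
  refine hu ⟨0, m0, rfl⟩ ⟨z, ?_, rfl⟩ h
  rw [mem_ball_zero_iff]
  refine lt_of_le_of_ne (mem_closedBall_zero_iff.1 hz) fun hz1 => ?_
  -- A point of the boundary circle lies on one of the arcs.
  obtain ⟨t, ⟨ht0, ht1⟩, rfl⟩ := exists_circlePt_eq hz1
  have hn' : (0 : ℝ) < n := by exact_mod_cast hn
  have h0 : 0 ≤ t * n := by positivity
  have h1 := Nat.floor_le h0
  have h2 := Nat.lt_floor_add_one (t * n)
  refine hze _ (hedge ⌊t * n⌋₊ ?_) ⟨_, ⟨t, ⟨?_, ?_⟩, rfl⟩, rfl⟩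
  · rw [Nat.floor_lt h0]
    nlinarith
  · rwa [div_le_iff₀ hn']
  · rw [le_div_iff₀ hn']
    exact h2.le

theorem cell_eq_of_mem {f f' : Set Y} (hf : f ∈ T.cells) (hf' : f' ∈ T.cells) {p : Y}
    (hp : p ∈ f) (hp' : p ∈ f') (hpv : p ∉ T.verts) (hpe : ∀ e ∈ T.edges, p ∉ e) : f = f' := by
  by_contra hne
  have hmem : p ∈ f ∩ f' := ⟨hp, hp'⟩
  rcases T.cell_inter f hf f' hf' hne with h | ⟨v, hv, h⟩ | h
  · rw [h] at hmem; exact hmem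
  · rw [h, mem_singleton_iff] at hmem
    exact hpv (hmem ▸ hv)
  · exact hpe _ h hmem

end CellDecomposition

/-! ### The periodic map of a cell decomposition -/

namespace CellDecomposition

variable {Y X : Type*} [TopologicalSpace Y] [TopologicalSpace X] {u : Y → X}
  (T : CellDecomposition u)

omit [TopologicalSpace X] in
theorem deck_inv_apply (g : Deck u) (y : Y) : (g⁻¹).1 (g.1 y) = y := g.1.symm_apply_apply y

theorem deck_mem_verts {g : Deck u} {y : Y} : g.1 y ∈ T.verts ↔ y ∈ T.verts := by
  refine ⟨fun h => ?_, T.deck_verts g.1 g.2 y⟩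
  have := T.deck_verts (g⁻¹).1 (g⁻¹).2 _ h
  rwa [deck_inv_apply] at this

theorem deck_notMem_edges {g : Deck u} {y : Y} (h : ∀ e ∈ T.edges, y ∉ e) :
    ∀ e ∈ T.edges, g.1 y ∉ e := fun e he hy =>
  h _ (T.deck_edges (g⁻¹).1 (g⁻¹).2 e he) ⟨_, hy, deck_inv_apply g y⟩

instance : MulAction (Deck u) T.verts where
  smul g v := ⟨g.1 v, T.deck_verts g.1 g.2 v v.2⟩
  one_smul _ := rfl
  mul_smul _ _ _ := rfl

instance : MulAction (Deck u) T.edges where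
  smul g e := ⟨g.1 '' e, T.deck_edges g.1 g.2 e e.2⟩
  one_smul _ := Subtype.ext (image_id _)
  mul_smul g h e := Subtype.ext (image_comp g.1 h.1 e.1)

instance : MulAction (Deck u) T.cells where
  smul g f := ⟨g.1 '' f, T.deck_cells g.1 g.2 f f.2⟩
  one_smul _ := Subtype.ext (image_id _)
  mul_smul g h f := Subtype.ext (image_comp g.1 h.1 f.1)

omit [TopologicalSpace X] in
theorem image_deck (g : Deck u) (s : Set Y) : u '' (g.1 '' s) = u '' s := by
  rw [image_image]
  exact image_congr fun y _ => g.2 y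

variable [SimplyConnectedSpace Y] [LocallyPathConnectedSpace Y] (hu : IsCoveringMap u)

include hu

theorem exists_deck_edge {e e' : Set Y} (he : e ∈ T.edges) (he' : e' ∈ T.edges)
    (h : u '' e = u '' e') : ∃ g : Deck u, g.1 '' e = e' := by
  obtain ⟨p, hp, hpv⟩ := T.exists_notMem_verts he
  obtain ⟨q, hq, hqp⟩ := h.subset ⟨p, hp, rfl⟩
  obtain ⟨g, rfl⟩ := Deck.exists_apply_eq hu hqp.symm
  exact ⟨g, T.edge_eq_of_mem (T.deck_edges g.1 g.2 e he) he' ⟨p, hp, rfl⟩ hq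
    fun h => hpv (T.deck_mem_verts.1 h)⟩

theorem exists_deck_cell {f f' : Set Y} (hf : f ∈ T.cells) (hf' : f' ∈ T.cells)
    (h : u '' f = u '' f') : ∃ g : Deck u, g.1 '' f = f' := by
  obtain ⟨p, hp, hpv, hpe, -⟩ := T.exists_interior hf
  obtain ⟨q, hq, hqp⟩ := h.subset ⟨p, hp, rfl⟩
  obtain ⟨g, rfl⟩ := Deck.exists_apply_eq hu hqp.symm
  exact ⟨g, T.cell_eq_of_mem (T.deck_cells g.1 g.2 f hf) hf' ⟨p, hp, rfl⟩ hq
    (fun h => hpv (T.deck_mem_verts.1 h)) (T.deck_notMem_edges hpe)⟩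

omit [LocallyPathConnectedSpace Y] in
theorem deck_eq_one_of_cell {f : Set Y} (hf : f ∈ T.cells) {g : Deck u} (h : g.1 '' f = f) :
    g = 1 := by
  obtain ⟨p, hp, hpv, hpe, hinj⟩ := T.exists_interior hf
  exact Deck.eq_one hu (hinj (g.1 p) (h.subset ⟨p, hp, rfl⟩)
    (fun h => hpv (T.deck_mem_verts.1 h)) (T.deck_notMem_edges hpe) (g.2 p).symm).symm

/-- A family of compact sets with finitely many orbits under the covering transformations is
locally finite. -/
theorem exists_nhds_finite [T2Space X] {𝒮 : Set (Set Y)} (hc : ∀ s ∈ 𝒮, IsCompact s)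
    (hfin : ((fun s => u '' s) '' 𝒮).Finite)
    (horb : ∀ s ∈ 𝒮, ∀ s' ∈ 𝒮, u '' s = u '' s' → ∃ g : Deck u, g.1 '' s = s') (y : Y) :
    ∃ N ∈ 𝓝 y, {s ∈ 𝒮 | (s ∩ N).Nonempty}.Finite := by
  obtain ⟨R, hR, hRfin, hRe⟩ : ∃ R ⊆ 𝒮, R.Finite ∧
      (fun s => u '' s) '' R = (fun s => u '' s) '' 𝒮 := by
    obtain ⟨R, hR, hbij⟩ := (SurjOn.exists_bijOn_subset (surjOn_image (fun s => u '' s) 𝒮))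
    exact ⟨R, hR, hbij.finite_iff_finite.2 hfin, hbij.image_eq⟩
  have hN : ∀ s ∈ R, ∃ N ∈ 𝓝 y, {g : Deck u | (g.1 '' s ∩ N).Nonempty}.Finite := fun s hs =>
    Deck.locallyFinite hu (hc s (hR hs)) y
  choose! N hN hNfin using hN
  refine ⟨⋂ s ∈ R, N s, (Filter.biInter_mem hRfin).2 hN, ?_⟩
  refine (hRfin.biUnion fun s hs => (hNfin s hs).image fun g : Deck u => g.1 '' s).subset ?_
  rintro s ⟨hs, z, hz, hzN⟩
  obtain ⟨r, hr, hrs⟩ := hRe.symm.subset ⟨s, hs, rfl⟩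
  obtain ⟨g, rfl⟩ := horb r (hR hr) s hs hrs
  exact mem_biUnion hr ⟨g, ⟨z, hz, mem_iInter₂.1 hzN r hr⟩, rfl⟩

theorem verts_discrete [T2Space X] [T2Space Y] (y : Y) : ∃ U ∈ 𝓝 y, U ∩ T.verts ⊆ {y} := by
  obtain ⟨N, hN, hfin⟩ := exists_nhds_finite hu (𝒮 := (fun v => {v}) '' T.verts)
    (by rintro _ ⟨v, -, rfl⟩; exact isCompact_singleton)
    (by
      refine (T.finite_verts.image fun v => {v}).subset ?_
      rintro _ ⟨_, ⟨v, hv, rfl⟩, rfl⟩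
      exact ⟨u v, ⟨v, hv, rfl⟩, by simp⟩)
    (by
      rintro _ ⟨v, -, rfl⟩ _ ⟨v', -, rfl⟩ h
      simp only [image_singleton, singleton_eq_singleton_iff] at h
      obtain ⟨g, rfl⟩ := Deck.exists_apply_eq hu h
      exact ⟨g, by simp⟩) y
  have hfin' : {v ∈ T.verts | v ∈ N ∧ v ≠ y}.Finite := by
    refine Set.Finite.of_finite_image (f := fun v => ({v} : Set Y)) (hfin.subset ?_)
      fun _ _ _ _ h => singleton_injective h
    rintro _ ⟨v, ⟨hv, hvN, -⟩, rfl⟩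
    exact ⟨⟨v, hv, rfl⟩, v, rfl, hvN⟩
  refine ⟨N \ {v ∈ T.verts | v ∈ N ∧ v ≠ y}, ?_, ?_⟩
  · exact Filter.inter_mem hN (hfin'.isClosed.isOpen_compl.mem_nhds fun h => h.2.2 rfl)
  · rintro z ⟨⟨hzN, hz⟩, hzv⟩
    by_contra hne
    exact hz ⟨hzv, hzN, hne⟩

theorem isClosed_sUnion_cells [T2Space X] [T2Space Y] {K : Set (Set Y)} (hK : K ⊆ T.cells) :
    IsClosed (⋃₀ K) := by
  rw [sUnion_eq_iUnion]
  refine LocallyFinite.isClosed_iUnion (fun y => ?_) fun f => (T.isCompact_cell (hK f.2)).isClosed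
  obtain ⟨N, hN, hfin⟩ := exists_nhds_finite hu (𝒮 := T.cells) (fun s hs => T.isCompact_cell hs)
    T.finite_cells (fun s hs s' hs' => T.exists_deck_cell hu hs hs') y
  exact ⟨N, hN, Set.Finite.of_finite_image (f := Subtype.val)
    (hfin.subset (by rintro _ ⟨f, hf, rfl⟩; exact ⟨hK f.2, hf⟩))
    Subtype.val_injective.injOn⟩

/-- Any two cells are joined by a chain of cells with common edges, because the vertices do not
disconnect the surface. -/
theorem dual_conn [T2Space X] [T2Space Y] [ChartedSpace (EuclideanSpace ℝ (Fin 2)) Y]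
    (K : Set T.cells) (hK : ∀ (e : T.edges) (f f' : T.cells), (e : Set Y) ⊆ f → (e : Set Y) ⊆ f' →
      f ∈ K → f' ∈ K) : K = ∅ ∨ K = univ := by
  have hclosed : ∀ L : Set T.cells, IsClosed (⋃₀ (Subtype.val '' L)) := fun L =>
    T.isClosed_sUnion_cells hu (by rintro _ ⟨f, -, rfl⟩; exact f.2)
  have hmem : ∀ (L : Set T.cells) (y : Y), y ∈ ⋃₀ (Subtype.val '' L) ↔ ∃ f ∈ L, y ∈ (f : Set Y) := by
    intro L y
    simp
  have hconn := isPreconnected_compl_of_discrete (T.verts_discrete hu)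
  rw [isPreconnected_closed_iff] at hconn
  have hempty : ∀ L : Set T.cells, (T.vertsᶜ ∩ ⋃₀ (Subtype.val '' L) = ∅) → L = ∅ := by
    intro L hL
    rw [Set.eq_empty_iff_forall_notMem]
    intro f hf
    obtain ⟨p, hp, hpv, -⟩ := T.exists_interior f.2
    exact hL.subset ⟨hpv, (hmem L p).2 ⟨f, hf, hp⟩⟩
  have hcover : T.vertsᶜ ⊆ ⋃₀ (Subtype.val '' K) ∪ ⋃₀ (Subtype.val '' Kᶜ) := by
    intro y _
    obtain ⟨f, hf, hy⟩ := T.cover.symm.subset (mem_univ y)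
    by_cases h : (⟨f, hf⟩ : T.cells) ∈ K
    · exact Or.inl ((hmem _ _).2 ⟨_, h, hy⟩)
    · exact Or.inr ((hmem _ _).2 ⟨_, h, hy⟩)
  by_contra! hcon
  obtain ⟨p, hpv, hp, hp'⟩ := hconn _ _ (hclosed K) (hclosed Kᶜ) hcover
    (Set.nonempty_iff_ne_empty.2 fun h => (Set.nonempty_iff_ne_empty.1 hcon.1) (hempty _ h))
    (Set.nonempty_iff_ne_empty.2 fun h => hcon.2 (compl_empty_iff.1 (hempty _ h)))
  obtain ⟨f, hf, hpf⟩ := (hmem _ _).1 hp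
  obtain ⟨f', hf', hpf'⟩ := (hmem _ _).1 hp'
  have hne : (f : Set Y) ≠ f' := fun h => hf' (Subtype.ext h ▸ hf)
  rcases T.cell_inter f f.2 f' f'.2 hne with h | ⟨v, hv, h⟩ | h
  · exact h.subset ⟨hpf, hpf'⟩
  · have : p = v := h.subset ⟨hpf, hpf'⟩
    exact hpv (this ▸ hv)
  · exact hf' (hK ⟨_, h⟩ f f' inter_subset_left inter_subset_right hf)

omit hu [SimplyConnectedSpace Y] [LocallyPathConnectedSpace Y] in
theorem exists_edge_of_vert [T2Space Y] (v : T.verts) :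
    ∃ e : T.edges, (v : Y) ∈ (e : Set Y) := by
  obtain ⟨f, hf, hv⟩ := T.cover.symm.subset (mem_univ (v : Y))
  obtain ⟨n, -, e, -, -, h⟩ := T.exists_cycle_of_cell hf
  obtain ⟨i, -, hi⟩ := h v hv v.2
  exact ⟨e i, hi⟩

/-- The combinatorial structure of a cell decomposition, with the covering transformations acting
on the lifted vertices, edges and cells. -/
noncomputable def periodicMap [T2Space X] [T2Space Y] [ChartedSpace (EuclideanSpace ℝ (Fin 2)) Y] :
    PeriodicMap (Deck u) T.verts T.edges T.cells T.V T.E T.F where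
  onE v e := (v : Y) ∈ (e : Set Y)
  onF e f := (e : Set Y) ⊆ (f : Set Y)
  pV v := ⟨u v, v, v.2, rfl⟩
  pE e := ⟨u '' e, e, e.2, rfl⟩
  pF f := ⟨u '' f, f, f.2, rfl⟩
  pV_surj := by rintro ⟨_, v, hv, rfl⟩; exact ⟨⟨v, hv⟩, rfl⟩
  pE_surj := by rintro ⟨_, e, he, rfl⟩; exact ⟨⟨e, he⟩, rfl⟩
  pF_surj := by rintro ⟨_, f, hf, rfl⟩; exact ⟨⟨f, hf⟩, rfl⟩
  pV_eq x y := by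
    constructor
    · intro h
      obtain ⟨g, hg⟩ := Deck.exists_apply_eq hu (congrArg Subtype.val h)
      exact ⟨g, Subtype.ext hg⟩
    · rintro ⟨g, rfl⟩
      exact Subtype.ext (g.2 x).symm
  pE_eq x y := by
    constructor
    · intro h
      obtain ⟨g, hg⟩ := T.exists_deck_edge hu x.2 y.2 (congrArg Subtype.val h)
      exact ⟨g, Subtype.ext hg⟩
    · rintro ⟨g, rfl⟩
      exact Subtype.ext (image_deck g x).symm
  pF_eq x y := by
    constructor
    · intro h
      obtain ⟨g, hg⟩ := T.exists_deck_cell hu x.2 y.2 (congrArg Subtype.val h)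
      exact ⟨g, Subtype.ext hg⟩
    · rintro ⟨g, rfl⟩
      exact Subtype.ext (image_deck g x).symm
  free_V g x h := Deck.eq_one hu (congrArg Subtype.val h)
  free_F g x h := T.deck_eq_one_of_cell hu x.2 (congrArg Subtype.val h)
  onE_smul g v e h := ⟨v, h, rfl⟩
  onF_smul g e f h := image_mono h
  edge_ends e := by
    obtain ⟨γ, -, -, -, hV, hne⟩ := T.edge_arc e e.2
    have h0 : γ 0 ∈ (e : Set Y) ∩ T.verts := by rw [hV]; simp
    have h1 : γ 1 ∈ (e : Set Y) ∩ T.verts := by rw [hV]; simp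
    refine ⟨⟨_, h0.2⟩, ⟨_, h1.2⟩, fun h => hne (congrArg Subtype.val h), fun x => ?_⟩
    have : (x : Y) ∈ (e : Set Y) ↔ (x : Y) ∈ ({γ 0, γ 1} : Set Y) := by
      rw [← hV]; exact ⟨fun h => ⟨h, x.2⟩, fun h => h.1⟩
    rw [this, mem_insert_iff, mem_singleton_iff, Subtype.ext_iff, Subtype.ext_iff]
  edge_faces e := by
    obtain ⟨f, g, hne, h⟩ := Set.ncard_eq_two.1 (T.edge_cells e e.2)
    have hf : f ∈ {f ∈ T.cells | (e : Set Y) ⊆ f} := by rw [h]; simp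
    have hg : g ∈ {f ∈ T.cells | (e : Set Y) ⊆ f} := by rw [h]; simp
    refine ⟨⟨f, hf.1⟩, ⟨g, hg.1⟩, fun h => hne (congrArg Subtype.val h), fun x => ?_⟩
    have : (e : Set Y) ⊆ x ↔ (x : Set Y) ∈ ({f, g} : Set (Set Y)) := by
      rw [← h]; exact ⟨fun h => ⟨x.2, h⟩, fun h => h.2⟩
    rw [this, mem_insert_iff, mem_singleton_iff, Subtype.ext_iff, Subtype.ext_iff]
  face_cycle f := by
    obtain ⟨n, v, e, h, h', -⟩ := T.exists_cycle_of_cell f.2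
    exact ⟨n, v, e, h, h'⟩
  exists_edge v := T.exists_edge_of_vert v
  dual_conn K hK := T.dual_conn hu K hK

end CellDecomposition

/-! ### Simple cycles as reduced contractible loops -/

/-- A path in a simply connected covering space is closed if and only if its projection is a
contractible loop. -/
theorem isContractibleLoopOn_iff {Y X : Type*} [TopologicalSpace Y] [TopologicalSpace X] {u : Y → X}
    [SimplyConnectedSpace Y] (hu : IsCoveringMap u) {Γ : ℝ → Y} {a b : ℝ} (hab : a ≤ b)
    (hΓ : ContinuousOn Γ (Icc a b)) :
    CellDecomposition.IsContractibleLoopOn (u ∘ Γ) a b ↔ Γ a = Γ b := by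
  have hc : Continuous fun t : unitInterval => Γ (a + t * (b - a)) := by
    refine hΓ.comp_continuous (by fun_prop) fun t => ?_
    have h0 := t.2.1
    have h1 := t.2.2
    constructor <;> nlinarith
  have h1' : Γ (a + (1 : unitInterval) * (b - a)) = Γ b := by simp
  have h0' : Γ (a + (0 : unitInterval) * (b - a)) = Γ a := by simp
  constructor
  · rintro ⟨x, p, hp, ⟨H⟩⟩
    have e0 : p.toContinuousMap 0 = u (Γ a) := by
      change p 0 = _
      rw [hp, Function.comp, h0']
    have ex : x = u (Γ a) := by rw [← e0]; exact p.source.symm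
    subst ex
    have key := hu.liftPath_apply_one_eq_of_homotopicRel (γ₀ := p.toContinuousMap)
      (γ₁ := ContinuousMap.const unitInterval (u (Γ a))) ⟨H⟩ (Γ a) e0
      (ContinuousMap.const_apply _ _)
    have l1 : (⟨_, hc⟩ : C(unitInterval, Y)) = hu.liftPath p.toContinuousMap (Γ a) e0 := by
      rw [hu.eq_liftPath_iff']
      exact ⟨funext fun t => (hp t).symm, h0'⟩
    have l2 := hu.liftPath_const (rfl : u (Γ a) = u (Γ a))
    exact (congrFun (congrArg DFunLike.coe l2) 1).symm.trans
      (key.symm.trans (by rw [← l1]; exact h1'))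
  · intro h
    let P : Path (Γ a) (Γ a) := ⟨⟨_, hc⟩, h0', h1'.trans h.symm⟩
    refine ⟨u (Γ a), P.map hu.continuous, fun t => rfl, ?_⟩
    exact (SimplyConnectedSpace.paths_homotopic P (Path.refl _)).map ⟨u, hu.continuous⟩

namespace CellDecomposition

variable {Y X : Type*} [TopologicalSpace Y] [TopologicalSpace X] {u : Y → X}
  (T : CellDecomposition u)

/-- The edges of a simple cycle, travelled one after the other, form a simple closed curve `Γ`. -/
theorem exists_path_of_cycle {n : ℕ} {v : ℕ → T.verts} {e : ℕ → T.edges}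
    (hc : IsCycle (fun (v : T.verts) (e : T.edges) => (v : Y) ∈ (e : Set Y)) n v e) :
    ∃ Γ : ℝ → Y, ContinuousOn Γ (Icc 0 n) ∧
      (∀ s ∈ Icc (0 : ℝ) n, ∀ t ∈ Icc (0 : ℝ) n, Γ s = Γ t → |s - t| < n → s = t) ∧
      (∀ i ≤ n, Γ i = v i) ∧ ∀ i < n, Γ '' Icc (i : ℝ) (i + 1) = e i := by
  have hγ : ∀ i, ∃ γ : ℝ → Y, i < n → ContinuousOn γ (Icc 0 1) ∧ InjOn γ (Icc 0 1) ∧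
      γ '' Icc 0 1 = e i ∧ γ 0 = v i ∧ γ 1 = v (i + 1) := by
    intro i
    by_cases hi : i < n
    swap
    · exact ⟨fun _ => v 0, fun h => absurd h hi⟩
    obtain ⟨γ, hγc, hγi, hγe, hV, -⟩ := T.edge_arc _ (e i).2
    have hends : ({γ 0, γ 1} : Set Y) = {(v i : Y), (v (i + 1) : Y)} := by
      rw [← hV]
      ext x
      constructor
      · rintro ⟨hx, hxv⟩
        rcases (hc.ends i hi ⟨x, hxv⟩).1 hx with h | h
        · exact Or.inl (congrArg Subtype.val h)
        · exact Or.inr (congrArg Subtype.val h)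
      · rintro (rfl | rfl)
        · exact ⟨(hc.ends i hi _).2 (Or.inl rfl), (v i).2⟩
        · exact ⟨(hc.ends i hi _).2 (Or.inr rfl), (v (i + 1)).2⟩
    rcases Set.pair_eq_pair_iff.1 hends with ⟨h0, h1⟩ | ⟨h0, h1⟩
    · exact ⟨γ, fun _ => ⟨hγc, hγi, hγe, h0, h1⟩⟩
    · have hmaps : MapsTo (fun t : ℝ => 1 - t) (Icc 0 1) (Icc 0 1) := fun t ht =>
        ⟨by linarith [ht.2], by linarith [ht.1]⟩
      refine ⟨fun t => γ (1 - t), fun _ => ⟨hγc.comp (by fun_prop) hmaps, ?_, ?_, ?_, ?_⟩⟩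
      · intro s hs t ht h
        have := hγi (hmaps hs) (hmaps ht) h
        linarith
      · rw [← hγe]
        ext y
        constructor
        · rintro ⟨t, ht, rfl⟩; exact ⟨_, hmaps ht, rfl⟩
        · rintro ⟨t, ht, rfl⟩; exact ⟨1 - t, hmaps ht, by simp⟩
      · simpa using h1
      · simpa using h0
  choose γ hγ using hγ
  have hex : ∃ Γ : ℝ → Y, ∀ i < n, ∀ t ∈ Icc (i : ℝ) (i + 1), Γ t = γ i (t - i) := by
    refine ⟨fun t => if t < n then γ ⌊t⌋₊ (t - ⌊t⌋₊) else v n, fun i hi t ht => ?_⟩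
    obtain ⟨-, -, -, -, hγ1⟩ := hγ i hi
    have hin : (i : ℝ) + 1 ≤ n := by exact_mod_cast hi
    dsimp only
    rcases ht.2.lt_or_eq with h | rfl
    · have hfl : ⌊t⌋₊ = i := by
        rw [Nat.floor_eq_iff ((Nat.cast_nonneg i).trans ht.1)]
        exact ⟨ht.1, h⟩
      rw [if_pos (h.trans_le hin), hfl]
    · rw [add_sub_cancel_left, hγ1]
      by_cases h : i + 1 < n
      · have h' : (i : ℝ) + 1 < n := by exact_mod_cast h
        have hfl : ⌊(i : ℝ) + 1⌋₊ = i + 1 := by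
          rw [show (i : ℝ) + 1 = ((i + 1 : ℕ) : ℝ) by push_cast; rfl, Nat.floor_natCast]
        rw [if_pos h', hfl]
        push_cast
        rw [sub_self, (hγ (i + 1) h).2.2.2.1]
      · have h' : ¬ (i : ℝ) + 1 < n := by exact_mod_cast h
        rw [if_neg h']
        congr 2
        omega
  obtain ⟨Γ, hΓ⟩ := hex
  have hshift : ∀ i : ℕ, ∀ t ∈ Icc (i : ℝ) (i + 1), t - i ∈ Icc (0 : ℝ) 1 := fun i t ht =>
    ⟨by linarith [ht.1], by linarith [ht.2]⟩
  have hnpos : 0 < n := by have := hc.two_le; omega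
  have hΓv : ∀ i ≤ n, Γ i = v i := by
    intro i hi
    rcases Nat.lt_or_ge i n with h | h
    · rw [hΓ i h i ⟨le_rfl, by linarith⟩, sub_self, (hγ i h).2.2.2.1]
    · obtain ⟨m, rfl⟩ : ∃ m, i = m + 1 := ⟨i - 1, by omega⟩
      have hm : m < n := by omega
      have := hΓ m hm ((m + 1 : ℕ) : ℝ) ⟨by push_cast; linarith, by push_cast; rfl⟩
      rw [this]
      push_cast
      rw [add_sub_cancel_left, (hγ m hm).2.2.2.2]
  have hΓe : ∀ i < n, Γ '' Icc (i : ℝ) (i + 1) = e i := by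
    intro i hi
    rw [← (hγ i hi).2.2.1]
    ext y
    constructor
    · rintro ⟨t, ht, rfl⟩
      exact ⟨_, hshift i t ht, (hΓ i hi t ht).symm⟩
    · rintro ⟨t, ht, rfl⟩
      have hmem : (i : ℝ) + t ∈ Icc (i : ℝ) (i + 1) := ⟨by linarith [ht.1], by linarith [ht.2]⟩
      exact ⟨i + t, hmem, by rw [hΓ i hi _ hmem, add_sub_cancel_left]⟩
  have hfind : ∀ t ∈ Icc (0 : ℝ) n, ∃ i < n, t ∈ Icc (i : ℝ) (i + 1) := by
    intro t ht
    rcases ht.2.lt_or_eq with h | rfl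
    · exact ⟨⌊t⌋₊, (Nat.floor_lt ht.1).2 h, Nat.floor_le ht.1, (Nat.lt_floor_add_one t).le⟩
    · refine ⟨n - 1, by omega, ?_, ?_⟩
      · exact_mod_cast Nat.sub_le n 1
      · exact_mod_cast (by omega : n ≤ n - 1 + 1)
  refine ⟨Γ, ?_, ?_, hΓv, hΓe⟩
  · have hcont : ∀ m ≤ n, ContinuousOn Γ (Icc 0 (m : ℝ)) := by
      intro m
      induction m with
      | zero => intro _; simp [continuousOn_singleton]
      | succ m ih =>
        intro hm
        have h1 : Icc (0 : ℝ) ((m + 1 : ℕ) : ℝ) = Icc 0 (m : ℝ) ∪ Icc (m : ℝ) (m + 1) := by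
          rw [Icc_union_Icc_eq_Icc (Nat.cast_nonneg m) (by linarith)]
          push_cast; rfl
        rw [h1]
        refine (ih (by omega)).union_of_isClosed ?_ isClosed_Icc isClosed_Icc
        refine ContinuousOn.congr ?_ (hΓ m hm)
        exact (hγ m hm).1.comp (by fun_prop) (hshift m)
    exact hcont n le_rfl
  · -- A point on two different edges is a vertex, hence its parameters are integers.
    have hint : ∀ i < n, ∀ s ∈ Icc (i : ℝ) (i + 1), Γ s ∈ T.verts → ∃ a ≤ n, s = (a : ℕ) := by
      intro i hi s hs hv
      obtain ⟨-, hinj, himg, h0, h1⟩ := hγ i hi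
      have hmem : Γ s ∈ (e i : Set Y) := hΓe i hi ▸ ⟨s, hs, rfl⟩
      rw [hΓ i hi s hs] at hmem hv
      rcases (hc.ends i hi ⟨_, hv⟩).1 hmem with h | h
      · have := hinj (hshift i s hs) (by simp) ((congrArg Subtype.val h).trans h0.symm)
        exact ⟨i, hi.le, by linarith⟩
      · have := hinj (hshift i s hs) (by simp) ((congrArg Subtype.val h).trans h1.symm)
        exact ⟨i + 1, hi, by push_cast; linarith⟩
    have hnat : ∀ a ≤ n, ∀ b ≤ n, v a = v b → |(a : ℝ) - b| < n → a = b := by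
      intro a ha b hb h hab
      rw [abs_lt] at hab
      have h1 : ¬ (a = 0 ∧ b = n) := by rintro ⟨rfl, rfl⟩; simp at hab
      have h2 : ¬ (b = 0 ∧ a = n) := by rintro ⟨rfl, rfl⟩; simp at hab
      rcases Nat.lt_or_ge a n with ha' | ha' <;> rcases Nat.lt_or_ge b n with hb' | hb'
      · exact hc.inj_v ha' hb' h
      · obtain rfl : b = n := by omega
        rw [hc.closed] at h
        exact absurd ⟨hc.inj_v ha' hnpos h, rfl⟩ h1
      · obtain rfl : a = n := by omega
        rw [hc.closed] at h
        exact absurd ⟨(hc.inj_v hnpos hb' h).symm, rfl⟩ h2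
      · omega
    intro s hs t ht hst habs
    obtain ⟨i, hi, hsi⟩ := hfind s hs
    obtain ⟨j, hj, htj⟩ := hfind t ht
    by_cases hij : i = j
    · subst hij
      rw [hΓ i hi s hsi, hΓ i hi t htj] at hst
      have := (hγ i hi).2.1 (hshift i s hsi) (hshift i t htj) hst
      linarith
    · have hv : Γ s ∈ T.verts := by
        refine T.edge_inter _ (e i).2 _ (e j).2 (fun h => hij ?_) ⟨?_, ?_⟩
        · exact hc.inj_e hi hj (Subtype.ext h)
        · exact hΓe i hi ▸ ⟨s, hsi, rfl⟩
        · exact hΓe j hj ▸ ⟨t, htj, hst.symm⟩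
      obtain ⟨a, ha, rfl⟩ := hint i hi s hsi hv
      obtain ⟨b, hb, rfl⟩ := hint j hj t htj (hst ▸ hv)
      rw [hΓv a ha, hΓv b hb] at hst
      rw [hnat a ha b hb (Subtype.ext hst) habs]

variable [SimplyConnectedSpace Y] [LocallyPathConnectedSpace Y]

/-- The covering is injective on edges, since no covering transformation but the identity maps an
edge to itself. -/
theorem injOn_edge (hu : IsCoveringMap u) {e : Set Y} (he : e ∈ T.edges) : InjOn u e := by
  obtain ⟨γ, -, -, -, hV, hne⟩ := T.edge_arc e he
  have hends : ∀ y ∈ e, ∀ y' ∈ e, y ∈ T.verts → y' ∈ T.verts → u y = u y' → y = y' := by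
    intro y hy y' hy' hv hv' h
    have h1 : y ∈ ({γ 0, γ 1} : Set Y) := hV ▸ ⟨hy, hv⟩
    have h2 : y' ∈ ({γ 0, γ 1} : Set Y) := hV ▸ ⟨hy', hv'⟩
    rcases h1 with rfl | rfl <;> rcases h2 with rfl | rfl
    · rfl
    · exact absurd h hne
    · exact absurd h.symm hne
    · rfl
  intro y hy y' hy' h
  obtain ⟨g, rfl⟩ := Deck.exists_apply_eq hu h
  by_cases hv : y ∈ T.verts
  · exact hends y hy _ hy' hv (T.deck_mem_verts.2 hv) h
  · have hge := T.edge_eq_of_mem (T.deck_edges g.1 g.2 e he) he ⟨y, hy, rfl⟩ hy'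
      fun h => hv (T.deck_mem_verts.1 h)
    have h0 : γ 0 ∈ e ∩ T.verts := by rw [hV]; simp
    -- The transformation maps the arc to itself and cannot exchange its ends.
    have h1 := hends (g.1 (γ 0)) (hge.subset ⟨_, h0.1, rfl⟩) (γ 0) h0.1
      (T.deck_mem_verts.2 h0.2) h0.2 (g.2 _)
    rw [Deck.eq_one hu h1]
    rfl

/-- A simple cycle of edges upstairs projects to a reduced contractible loop of edges. -/
theorem isReducedContractibleLoop (hu : IsCoveringMap u) {n : ℕ} {v : ℕ → T.verts}
    {e : ℕ → T.edges}
    (hc : IsCycle (fun (v : T.verts) (e : T.edges) => (v : Y) ∈ (e : Set Y)) n v e)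
    {Γ : ℝ → Y} (hΓ : ContinuousOn Γ (Icc 0 n))
    (hinj : ∀ s ∈ Icc (0 : ℝ) n, ∀ t ∈ Icc (0 : ℝ) n, Γ s = Γ t → |s - t| < n → s = t)
    (hv : ∀ i ≤ n, Γ i = v i) (he : ∀ i < n, Γ '' Icc (i : ℝ) (i + 1) = e i)
    {L : List T.E} (hL : L.length = n) (hLe : ∀ i : Fin L.length, (L.get i : Set X) = u '' e i) :
    T.IsReducedContractibleLoop L (u ∘ Γ) := by
  have hn2 := hc.two_le
  have hn2' : (2 : ℝ) ≤ n := by exact_mod_cast hn2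
  have hsub : ∀ i < n, Icc (i : ℝ) (i + 1) ⊆ Icc (0 : ℝ) n := fun i hi =>
    Icc_subset_Icc (Nat.cast_nonneg i) (by exact_mod_cast hi)
  refine ⟨⟨?_, ?_, ?_, ?_, ?_⟩, ?_, ?_⟩
  · rintro rfl
    simp only [List.length_nil] at hL
    omega
  · rw [hL]
    exact hu.continuous.comp_continuousOn hΓ
  · rw [hL]
    intro t ht
    obtain ⟨N, hN, htN, hNi⟩ := hu.exists_injOn_nhds (Γ t)
    obtain ⟨U, hU, hUN⟩ := mem_nhdsWithin_iff_exists_mem_nhds_inter.1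
      ((hΓ t ht).preimage_mem_nhdsWithin (hN.mem_nhds htN))
    refine ⟨U ∩ Metric.ball t (1 / 2), Filter.inter_mem hU (Metric.ball_mem_nhds t (by norm_num)),
      ?_⟩
    rintro a ⟨⟨haU, hab⟩, ha⟩ b ⟨⟨hbU, hbb⟩, hb⟩ h
    refine hinj a ha b hb (hNi (hUN ⟨haU, ha⟩) (hUN ⟨hbU, hb⟩) h) ?_
    rw [Metric.mem_ball, Real.dist_eq, abs_lt] at hab hbb
    rw [abs_lt]
    constructor <;> linarith [hab.1, hab.2, hbb.1, hbb.2]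
  · intro i
    have hi : (i : ℕ) < n := hL ▸ i.2
    intro a ha b hb h
    have h1 := T.injOn_edge hu (e i).2 (he i hi ▸ ⟨a, ha, rfl⟩) (he i hi ▸ ⟨b, hb, rfl⟩) h
    refine hinj a (hsub i hi ha) b (hsub i hi hb) h1 ?_
    rw [abs_lt]
    constructor <;> linarith [ha.1, ha.2, hb.1, hb.2]
  · intro i
    have hi : (i : ℕ) < n := hL ▸ i.2
    rw [image_comp, he i hi, hLe]
  · rw [hL, isContractibleLoopOn_iff hu (by linarith) hΓ]
    have h0 := hv 0 (by omega)
    rw [Nat.cast_zero] at h0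
    rw [h0, hv n le_rfl, hc.closed]
  · rw [hL]
    intro i j hij hjn hne hcon
    have hij' : (i : ℝ) < j := by exact_mod_cast hij
    have hjn' : (j : ℝ) ≤ n := by exact_mod_cast hjn
    have hi0 : (0 : ℝ) ≤ i := Nat.cast_nonneg i
    rw [isContractibleLoopOn_iff hu hij'.le (hΓ.mono (Icc_subset_Icc hi0 hjn'))] at hcon
    have h1 := hinj i ⟨hi0, by linarith⟩ j ⟨by linarith, hjn'⟩ hcon ?_
    · linarith
    · rw [abs_lt]
      refine ⟨?_, by linarith⟩
      have : j < n + i := by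
        by_contra h
        exact hne (by rw [Prod.mk.injEq]; omega)
      have : (j : ℝ) < n + i := by exact_mod_cast this
      linarith

/-- The projection of a simple cycle has a lift that bounds a cell if and only if the cycle
itself consists of the edges of some cell. -/
theorem liftBoundsCell_iff (hu : IsCoveringMap u) {n : ℕ} {e : ℕ → T.edges}
    {Γ : ℝ → Y} (hΓ : ContinuousOn Γ (Icc 0 n))
    (himg : Γ '' Icc 0 (n : ℝ) = ⋃ i < n, (e i : Set Y)) :
    T.LiftBoundsCell (u ∘ Γ) n ↔
      ∃ f : T.cells, ∀ x : T.edges, (x : Set Y) ⊆ f ↔ ∃ i < n, e i = x := by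
  have h0 : (0 : ℝ) ∈ Icc (0 : ℝ) n := ⟨le_rfl, Nat.cast_nonneg n⟩
  constructor
  · rintro ⟨γ, hγ, hγu, f, hf, hγf⟩
    obtain ⟨g, hg⟩ := Deck.exists_apply_eq hu (hγu 0 h0)
    have heq : EqOn (fun t => g.1 (γ t)) Γ (Icc 0 (n : ℝ)) :=
      hu.eqOn_of_comp_eqOn isPreconnected_Icc (g.1.continuous.comp_continuousOn hγ) hΓ
        (fun t ht => (g.2 _).trans (hγu t ht)) h0 hg
    have himg' : ⋃ i < n, (e i : Set Y) = g.1 '' T.boundary f := by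
      rw [← himg, ← hγf, image_image]
      exact (image_congr heq).symm
    refine ⟨⟨_, T.deck_cells g.1 g.2 f hf⟩, fun x => ⟨fun hx => ?_, ?_⟩⟩
    · obtain ⟨p, hp, hpv⟩ := T.exists_notMem_verts x.2
      have hpm : p ∈ g.1 '' T.boundary f := by
        have hsub := image_mono (f := (g⁻¹).1) hx
        have hgg : (g⁻¹).1 '' (g.1 '' f) = f := by
          rw [image_image]
          simp only [deck_inv_apply, image_id']
        refine ⟨(g⁻¹).1 p, ⟨_, ⟨T.deck_edges (g⁻¹).1 (g⁻¹).2 x x.2, ?_⟩, p, hp, rfl⟩,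
          g.1.apply_symm_apply p⟩
        exact hsub.trans hgg.subset
      rw [← himg'] at hpm
      simp only [mem_iUnion] at hpm
      obtain ⟨i, hi, hpi⟩ := hpm
      exact ⟨i, hi, Subtype.ext (T.edge_eq_of_mem (e i).2 x.2 hpi hp hpv)⟩
    · rintro ⟨i, hi, rfl⟩
      obtain ⟨p, hp, hpv⟩ := T.exists_notMem_verts (e i).2
      have hpm : p ∈ g.1 '' T.boundary f := by
        rw [← himg']
        exact mem_biUnion hi hp
      obtain ⟨_, ⟨ε, ⟨hε, hεf⟩, hq⟩, rfl⟩ := hpm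
      rw [T.edge_eq_of_mem (e i).2 (T.deck_edges g.1 g.2 ε hε) hp ⟨_, hq, rfl⟩ hpv]
      exact image_mono hεf
  · rintro ⟨f, hf⟩
    refine ⟨Γ, hΓ, fun t _ => rfl, f, f.2, ?_⟩
    rw [himg]
    ext y
    simp only [boundary, mem_iUnion, mem_sUnion, mem_ofPred_eq]
    constructor
    · rintro ⟨i, hi, hy⟩
      exact ⟨_, ⟨(e i).2, (hf _).2 ⟨i, hi, rfl⟩⟩, hy⟩
    · rintro ⟨x, ⟨hx, hxf⟩, hy⟩
      obtain ⟨i, hi, hix⟩ := (hf ⟨x, hx⟩).1 hxf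
      exact ⟨i, hi, by rw [hix]; exact hy⟩

/-- A polyhedral function gives a weight on the lifted edges that satisfies the combinatorial weight
condition. -/
theorem IsPolyhedral.isPolyhedralWeight [T2Space X] [T2Space Y]
    [ChartedSpace (EuclideanSpace ℝ (Fin 2)) Y] {T : CellDecomposition u} (hu : IsCoveringMap u)
    {θ : T.E → ℝ} (hθ : T.IsPolyhedral θ) :
    (T.periodicMap hu).IsPolyhedralWeight fun e => π - θ e := by
  refine ⟨fun e => by linarith [(hθ.1 e).2], fun n v e hc => ?_⟩
  obtain ⟨Γ, hΓ, hinj, hv, he⟩ := T.exists_path_of_cycle hc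
  set L : List T.E := List.ofFn fun i : Fin n => (T.periodicMap hu).pE (e i) with hLdef
  have hL : L.length = n := List.length_ofFn
  have hLe : ∀ i : Fin L.length, (L.get i : Set X) = u '' e i := by
    intro i
    exact congrArg Subtype.val (List.get_ofFn _ i)
  have hsum : (L.map fun e => π - θ e).sum =
      ∑ i ∈ Finset.range n, (π - θ ((T.periodicMap hu).pE (e i))) := by
    rw [hLdef, List.map_ofFn, List.sum_ofFn, Finset.sum_range]
    rfl
  have himg : Γ '' Icc 0 (n : ℝ) = ⋃ i < n, (e i : Set Y) := by
    ext y
    simp only [mem_iUnion]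
    constructor
    · rintro ⟨t, ht, rfl⟩
      have hn := hc.two_le
      rcases ht.2.lt_or_eq with h | rfl
      · have h1 := (Nat.floor_lt ht.1).2 h
        exact ⟨⌊t⌋₊, h1, he _ h1 ▸ ⟨t, ⟨Nat.floor_le ht.1, (Nat.lt_floor_add_one t).le⟩, rfl⟩⟩
      · refine ⟨n - 1, by omega, he (n - 1) (by omega) ▸ ⟨n, ⟨?_, ?_⟩, rfl⟩⟩
        · exact_mod_cast Nat.sub_le n 1
        · exact_mod_cast (by omega : n ≤ n - 1 + 1)
    · rintro ⟨i, hi, hy⟩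
      rw [← he i hi] at hy
      exact image_mono (Icc_subset_Icc (Nat.cast_nonneg i) (by exact_mod_cast hi)) hy
  obtain ⟨h1, h2⟩ := hθ.2 L (u ∘ Γ)
    (T.isReducedContractibleLoop hu hc hΓ hinj hv he hL hLe)
  rw [hsum] at h1 h2
  rw [hL, T.liftBoundsCell_iff hu hΓ himg] at h2
  exact ⟨h1, h2⟩

end CellDecomposition

/-! ### Coherent angle systems -/

namespace CellDecomposition

variable {Y X : Type*} [TopologicalSpace Y] [TopologicalSpace X] {u : Y → X}
  {T : CellDecomposition u}

theorem edge_rev (s : T.S) : edge (rev s) = edge s := (exists_rev s).choose_spec.1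

theorem vertex_rev_ne (s : T.S) : vertex (rev s) ≠ vertex s := (exists_rev s).choose_spec.2

theorem finite_S (T : CellDecomposition u) : Finite T.S := by
  have : Finite T.E := T.finite_edges
  have : Finite T.V := T.finite_verts
  exact inferInstanceAs (Finite {s : T.E × T.V // (s.2 : X) ∈ (s.1 : Set X)})

open Classical in
theorem finsum_vertex_eq [Fintype T.S] (ψ : T.S → ℝ) (v : T.V) :
    ∑ᶠ (s : T.S) (_ : vertex s = v), ψ s = ∑ s : T.S, if vertex s = v then ψ s else 0 := by
  rw [finsum_eq_sum_of_fintype]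
  exact Finset.sum_congr rfl fun s _ => finsum_eq_if

theorem convex_etaRange (χ : ℤ) (t : ℝ) : Convex ℝ (etaRange χ t) := by
  unfold etaRange
  split_ifs
  · exact convex_Ioo _ _
  · exact convex_singleton _
  · exact convex_Ioo _ _

theorem convex_FDeltaSigma (θ : T.E → ℝ) : Convex ℝ (T.FDeltaSigma θ) := by
  classical
  have := T.finite_S
  let _ : Fintype T.S := Fintype.ofFinite T.S
  rintro ψ ⟨hψ, hψv⟩ φ ⟨hφ, hφv⟩ a b ha hb hab
  have heta : ∀ s, etaHat θ (a • ψ + b • φ) s = a • etaHat θ ψ s + b • etaHat θ φ s := by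
    intro s
    simp only [etaHat, Pi.add_apply, Pi.smul_apply, smul_eq_mul]
    linear_combination (θ (edge s) / 2) * hab
  have hpsi : ∀ s, psiHat θ (a • ψ + b • φ) s = a • psiHat θ ψ s + b • psiHat θ φ s := by
    intro s
    simp only [psiHat, heta, Pi.add_apply, Pi.smul_apply, smul_eq_mul]
    ring
  refine ⟨fun s => ⟨?_, ?_⟩, fun v => ?_⟩
  · rw [hpsi]
    exact convex_Ioo _ _ (hψ s).1 (hφ s).1 ha hb hab
  · rw [heta]
    exact convex_etaRange _ _ (hψ s).2 (hφ s).2 ha hb hab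
  · have h1 := hψv v
    have h2 := hφv v
    rw [finsum_vertex_eq] at h1 h2 ⊢
    have h3 : ∀ s : T.S, (if vertex s = v then (a • ψ + b • φ) s else 0) =
        a * (if vertex s = v then ψ s else 0) + b * (if vertex s = v then φ s else 0) := by
      intro s
      split_ifs <;> simp
    rw [Finset.sum_congr rfl fun s _ => h3 s, Finset.sum_add_distrib, ← Finset.mul_sum,
      ← Finset.mul_sum, h1, h2, ← add_mul, hab, one_mul]

/-- For `χ ≤ 0` a coherent angle system is given by positive angles `y e` and `z e` at the two ends
of each edge `e`, with the sum `θ e` if `χ = 0` and a smaller sum if `χ < 0`, that add up to `π` at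
each vertex. -/
theorem nonempty_FDeltaSigma_of [Fintype T.E] [DecidableEq T.V] (θ : T.E → ℝ)
    (hχ : T.eulerChar ≤ 0) {a b : T.E → T.V} (hab : ∀ e, a e ≠ b e)
    (hinc : ∀ (v : T.V) (e : T.E), (v : X) ∈ (e : Set X) ↔ v = a e ∨ v = b e) {y z : T.E → ℝ}
    (hy : ∀ e, 0 < y e) (hz : ∀ e, 0 < z e) (h0 : T.eulerChar = 0 → ∀ e, y e + z e = θ e)
    (h1 : T.eulerChar < 0 → ∀ e, y e + z e < θ e)
    (hsum : ∀ v, ∑ e, ((if a e = v then y e else 0) + (if b e = v then z e else 0)) = π) :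
    (T.FDeltaSigma θ).Nonempty := by
  classical
  have := T.finite_S
  let _ : Fintype T.S := Fintype.ofFinite T.S
  let ψ : T.S → ℝ := fun s => if vertex s = a (edge s) then y (edge s) else z (edge s)
  have hpair : ∀ s, (ψ s = y (edge s) ∧ ψ (rev s) = z (edge s)) ∨
      (ψ s = z (edge s) ∧ ψ (rev s) = y (edge s)) := by
    intro s
    have hr := edge_rev s
    have hne := vertex_rev_ne s
    have hs := (hinc (vertex s) (edge s)).1 s.2
    have hs' := (hinc (vertex (rev s)) (edge (rev s))).1 (rev s).2
    rw [hr] at hs'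
    simp only [ψ, hr]
    by_cases h : vertex s = a (edge s)
    · have h' : vertex (rev s) ≠ a (edge s) := fun h' => hne (h'.trans h.symm)
      exact Or.inl ⟨if_pos h, if_neg h'⟩
    · have h' : vertex (rev s) = a (edge s) := by
        refine hs'.resolve_right fun h' => hne ?_
        rw [h', hs.resolve_left h]
      exact Or.inr ⟨if_neg h, if_pos h'⟩
  have heta : ∀ s, etaHat θ ψ s = (y (edge s) + z (edge s) - θ (edge s)) / 2 := by
    intro s
    unfold etaHat
    rcases hpair s with ⟨h, h'⟩ | ⟨h, h'⟩ <;> rw [h, h']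
    rw [add_comm (z _)]
  refine ⟨ψ, fun s => ?_, fun v => ?_⟩
  · have hye := hy (edge s)
    have hze := hz (edge s)
    have hle : y (edge s) + z (edge s) ≤ θ (edge s) := by
      rcases hχ.lt_or_eq with h | h
      · exact (h1 h _).le
      · exact (h0 h _).le
    refine ⟨?_, ?_⟩
    · rw [psiHat, heta]
      rcases hpair s with ⟨h, -⟩ | ⟨h, -⟩ <;> rw [h] <;> constructor <;> linarith
    · rw [heta, etaRange, if_neg (not_lt.2 hχ)]
      split_ifs with h
      · rw [h0 h]
        simp
      · have := h1 (lt_of_le_of_ne hχ h) (edge s)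
        constructor <;> linarith
  · rw [finsum_vertex_eq, ← hsum v, ← Finset.sum_fiberwise (s := Finset.univ) (g := edge)]
    refine Finset.sum_congr rfl fun e _ => ?_
    let sa : T.S := ⟨(e, a e), (hinc _ _).2 (Or.inl rfl)⟩
    let sb : T.S := ⟨(e, b e), (hinc _ _).2 (Or.inr rfl)⟩
    have hfib : (Finset.univ.filter fun s : T.S => edge s = e) = {sa, sb} := by
      ext s
      simp only [Finset.mem_filter, Finset.mem_univ, true_and, Finset.mem_insert,
        Finset.mem_singleton]
      constructor
      · intro h
        rcases (hinc (vertex s) (edge s)).1 s.2 with h' | h'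
        · exact Or.inl (Subtype.ext (Prod.ext h (h'.trans (by rw [h]))))
        · exact Or.inr (Subtype.ext (Prod.ext h (h'.trans (by rw [h]))))
      · rintro (rfl | rfl) <;> rfl
    have hne : sa ≠ sb := fun h => hab e (congrArg vertex h)
    rw [hfib, Finset.sum_pair hne]
    have hψa : ψ sa = y e := if_pos rfl
    have hψb : ψ sb = z e := if_neg (hab e).symm
    rw [hψa, hψb]
    have hva : vertex sa = a e := rfl
    have hvb : vertex sb = b e := rfl
    by_cases h₁ : a e = v <;> by_cases h₂ : b e = v <;> simp [hva, hvb, h₁, h₂]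

end CellDecomposition

theorem lemma2 {X Y : Type*} [TopologicalSpace X] [T2Space X] [CompactSpace X] [ConnectedSpace X]
    [ChartedSpace (EuclideanSpace ℝ (Fin 2)) X]
    [TopologicalSpace Y] [SimplyConnectedSpace Y] (u : Y → X) (hu : IsCoveringMap u)
    (T : CellDecomposition u) (θ : T.E → ℝ) (hθ : T.IsPolyhedral θ) (hχ : T.eulerChar ≤ 0) :
    Convex ℝ (T.FDeltaSigma θ) ∧ (T.FDeltaSigma θ).Nonempty := by
  classical
  refine ⟨CellDecomposition.convex_FDeltaSigma θ, ?_⟩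
  have := hu.t2Space
  let _ : ChartedSpace (EuclideanSpace ℝ (Fin 2)) Y := hu.chartedSpace
  have : LocallyPathConnectedSpace Y :=
    ChartedSpace.locallyPathConnectedSpace (EuclideanSpace ℝ (Fin 2)) Y
  let _ : Fintype T.V := T.finite_verts.fintype
  let _ : Fintype T.E := T.finite_edges.fintype
  let _ : Fintype T.F := T.finite_cells.fintype
  have hχe : T.eulerChar = Fintype.card T.V - Fintype.card T.E + Fintype.card T.F := by
    rw [CellDecomposition.eulerChar, ← Nat.card_coe_set_eq, ← Nat.card_coe_set_eq,
      ← Nat.card_coe_set_eq, Nat.card_eq_fintype_card, Nat.card_eq_fintype_card,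
      Nat.card_eq_fintype_card]
  have hχ' : Fintype.card T.V + Fintype.card T.F ≤ Fintype.card T.E := by
    rw [hχe] at hχ
    omega
  set M := T.periodicMap hu with hM
  have hw : M.IsPolyhedralWeight fun e => π - θ e := hθ.isPolyhedralWeight hu
  choose a b hab hinc using M.exists_ends
  have hmem : ∀ (v : T.V) (e : T.E), (v : X) ∈ (e : Set X) ↔ v = a e ∨ v = b e := by
    intro v e
    rw [← hinc]
    constructor
    · intro h
      obtain ⟨_, x, hx, rfl⟩ := v
      obtain ⟨_, e, he, rfl⟩ := e
      obtain ⟨y, hy, hyx⟩ := h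
      obtain ⟨g, rfl⟩ := Deck.exists_apply_eq hu hyx.symm
      exact ⟨⟨_, T.deck_mem_verts.2 hx⟩, ⟨e, he⟩, Subtype.ext (g.2 x), rfl, hy⟩
    · rintro ⟨x, e', rfl, rfl, h⟩
      exact ⟨x, h, rfl⟩
  have hmeets : ∀ A : Finset T.V, M.meets A = Finset.univ.filter fun e => a e ∈ A ∨ b e ∈ A := by
    intro A
    ext e
    rw [M.mem_meets, Finset.mem_filter]
    simp only [hinc, Finset.mem_univ, true_and]
    constructor
    · rintro ⟨v, hv, rfl | rfl⟩ <;> simp [hv]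
    · rintro (h | h)
      · exact ⟨_, h, Or.inl rfl⟩
      · exact ⟨_, h, Or.inr rfl⟩
  have hA : ∀ A : Finset T.V, A.Nonempty → (A : Set T.V) ≠ univ →
      π * A.card < ∑ e with a e ∈ A ∨ b e ∈ A, θ e := by
    intro A h h'
    have := hw.lt_sum_meets hχ' h h'
    simpa [hmeets] using this
  have htot : ∑ e, θ e = π * Fintype.card T.E - π * Fintype.card T.F := by
    have := hw.sum_eq
    rw [Finset.sum_sub_distrib, Finset.sum_const, nsmul_eq_mul, Finset.card_univ] at this
    linarith
  have hθ0 : ∀ e, 0 < θ e := fun e => (hθ.1 e).1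
  rcases hχ.lt_or_eq with hneg | hzero
  · have hlt : (Fintype.card T.V + Fintype.card T.F : ℝ) < Fintype.card T.E := by
      rw [hχe] at hneg
      exact_mod_cast (by omega : Fintype.card T.V + Fintype.card T.F < Fintype.card T.E)
    obtain ⟨y, z, hyz, hsum⟩ := exists_vertexSum_eq_of_lt hab hθ0 Real.pi_pos fun A hne => by
      by_cases h : (A : Set T.V) = univ
      · rw [Finset.coe_eq_univ] at h
        subst h
        simp only [Finset.mem_univ, or_self, Finset.filter_true, Finset.card_univ, htot]
        nlinarith [Real.pi_pos]
      · exact hA A hne h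
    exact CellDecomposition.nonempty_FDeltaSigma_of θ hχ hab hmem (fun e => (hyz e).1)
      (fun e => (hyz e).2.1) (fun h => absurd h hneg.ne) (fun _ e => (hyz e).2.2) hsum
  · have heq : (Fintype.card T.V + Fintype.card T.F : ℝ) = Fintype.card T.E := by
      rw [hχe] at hzero
      exact_mod_cast (by omega : Fintype.card T.V + Fintype.card T.F = Fintype.card T.E)
    obtain ⟨x, hx, hsum⟩ := exists_vertexSum_eq hab hθ0 π hA (by rw [htot, ← heq]; ring)
    exact CellDecomposition.nonempty_FDeltaSigma_of θ hχ hab hmem (fun e => (hx e).1)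
      (fun e => sub_pos.2 (hx e).2) (fun _ e => add_sub_cancel _ _)
      (fun h => absurd h (by rw [hzero]; exact lt_irrefl 0)) hsum
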